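/- **Theorem 3.1.** Quantum circuits are sequences of Hadamard gates $\mathsf{H}$ and Toffoli gates, and their size is the number of gates. On an $n$-bit input $x$ such a circuit $U$ is started on $|x,0^m\rangle$ for some $m$, and for $b\in\{0,1\}$, $\Pr[U(x)=b]$ is the probability that measuring its first qubit gives $b$. A circuit class $\mathcal{C}$ assigns to all $n,s\in\mathbb{N}$ a set $\mathcal{C}_n[s]$ of Boolean functions on $\{0,1\}^n$ (those computed by $\mathcal{C}$-circuits of size at most $s$); nothing else is assumed about it. For $f\colon\{0,1\}^n\to\{0,1\}$ let $\mathsf{tt}(f)\in\{0,1\}^{2^n}$ be its truth table. *Learning.* Let $T\colon\mathbb{N}\to\mathbb{N}$ and $\varepsilon,\delta\colon\mathbb{N}\to\mathbb{R}$. We say that $\mathcal{C}[n^k]$ is $(\varepsilon,\delta)$-learned under the uniform distribution in quantum time $T$ if there are quantum circuits $(Q_n)_{n\ge1}$, started on $|0\ldots0\rangle$, such that: - $Q_n$ has at most $T(n)$ gates from $\mathsf{H}$, $\mathsf{Toff}$ and queries $O_f\colon|x,b\rangle\mapsto|x,b\oplus f(x)\rangle$; intermediate measurements are also allowed and are not counted;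 - one deterministic algorithm prints $Q_n$ on input $1^n$ in time $\mathrm{poly}(n,T(n))$; - for every $n\ge1$ and every $f\in\mathcal{C}_n[n^k]$, with probability at least $1-\delta(n)$ the measured output of $Q_n$ with oracle $O_f$ is the description of a quantum circuit $U$ with $\mathbb{E}_{x\sim\{0,1\}^n}\big[\Pr[U(x)=f(x)]\big]\ge 1-\varepsilon(n)$. *Natural property.* There is a promise $\mathsf{BQP}$-natural property against $\mathcal{C}[n^k]$ if there are quantum circuits $(D_n)$ such that for all large enough $n$, with $N=2^n$: - (constructiveness) $D_n$ takes $N$-bit inputs, has $\mathrm{poly}(N)$ gates, and is printed by one deterministic algorithm on input $1^N$ in time $\mathrm{poly}(N)$; - (hardness) $\Pr[D_n(\mathsf{tt}(f))=1]\le 1/3$ for every $f\in\mathcal{C}_n[n^k]$; - (density) there is $\Gamma_n\subseteq\{0,1\}^N$ with $|\Gamma_n|/2^N\ge 1/2$ such that every $w\in\Gamma_n$ is the truth table of a function outside $\mathcal{C}_n[n^k]$ and $\Pr[D_n(w)=1]\ge 2/3$. *Claim.* There is a universal constant $\lambda\ge1$ such that the following holds for every circuit class $\mathcal{C}$, every $k\in\mathbb{N}$,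 every $\gamma\colon\mathbb{N}\to[0,1/2]$, every $\delta,\varepsilon\colon\mathbb{N}\to\mathbb{R}$ and every $T\colon\mathbb{N}\to\mathbb{N}$. Suppose that for all large enough $n$ $$\gamma(n)\ge\lambda\,2^{-n/2},\qquad T(n)\le \frac{\gamma(n)^2\,2^n}{\lambda n},\qquad \delta(n)\le 0.99,\qquad \varepsilon(n)\le\tfrac12-\gamma(n).$$ If $\mathcal{C}[n^k]$ is $(\varepsilon,\delta)$-learned under the uniform distribution in quantum time $T$, then there is a promise $\mathsf{BQP}$-natural property against $\mathcal{C}[n^k]$. -/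

import Mathlib

open Filter

namespace QLearn

/-! ### Boolean functions, truth tables, circuit classes -/

/-- Boolean functions on `n` input bits. -/
abbrev BoolFun (n : ℕ) : Type := (Fin n → Bool) → Bool

/-- A circuit class `𝒞`, seen as a family of concept classes: `𝒞 n s` is the set of Boolean
functions on `n` bits that are computed by a `𝒞`-circuit of size at most `s`.  Nothing is assumed
about the class. -/
abbrev CircuitClass : Type := (n : ℕ) → ℕ → Set (BoolFun n)

/-- The truth table of `f`, a string of `2 ^ n` bits: its `i`-th bit is the value of `f` on the
`n` binary digits of `i`. -/
def tt {n : ℕ} (f : BoolFun n) : Fin (2 ^ n) → Bool :=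
  fun i => f fun j => i.val.testBit j.val

/-! ### Quantum circuits

Qubits are indexed by natural numbers.  All but finitely many of them are in state `|0⟩` at any
time, so that a state is a finite linear combination of basis states and the number of auxiliary
qubits needs no bookkeeping: those that a circuit never touches do not influence its output. -/

/-- A computational basis state: the values of all the qubits. -/
abbrev Basis : Type := ℕ → Bool

/-- A (possibly unnormalised) state: a finite linear combination of basis states. -/
abbrev QState : Type := Basis →₀ ℂ

/-- The basis state `|x, 0, 0, …⟩`. -/
def inputBasis {n : ℕ} (x : Fin n → Bool) : Basis :=
  fun q => if h : q < n then x ⟨q, h⟩ else false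

/-- The state `|b⟩`. -/
noncomputable def ket (b : Basis) : QState := Finsupp.single b 1

/-- The linear extension of a map given on basis states. -/
noncomputable def linExt (U : Basis → QState) (ψ : QState) : QState :=
  ψ.sum fun b α => α • U b

open Classical in
/-- The total weight `∑ |α_b|²` of `ψ` on the basis states in `E`; for a normalised state this is
the probability that a measurement of all the qubits gives an outcome in `E`. -/
noncomputable def weight (ψ : QState) (E : Set Basis) : ℝ :=
  ψ.sum fun b α => if b ∈ E then ‖α‖ ^ 2 else 0

/-- The gates: Hadamard on qubit `q`, and Toffoli with controls `a`, `b` and target `c`. -/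
inductive Gate : Type
  | had (q : ℕ)
  | toff (a b c : ℕ)

namespace Gate

/-- The qubits a gate acts on. -/
def qubits : Gate → List ℕ
  | had q => [q]
  | toff a b c => [a, b, c]

/-- A gate acts on distinct qubits. -/
def WF (g : Gate) : Prop := g.qubits.Nodup

/-- The action on basis states:
`H |b⟩ = (|0⟩ + (-1)^b |1⟩) / √2` and `Toff |b₁, b₂, b₃⟩ = |b₁, b₂, b₃ ⊕ b₁ b₂⟩`. -/
noncomputable def act : Gate → Basis → QState
  | had q, b => ((1 / Real.sqrt 2 : ℝ) : ℂ) •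
      (ket (Function.update b q false) +
        (if b q then (-1 : ℂ) else 1) • ket (Function.update b q true))
  | toff p q r, b => ket (Function.update b r (xor (b r) (b p && b q)))

end Gate

/-- A quantum circuit: a sequence of gates, the first one being applied first.  Its size is its
length. -/
abbrev Circuit : Type := List Gate

namespace Circuit

/-- Every gate acts on distinct qubits. -/
def WF (U : Circuit) : Prop := ∀ g ∈ U, g.WF

/-- `U` is a circuit on the `m` qubits `0, …, m - 1`. -/
def OnQubits (m : ℕ) (U : Circuit) : Prop := U.WF ∧ ∀ g ∈ U, ∀ q ∈ g.qubits, q < m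

/-- The state after running the circuit. -/
noncomputable def run (U : Circuit) (ψ : QState) : QState :=
  U.foldl (fun φ g => linExt g.act φ) ψ

/-- `Pr[U(x) = v] = ‖Π_v U |x, 0⟩‖²`: the probability that measuring the first qubit of `U` on
input `x` (and auxiliary qubits `0`) gives `v`. -/
noncomputable def prob (U : Circuit) {n : ℕ} (x : Fin n → Bool) (v : Bool) : ℝ :=
  weight (U.run (ket (inputBasis x))) {b | b 0 = v}

/-- The expected agreement of `U` and `f` over a uniformly random input. -/
noncomputable def agreement (U : Circuit) {n : ℕ} (f : BoolFun n) : ℝ :=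
  (∑ x : Fin n → Bool, U.prob x (f x)) / 2 ^ n

/-- `w` binary digits of a qubit address. -/
def addr (w q : ℕ) : List Bool := (List.range w).map fun j => q.testBit j

/-- The code of a gate with addresses of `w` bits: a bit announcing a gate, a bit for its kind,
and three address fields, of which a Hadamard gate uses the first. -/
def gateCode (w : ℕ) : Gate → List Bool
  | Gate.had q => [true, false] ++ addr w q ++ List.replicate (2 * w) false
  | Gate.toff a b c => [true, true] ++ addr w a ++ addr w b ++ addr w c

/-- The binary description `code(U)` of a circuit on `m` qubits: the number `m` in unary, the codes
of the gates with addresses of `⌈log₂ (m + 1)⌉` bits, and an end marker.  The code is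
self-delimiting. -/
def code (m : ℕ) (U : Circuit) : List Bool :=
  List.replicate m false ++ [true] ++ U.flatMap (gateCode (Nat.size m)) ++ [false]

end Circuit

/-! ### Quantum circuits with quantum membership queries -/

/-- Operations of a learner: a gate, a query to the oracle
`O_f : |x, b⟩ ↦ |x, b ⊕ f(x)⟩`, where `x` is held by the qubits `xs` and `b` by the qubit `t`, and
an intermediate measurement of a qubit in the computational basis. -/
inductive OracleGate : Type
  | gate (g : Gate)
  | query (xs : List ℕ) (t : ℕ)
  | meas (q : ℕ)

namespace OracleGate

/-- Gates and queries act on distinct qubits, and a query has `n` input qubits. -/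
def WF (n : ℕ) : OracleGate → Prop
  | gate g => g.WF
  | query xs t => xs.length = n ∧ (t :: xs).Nodup
  | meas _ => True

/-- Gates and queries are counted in the running time, measurements are not. -/
def cost : OracleGate → ℕ
  | gate _ => 1
  | query _ _ => 1
  | meas _ => 0

end OracleGate

/-- The action of `O_f` on basis states. -/
noncomputable def queryAct {n : ℕ} (f : BoolFun n) (xs : List ℕ) (t : ℕ) (b : Basis) : QState :=
  ket (Function.update b t (xor (b t) (f fun j => b (xs.getD j.val 0))))

/-- The probability that a sequence of operations, started in the state `ψ`, ends (after a final
measurement of all the qubits) in a basis state belonging to `E`.  An intermediate measurement of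
qubit `q` splits the computation into the two (unnormalised) branches in which `q` was found to be
`0` and to be `1`. -/
noncomputable def finalProb {n : ℕ} (f : BoolFun n) (E : Set Basis) :
    List OracleGate → QState → ℝ
  | [], ψ => weight ψ E
  | OracleGate.gate g :: c, ψ => finalProb f E c (linExt g.act ψ)
  | OracleGate.query xs t :: c, ψ => finalProb f E c (linExt (queryAct f xs t) ψ)
  | OracleGate.meas q :: c, ψ =>
      finalProb f E c (ψ.filter fun b => b q = false) +
        finalProb f E c (ψ.filter fun b => b q = true)

/-- An oracle circuit started on `|0, 0, …⟩`, whose output is the string obtained by measuring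
its first `outLen` qubits. -/
structure OracleCircuit : Type where
  gates : List OracleGate
  outLen : ℕ

namespace OracleCircuit

def WF (n : ℕ) (Q : OracleCircuit) : Prop := ∀ g ∈ Q.gates, g.WF n

/-- The number of gates. -/
def size (Q : OracleCircuit) : ℕ := (Q.gates.map OracleGate.cost).sum

/-- The probability that `Q`, with oracle `f`, outputs a string in `S`. -/
noncomputable def outputProb (Q : OracleCircuit) {n : ℕ} (f : BoolFun n)
    (S : Set (List Bool)) : ℝ :=
  finalProb f {b | (List.range Q.outLen).map b ∈ S} Q.gates (ket fun _ => false)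

end OracleCircuit

/-! ### Deterministic algorithms with a step count -/

/-- Programs over finitely many registers, each holding a stack of bits.  Every elementary step
pushes or pops one bit or branches on the top of one stack, so these are deterministic multi-tape
Turing machines (a tape being two stacks) with structured control flow. -/
inductive Prog : Type
  | skip
  | push (r : ℕ) (v : Bool)
  | pop (r : ℕ)
  | seq (p q : Prog)
  /-- Continue with the first, second or third program, when stack `r` is empty, has top `0`, or
  has top `1`. -/
  | branch (r : ℕ) (pe p0 p1 : Prog)
  /-- While stack `r` is not empty, do `p`. -/
  | loop (r : ℕ) (p : Prog)

/-- The contents of the registers; the head of a list is the top of the stack. -/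
abbrev Mem : Type := ℕ → List Bool

/-- `Runs p m m' t`: started with memory `m`, the program `p` halts with memory `m'` after `t`
steps. -/
inductive Prog.Runs : Prog → Mem → Mem → ℕ → Prop
  | skip (m : Mem) : Runs Prog.skip m m 1
  | push (r : ℕ) (v : Bool) (m : Mem) :
      Runs (Prog.push r v) m (Function.update m r (v :: m r)) 1
  | pop (r : ℕ) (m : Mem) : Runs (Prog.pop r) m (Function.update m r (m r).tail) 1
  | seq {p q : Prog} {m₁ m₂ m₃ : Mem} {s t : ℕ} :
      Runs p m₁ m₂ s → Runs q m₂ m₃ t → Runs (Prog.seq p q) m₁ m₃ (s + t)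
  | branchEmpty {r : ℕ} {pe p0 p1 : Prog} {m m' : Mem} {t : ℕ} :
      (m r).head? = none → Runs pe m m' t → Runs (Prog.branch r pe p0 p1) m m' (t + 1)
  | branchZero {r : ℕ} {pe p0 p1 : Prog} {m m' : Mem} {t : ℕ} :
      (m r).head? = some false → Runs p0 m m' t → Runs (Prog.branch r pe p0 p1) m m' (t + 1)
  | branchOne {r : ℕ} {pe p0 p1 : Prog} {m m' : Mem} {t : ℕ} :
      (m r).head? = some true → Runs p1 m m' t → Runs (Prog.branch r pe p0 p1) m m' (t + 1)
  | loopDone {r : ℕ} {p : Prog} {m : Mem} : m r = [] → Runs (Prog.loop r p) m m 1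
  | loopStep {r : ℕ} {p : Prog} {m₁ m₂ m₃ : Mem} {s t : ℕ} :
      m₁ r ≠ [] → Runs p m₁ m₂ s → Runs (Prog.loop r p) m₂ m₃ t →
        Runs (Prog.loop r p) m₁ m₃ (s + t + 1)

/-- On input `x` (in register `0`, the others being empty) the program halts within `T` steps with
output `y` in register `1`. -/
def Prog.Outputs (p : Prog) (x y : List Bool) (T : ℕ) : Prop :=
  ∃ (m : Mem) (t : ℕ), t ≤ T ∧ p.Runs (fun r => if r = 0 then x else []) m t ∧ m 1 = y

/-! ### Uniformity

The description that a uniformity algorithm prints lists the gates and the qubits they act on, in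
order, all numbers being written in unary; up to a polynomial, which is immaterial here, this is as
good as any other description. -/

/-- A list of numbers, each written as `1^k 0`. -/
def unary (l : List ℕ) : List Bool := l.flatMap fun k => List.replicate k true ++ [false]

def Gate.tokens : Gate → List ℕ
  | Gate.had q => [0, q]
  | Gate.toff a b c => [1, a, b, c]

def OracleGate.tokens : OracleGate → List ℕ
  | OracleGate.gate g => g.tokens
  | OracleGate.query xs t => 2 :: xs.length :: t :: xs
  | OracleGate.meas q => [3, q]

/-- The description of a quantum circuit printed by a uniformity algorithm. -/
def Circuit.listing (U : Circuit) : List Bool := unary (U.flatMap Gate.tokens)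

/-- The description of an oracle circuit printed by a uniformity algorithm. -/
def OracleCircuit.listing (Q : OracleCircuit) : List Bool :=
  unary (Q.outLen :: Q.gates.flatMap OracleGate.tokens)

/-! ### Learners and natural properties -/

/-- The string `z` is (up to padding at its end) the description of a quantum circuit `U`, with at
least `n` qubits, whose expected agreement with `f` is at least `1 - ε`. -/
def IsGoodHypothesis {n : ℕ} (f : BoolFun n) (ε : ℝ) (z : List Bool) : Prop :=
  ∃ (m : ℕ) (U : Circuit), n ≤ m ∧ U.OnQubits m ∧ U.code m <+: z ∧ 1 - ε ≤ U.agreement f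

/-- `𝒞 = ⋃ 𝒞ₙ` can be `(ε, δ)`-learned under the uniform distribution in quantum time `T`, with
quantum membership queries and quantum hypotheses: there are oracle circuits `Q n` with at most
`T n` gates, printed by one deterministic algorithm on input `1^n` in time polynomial in `n` and
`T n`, such that for all `n ≥ 1` and `f ∈ 𝒞ₙ` the circuit `Q n` with oracle `f` outputs a good
hypothesis with probability at least `1 - δ n`. -/
def QuantumLearnable (𝒞 : (n : ℕ) → Set (BoolFun n)) (T : ℕ → ℕ) (ε δ : ℕ → ℝ) : Prop :=
  ∃ (Q : ℕ → OracleCircuit) (p : Prog) (a : ℕ), ∀ n : ℕ, 1 ≤ n →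
    (Q n).WF n ∧ (Q n).size ≤ T n ∧
    p.Outputs (List.replicate n true) (Q n).listing (a * (n + T n) ^ a + a) ∧
    ∀ f ∈ 𝒞 n, 1 - δ n ≤ (Q n).outputProb f {z | IsGoodHypothesis f (ε n) z}

/-- There is a promise BQP-natural property against `𝒞 = ⋃ 𝒞ₙ`.  For all large `n` and
`N = 2 ^ n`, the tester `D n` operates on strings of `N` bits; it accepts when the measurement of
its first qubit gives `1`.
* Constructiveness: `D n` has polynomially many gates in `N`, and one deterministic algorithm
  prints it on input `1^N` in time polynomial in `N`.
* Hardness: truth tables of functions in `𝒞ₙ` are accepted with probability at most `1 / 3`.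
* Density: at least half of the strings of `N` bits are truth tables of functions outside `𝒞ₙ` and
  are accepted with probability at least `2 / 3`. -/
def HasPromiseBQPNaturalProperty (𝒞 : (n : ℕ) → Set (BoolFun n)) : Prop :=
  ∃ (D : ℕ → Circuit) (p : Prog) (a : ℕ), ∀ᶠ n : ℕ in atTop,
    ((D n).WF ∧ (D n).length ≤ a * (2 ^ n) ^ a + a ∧
      p.Outputs (List.replicate (2 ^ n) true) (D n).listing (a * (2 ^ n) ^ a + a)) ∧
    (∀ f ∈ 𝒞 n, (D n).prob (tt f) true ≤ 1 / 3) ∧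
    ∃ Γ : Finset (Fin (2 ^ n) → Bool), (1 / 2 : ℝ) ≤ (Γ.card : ℝ) / 2 ^ (2 ^ n) ∧
      ∀ w ∈ Γ, (∀ f : BoolFun n, tt f = w → f ∉ 𝒞 n) ∧ 2 / 3 ≤ (D n).prob w true

end QLearn

/-!
A learner for a class is turned into a test for membership in the class. Given the truth table of
`f`, the tester `naturalTester` runs the learner with `f` as its oracle, obtains a description `z`
of a hypothesis, and estimates on random inputs how well the hypothesis agrees with `f`. If `f`
belongs to the class then, with probability at least `1 / 100`, the agreement is at least
`1 / 2 + γ`. The tester therefore performs `200` such rounds and accepts if no round finds an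
agreement of about `1 / 2 + 2 g` or more, where `g` is a number with `g ≤ γ / 3` (`reject`).

*Density.* A measurement can find `1` only on qubits that the learner changes, of which there are
at most as many as it has gates, say `s`. So there are at most `2 ^ s` possible strings `z`,
whatever `f` is (`OracleCircuit.targets`, `outcomeExp_mono`). By Hoeffding's inequality a fixed
hypothesis has agreement `1 / 2 + g` with at most a fraction `exp (- 2 g² 2 ^ n)` of all functions
(`card_agreement_ge`), and by a union bound over the strings `z` at least half of all functions have
no such agreement with any hypothesis that the learner can produce (`half_le_card`). This needs
`2 g² 2 ^ n` to be a little larger than `s`. Such a `g ≤ γ / 3` exists, because `γ² 2 ^ n` is larger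
than both a multiple of `s` and a large constant; it is taken of the form `G / 2 ^ n` with `G` as
small as possible (`IsGap`). Functions without an agreement of `1 / 2 + g` are accepted (`accept`),
and they lie outside of the class, because a function that is learned agrees better than that with
some possible hypothesis (`exists_hypothesis`). The number of disagreements in `400 * 2 ^ n` samples
separates the two cases by Chebyshev's inequality (`variance_le`).

*The circuit.* The tester consists of Hadamard and Toffoli gates only.
* There is no negation, and no qubit is known to be in state `|1⟩`. Therefore two qubits receive the
  disjunction of eight conjunctions of two random bits each, so that they hold `1` except with
  probability `(3 / 4) ^ 8` (`prepareOr`), and serve as the constant `1` from then on.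
* Queries are answered by looking up the truth table, measurements are replaced by copying the
  qubit to a fresh one, and the gates of the hypothesis, which is only known at run time, are
  controlled by flags computed from `z`. A Hadamard gate is controlled by exchanging its qubit with
  a fresh one (`ctrlHad`). That such a coherent simulation has the same outcome probabilities as the
  original computation is `expect_run_simulation`; the description is decoded correctly by
  `decode_eq`.
* Parts of the circuit that change disjoint sets of qubits compose like the steps of a Markov chain
  on basis states (`Circuit.ex_append`). Hence quantum states appear only inside one simulation, and
  the analysis of the rounds is elementary probability (`prob_tester`).

*Uniformity.* The tester is given by nested `flatMap`s over ranges, whose entries are arithmetic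
expressions in `n`, in `2 ^ n` and in the description of the learner. Numbers, conditions, lists and
circuits that a `Prog` can compute in polynomial time from such data are closed under these
constructions (`NumE`, `CondE`, `PrintE`, `CircE`), which yields `CircE.naturalTester`. Since
`T n ≤ 2 ^ n`, the algorithm that prints the learner runs in time polynomial in `2 ^ n` as well, and
`exists_printer` combines the two.
-/

namespace QLearn

/-! ### Linearity of circuits and expected values of measurements -/

theorem linExt_eq_linearCombination (U : Basis → QState) (ψ : QState) :
    linExt U ψ = Finsupp.linearCombination ℂ U ψ := rfl

theorem linExt_add (U : Basis → QState) (ψ φ : QState) :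
    linExt U (ψ + φ) = linExt U ψ + linExt U φ := by
  simp [linExt_eq_linearCombination]

theorem linExt_smul (U : Basis → QState) (c : ℂ) (ψ : QState) :
    linExt U (c • ψ) = c • linExt U ψ := by
  simp [linExt_eq_linearCombination]

@[simp] theorem linExt_zero (U : Basis → QState) : linExt U 0 = 0 := by
  simp [linExt_eq_linearCombination]

@[simp] theorem linExt_ket (U : Basis → QState) (b : Basis) : linExt U (ket b) = U b := by
  simp [linExt_eq_linearCombination, ket]

theorem linExt_single (U : Basis → QState) (b : Basis) (c : ℂ) :
    linExt U (Finsupp.single b c) = c • U b := by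
  simp [linExt_eq_linearCombination]

theorem single_eq_smul_ket (b : Basis) (c : ℂ) : (Finsupp.single b c : QState) = c • ket b := by
  simp [ket]

namespace Circuit

@[simp] theorem run_nil (ψ : QState) : run [] ψ = ψ := rfl

@[simp] theorem run_cons (g : Gate) (U : Circuit) (ψ : QState) :
    run (g :: U) ψ = run U (linExt g.act ψ) := rfl

theorem run_append (U V : Circuit) (ψ : QState) : run (U ++ V) ψ = run V (run U ψ) := by
  simp [run, List.foldl_append]

theorem run_add (U : Circuit) (ψ φ : QState) : run U (ψ + φ) = run U ψ + run U φ := by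
  induction U generalizing ψ φ with
  | nil => rfl
  | cons g U ih => simp [linExt_add, ih]

theorem run_smul (U : Circuit) (c : ℂ) (ψ : QState) : run U (c • ψ) = c • run U ψ := by
  induction U generalizing ψ with
  | nil => rfl
  | cons g U ih => simp [linExt_smul, ih]

@[simp] theorem run_zero (U : Circuit) : run U 0 = 0 := by
  induction U with
  | nil => rfl
  | cons g U ih => simp [ih]

/-- A circuit as a linear map on states. -/
noncomputable def runLin (U : Circuit) : QState →ₗ[ℂ] QState where
  toFun := run U
  map_add' := run_add U
  map_smul' := run_smul U

theorem run_eq_sum (U : Circuit) (ψ : QState) :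
    run U ψ = ∑ b ∈ ψ.support, ψ b • run U (ket b) := by
  have h : ψ = ∑ b ∈ ψ.support, ψ b • ket b := by
    conv_lhs => rw [← Finsupp.sum_single ψ]
    simp [Finsupp.sum, ket]
  conv_lhs => rw [h]
  change runLin U _ = _
  rw [map_sum]
  exact Finset.sum_congr rfl fun b _ => run_smul U _ _

end Circuit

/-- The expected value of `g` on the outcome of measuring all qubits of `ψ`. -/
noncomputable def expect (ψ : QState) (g : Basis → ℝ) : ℝ := ψ.sum fun b α => ‖α‖ ^ 2 * g b

theorem weight_eq_expect (ψ : QState) (E : Set Basis) :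
    weight ψ E = expect ψ (E.indicator 1) := by
  classical
  unfold weight expect
  refine Finsupp.sum_congr fun b _ => ?_
  by_cases h : b ∈ E <;> simp [h]

@[simp] theorem expect_zero (g : Basis → ℝ) : expect 0 g = 0 := by simp [expect]

@[simp] theorem expect_ket (b : Basis) (g : Basis → ℝ) : expect (ket b) g = g b := by
  simp [expect, ket]

theorem expect_smul (c : ℂ) (ψ : QState) (g : Basis → ℝ) :
    expect (c • ψ) g = ‖c‖ ^ 2 * expect ψ g := by
  unfold expect
  rw [Finsupp.sum_of_support_subset (c • ψ) Finsupp.support_smul _ (by simp), Finsupp.sum,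
    Finset.mul_sum]
  refine Finset.sum_congr rfl fun b _ => ?_
  simp; ring

theorem expect_add_of_disjoint {ψ φ : QState} (h : Disjoint ψ.support φ.support)
    (g : Basis → ℝ) : expect (ψ + φ) g = expect ψ g + expect φ g := by
  classical
  unfold expect
  exact Finsupp.sum_add_index_of_disjoint h _

theorem expect_sum_of_disjoint {ι : Type*} (s : Finset ι) (v : ι → QState)
    (h : ∀ i ∈ s, ∀ j ∈ s, i ≠ j → Disjoint (v i).support (v j).support) (g : Basis → ℝ) :
    expect (∑ i ∈ s, v i) g = ∑ i ∈ s, expect (v i) g := by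
  classical
  induction s using Finset.induction_on with
  | empty => simp
  | insert i s hi ih =>
    rw [Finset.sum_insert hi, Finset.sum_insert hi, expect_add_of_disjoint, ih]
    · exact fun j hj k hk => h j (Finset.mem_insert_of_mem hj) k (Finset.mem_insert_of_mem hk)
    · rw [Finset.disjoint_left]
      intro b hb hb'
      obtain ⟨j, hj, hbj⟩ := Finset.mem_biUnion.1 (Finsupp.support_finsetSum hb')
      have := h i (Finset.mem_insert_self _ _) j (Finset.mem_insert_of_mem hj)
        (fun e => hi (e ▸ hj))
      exact Finset.disjoint_left.1 this hb hbj

theorem expect_congr {ψ : QState} {g g' : Basis → ℝ} (h : ∀ b ∈ ψ.support, g b = g' b) :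
    expect ψ g = expect ψ g' :=
  Finset.sum_congr rfl fun b hb => by simp only [h b hb]

theorem expect_mono {ψ : QState} {g g' : Basis → ℝ} (h : ∀ b ∈ ψ.support, g b ≤ g' b) :
    expect ψ g ≤ expect ψ g' :=
  Finset.sum_le_sum fun b hb => mul_le_mul_of_nonneg_left (h b hb) (by positivity)

theorem expect_add (ψ : QState) (g g' : Basis → ℝ) :
    expect ψ (fun b => g b + g' b) = expect ψ g + expect ψ g' := by
  simp [expect, Finsupp.sum, mul_add, Finset.sum_add_distrib]

theorem expect_const_mul (ψ : QState) (c : ℝ) (g : Basis → ℝ) :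
    expect ψ (fun b => c * g b) = c * expect ψ g := by
  simp only [expect, Finsupp.sum, Finset.mul_sum]
  exact Finset.sum_congr rfl fun b _ => by ring

theorem expect_mapDomain {τ : Basis → Basis} (ψ : QState) (hτ : Set.InjOn τ ψ.support)
    (g : Basis → ℝ) : expect (ψ.mapDomain τ) g = expect ψ (g ∘ τ) := by
  classical
  unfold expect
  rw [Finsupp.sum, Finsupp.mapDomain_support_of_injOn ψ hτ, Finset.sum_image hτ]
  refine Finset.sum_congr rfl fun b hb => ?_
  rw [Finsupp.mapDomain_apply' (S := (ψ.support : Set Basis)) _ subset_rfl hτ hb]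
  rfl

/-! ### Targets of gates -/

/-- The only qubit whose value a gate changes; a Toffoli gate merely reads its controls. -/
def Gate.target : Gate → ℕ
  | Gate.had q => q
  | Gate.toff _ _ c => c

/-- The qubits that are targets of gates of `U`. -/
def Circuit.targets (U : Circuit) : Set ℕ := {q | ∃ g ∈ U, g.target = q}

namespace Circuit

@[simp] theorem targets_nil : targets [] = ∅ := by ext; simp [targets]

@[simp] theorem targets_cons (g : Gate) (U : Circuit) :
    targets (g :: U) = insert g.target (targets U) := by
  ext q; simp [targets, eq_comm]

@[simp] theorem targets_append (U V : Circuit) : targets (U ++ V) = targets U ∪ targets V := by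
  ext q; simp [targets, or_and_right, exists_or]

@[simp] theorem targets_flatMap {α : Type*} (l : List α) (F : α → Circuit) :
    targets (l.flatMap F) = ⋃ a ∈ l, targets (F a) := by
  ext q; simp only [targets, List.mem_flatMap, Set.mem_ofPred_eq, Set.mem_iUnion]
  constructor
  · rintro ⟨g, ⟨a, ha, hg⟩, h⟩; exact ⟨a, ha, g, hg, h⟩
  · rintro ⟨a, ha, g, hg, h⟩; exact ⟨g, ⟨a, ha, hg⟩, h⟩

theorem WF.append {U V : Circuit} (hU : U.WF) (hV : V.WF) : WF (U ++ V) := by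
  intro g hg
  rcases List.mem_append.1 hg with h | h
  exacts [hU g h, hV g h]

theorem WF.flatMap {α : Type*} {l : List α} {F : α → Circuit} (h : ∀ a ∈ l, (F a).WF) :
    WF (l.flatMap F) := by
  intro g hg
  obtain ⟨a, ha, hg⟩ := List.mem_flatMap.1 hg
  exact h a ha g hg

theorem wf_nil : WF [] := by simp [WF]

theorem wf_cons {g : Gate} {U : Circuit} : WF (g :: U) ↔ g.WF ∧ U.WF := by simp [WF]

end Circuit

theorem Gate.mem_support_act {g : Gate} {b b' : Basis} (h : b' ∈ (g.act b).support) (q : ℕ)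
    (hq : q ≠ g.target) : b' q = b q := by
  classical
  cases g with
  | had p =>
    rw [Finsupp.mem_support_iff] at h
    simp only [Gate.target] at hq
    have : b' = Function.update b p false ∨ b' = Function.update b p true := by
      by_contra hc
      push Not at hc
      apply h
      cases hb : b p <;> simp [Gate.act, ket, hb, Ne.symm hc.1, Ne.symm hc.2]
    rcases this with rfl | rfl <;> simp [hq]
  | toff x y z =>
    simp only [Gate.target] at hq
    simp only [Gate.act, ket] at h
    have := Finsupp.support_single_subset h
    simp at this
    subst this
    simp [hq]

theorem Circuit.mem_support_run {U : Circuit} {ψ : QState} {b' : Basis}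
    (h : b' ∈ (U.run ψ).support) : ∃ b ∈ ψ.support, ∀ q ∉ U.targets, b' q = b q := by
  classical
  induction U generalizing ψ with
  | nil => exact ⟨b', h, fun _ _ => rfl⟩
  | cons g U ih =>
    obtain ⟨b₁, hb₁, h₁⟩ := ih (ψ := linExt g.act ψ) h
    have := Finsupp.support_sum hb₁
    obtain ⟨b, hb, hb₂⟩ := Finset.mem_biUnion.1 this
    have hb₃ := Finsupp.support_smul hb₂
    refine ⟨b, hb, fun q hq => ?_⟩
    simp only [targets_cons, Set.mem_insert_iff, not_or] at hq
    rw [h₁ q hq.2, Gate.mem_support_act hb₃ q hq.1]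

theorem Circuit.mem_support_run_ket {U : Circuit} {b b' : Basis}
    (h : b' ∈ (U.run (ket b)).support) (q : ℕ) (hq : q ∉ U.targets) : b' q = b q := by
  obtain ⟨b₀, hb₀, h₀⟩ := mem_support_run h
  have : b₀ = b := by simpa using Finsupp.support_single_subset hb₀
  rw [h₀ q hq, this]

/-- If the basis states of `ψ` agree on the targets of `V`, then `ψ` can be measured before `V`
is run. -/
theorem Circuit.expect_run_of_agree (V : Circuit) (ψ : QState) (g : Basis → ℝ)
    (h : ∀ b ∈ ψ.support, ∀ b' ∈ ψ.support, ∀ q ∈ V.targets, b q = b' q) :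
    expect (V.run ψ) g = expect ψ fun b => expect (V.run (ket b)) g := by
  rw [run_eq_sum, expect_sum_of_disjoint]
  · exact Finset.sum_congr rfl fun b _ => expect_smul _ _ _
  · intro b hb b' hb' hne
    rw [Finset.disjoint_left]
    intro c hc hc'
    apply hne
    funext q
    by_cases hq : q ∈ V.targets
    · exact h b hb b' hb' q hq
    · rw [← mem_support_run_ket (Finsupp.support_smul hc) q hq,
        ← mem_support_run_ket (Finsupp.support_smul hc') q hq]

/-! ### Preservation of the norm -/

theorem update_flip {b : Basis} {q : ℕ} {v w : Bool} :
    Function.update (Function.update b q v) q w = Function.update b q w := by simp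

theorem toff_act_injective {x y z : ℕ} (h : (Gate.toff x y z).WF) :
    Function.Injective fun b : Basis => Function.update b z (xor (b z) (b x && b y)) := by
  simp only [Gate.WF, Gate.qubits, List.nodup_cons, List.mem_cons, List.not_mem_nil, or_false,
    not_or, List.nodup_nil, and_true, not_false_eq_true] at h
  obtain ⟨⟨hxy, hxz⟩, hyz⟩ := h
  intro b b' hbb
  have h1 : ∀ q, q ≠ z → b q = b' q := fun q hq => by
    simpa [hq] using congrFun hbb q
  have h2 := congrFun hbb z
  simp only [Function.update_self, h1 x hxz, h1 y hyz] at h2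
  funext q
  by_cases hq : q = z
  · subst hq; simpa using h2
  · exact h1 q hq

theorem linExt_toff (x y z : ℕ) (ψ : QState) : linExt (Gate.toff x y z).act ψ =
    ψ.mapDomain fun b => Function.update b z (xor (b z) (b x && b y)) := by
  simp [linExt, Finsupp.mapDomain, Gate.act, ket]

theorem linExt_had_apply (q : ℕ) (ψ : QState) (b : Basis) :
    linExt (Gate.had q).act ψ b = ((1 / Real.sqrt 2 : ℝ) : ℂ) *
      (ψ (Function.update b q false) +
        (if b q then (-1 : ℂ) else 1) * ψ (Function.update b q true)) := by
  classical
  induction ψ using Finsupp.induction_linear with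
  | zero => simp
  | add ψ φ h1 h2 => 
    rw [linExt_add, Finsupp.add_apply, h1, h2, Finsupp.add_apply, Finsupp.add_apply]; ring
  | single c α =>
    rw [linExt_single]
    by_cases h : Function.update c q (b q) = b
    · have hc : c = Function.update b q (c q) := by rw [← h]; simp
      have e1 : ∀ v, (Function.update c q v = b) ↔ v = b q := by
        intro v
        constructor
        · intro hv; rw [← hv]; simp
        · rintro rfl; exact h
      have e2 : ∀ v, (c = Function.update b q v) ↔ v = c q := by
        intro v
        constructor
        · intro h; rw [h]; simp
        · intro h; rw [h, ← hc]
      cases hb : b q <;> cases hcq : c q <;>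
        simp [Gate.act, ket, Finsupp.single_apply, e1, e2, hb, hcq] <;> ring
    · have e1 : ∀ v, Function.update c q v ≠ b := by
        intro v hv; apply h; rw [← hv]; simp
      have e2 : ∀ v, c ≠ Function.update b q v := by
        intro v hv; apply h; rw [hv]; simp
      cases hc : c q <;> simp [Gate.act, ket, hc, e1, e2]

theorem expect_one_of_flip {q : ℕ} {ψ φ : QState}
    (h : ∀ b, ‖φ (Function.update b q false)‖ ^ 2 + ‖φ (Function.update b q true)‖ ^ 2 =
      ‖ψ (Function.update b q false)‖ ^ 2 + ‖ψ (Function.update b q true)‖ ^ 2) :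
    expect φ 1 = expect ψ 1 := by
  classical
  let fl : Basis → Basis := fun b => Function.update b q (!b q)
  have hfl : Function.Involutive fl := by intro b; simp [fl]
  let B := ψ.support ∪ φ.support
  let A := B ∪ B.image fl
  have hA : ∀ b, b ∈ A → fl b ∈ A := by
    intro b hb
    rcases Finset.mem_union.1 hb with h | h
    · exact Finset.mem_union_right _ (Finset.mem_image_of_mem _ h)
    · obtain ⟨c, hc, rfl⟩ := Finset.mem_image.1 h
      rw [hfl c]; exact Finset.mem_union_left _ hc
  have key : ∀ χ : QState, χ.support ⊆ A →
      expect χ 1 = (∑ b ∈ A, (‖χ b‖ ^ 2 + ‖χ (fl b)‖ ^ 2)) / 2 := by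
    intro χ hχ
    have h1 : expect χ 1 = ∑ b ∈ A, ‖χ b‖ ^ 2 := by
      unfold expect
      rw [Finsupp.sum_of_support_subset _ hχ _ (by simp)]; simp
    have h2 : ∑ b ∈ A, ‖χ b‖ ^ 2 = ∑ b ∈ A, ‖χ (fl b)‖ ^ 2 :=
      Finset.sum_nbij' fl fl hA hA (fun b _ => hfl b) (fun b _ => hfl b)
        (fun b _ => by rw [hfl b])
    rw [Finset.sum_add_distrib, h1, ← h2]; ring
  rw [key φ (fun b hb => by simp [A, B] at hb ⊢; tauto),
    key ψ (fun b hb => by simp [A, B] at hb ⊢; tauto)]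
  congr 1
  refine Finset.sum_congr rfl fun b _ => ?_
  have := h b
  cases hb : b q
  · have e : Function.update b q false = b := by rw [← hb]; simp
    simp only [fl, hb, Bool.not_false]
    rw [e] at this; exact this
  · have e : Function.update b q true = b := by rw [← hb]; simp
    simp only [fl, hb, Bool.not_true]
    rw [e] at this; linarith

theorem expect_one_gate {g : Gate} (hg : g.WF) (ψ : QState) :
    expect (linExt g.act ψ) 1 = expect ψ 1 := by
  cases g with
  | had q =>
    apply expect_one_of_flip (q := q)
    intro b
    simp only [linExt_had_apply, update_flip, Function.update_self]
    have h2 : ‖((1 / Real.sqrt 2 : ℝ) : ℂ)‖ ^ 2 = 1 / 2 := by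
      rw [Complex.norm_real]; simp
    simp only [norm_mul, mul_pow, h2]
    have := parallelogram_law_with_norm ℂ (ψ (Function.update b q false))
      (ψ (Function.update b q true))
    simp only [Bool.false_eq_true, if_false, if_true, one_mul, neg_mul, ← sub_eq_add_neg]
    nlinarith [this]
  | toff x y z =>
    rw [linExt_toff, expect_mapDomain _ (toff_act_injective hg).injOn]
    rfl

theorem Circuit.expect_one {U : Circuit} (hU : U.WF) (ψ : QState) :
    expect (U.run ψ) 1 = expect ψ 1 := by
  induction U generalizing ψ with
  | nil => rfl
  | cons g U ih =>
    rw [wf_cons] at hU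
    rw [run_cons, ih hU.2, expect_one_gate hU.1]

/-! ### Circuits as Markov kernels on basis states -/

/-- The expected value of `g` on the outcome of running `U` on `|b⟩` and measuring all qubits. -/
noncomputable def Circuit.ex (U : Circuit) (b : Basis) (g : Basis → ℝ) : ℝ :=
  expect (U.run (ket b)) g

namespace Circuit

@[simp] theorem ex_nil (b : Basis) (g : Basis → ℝ) : ex [] b g = g b := by simp [ex]

theorem ex_const {U : Circuit} (hU : U.WF) (b : Basis) (c : ℝ) : U.ex b (fun _ => c) = c := by
  have := expect_const_mul (U.run (ket b)) c 1
  simp only [Pi.one_apply, mul_one] at this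
  rw [ex, this, expect_one hU]; simp

theorem ex_congr {U : Circuit} {b : Basis} {g g' : Basis → ℝ}
    (h : ∀ b' : Basis, (∀ q ∉ U.targets, b' q = b q) → g b' = g' b') : U.ex b g = U.ex b g' :=
  expect_congr fun b' hb' => h b' (mem_support_run_ket hb')

theorem ex_mono {U : Circuit} {b : Basis} {g g' : Basis → ℝ}
    (h : ∀ b' : Basis, (∀ q ∉ U.targets, b' q = b q) → g b' ≤ g' b') : U.ex b g ≤ U.ex b g' :=
  expect_mono fun b' hb' => h b' (mem_support_run_ket hb')

theorem ex_add (U : Circuit) (b : Basis) (g g' : Basis → ℝ) :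
    U.ex b (fun b => g b + g' b) = U.ex b g + U.ex b g' := expect_add _ _ _

theorem ex_const_mul (U : Circuit) (b : Basis) (c : ℝ) (g : Basis → ℝ) :
    U.ex b (fun b => c * g b) = c * U.ex b g := expect_const_mul _ _ _

/-- A circuit that only writes to qubits which the preceding circuit has not written to acts as
if all qubits had been measured in between. -/
theorem ex_append {U V : Circuit} (h : Disjoint U.targets V.targets) (b : Basis)
    (g : Basis → ℝ) : (U ++ V).ex b g = U.ex b fun b' => V.ex b' g := by
  unfold ex
  rw [run_append, expect_run_of_agree]
  intro b₁ h₁ b₂ h₂ q hq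
  have hq' : q ∉ U.targets := fun h' => Set.disjoint_left.1 h h' hq
  rw [mem_support_run_ket h₁ q hq', mem_support_run_ket h₂ q hq']

end Circuit

/-! ### Classical circuits -/

/-- The gate is a Toffoli gate. -/
def Gate.IsClassical : Gate → Prop
  | Gate.had _ => False
  | Gate.toff _ _ _ => True

/-- The action of a Toffoli gate on basis states; the value on a Hadamard gate is irrelevant. -/
def Gate.apply : Gate → Basis → Basis
  | Gate.had _, b => b
  | Gate.toff x y z, b => Function.update b z (xor (b z) (b x && b y))

namespace Circuit

/-- All gates are Toffoli gates. -/
def IsClassical (U : Circuit) : Prop := ∀ g ∈ U, g.IsClassical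

/-- The action of a circuit of Toffoli gates on basis states. -/
def cl (U : Circuit) (b : Basis) : Basis := U.foldl (fun b g => g.apply b) b

@[simp] theorem cl_nil (b : Basis) : cl [] b = b := rfl

@[simp] theorem cl_cons (g : Gate) (U : Circuit) (b : Basis) :
    cl (g :: U) b = cl U (g.apply b) := rfl

theorem cl_append (U V : Circuit) (b : Basis) : cl (U ++ V) b = cl V (cl U b) := by
  simp [cl, List.foldl_append]

theorem isClassical_cons {g : Gate} {U : Circuit} :
    IsClassical (g :: U) ↔ g.IsClassical ∧ U.IsClassical := by simp [IsClassical]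

theorem isClassical_nil : IsClassical [] := by simp [IsClassical]

theorem IsClassical.append {U V : Circuit} (hU : U.IsClassical) (hV : V.IsClassical) :
    IsClassical (U ++ V) := by
  intro g hg
  rcases List.mem_append.1 hg with h | h
  exacts [hU g h, hV g h]

theorem IsClassical.flatMap {α : Type*} {l : List α} {F : α → Circuit}
    (h : ∀ a ∈ l, (F a).IsClassical) : IsClassical (l.flatMap F) := by
  intro g hg
  obtain ⟨a, ha, hg⟩ := List.mem_flatMap.1 hg
  exact h a ha g hg

theorem cl_apply_of_notMem (U : Circuit) (b : Basis) (q : ℕ) (hq : q ∉ U.targets) :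
    cl U b q = b q := by
  induction U generalizing b with
  | nil => rfl
  | cons g U ih =>
    simp only [targets_cons, Set.mem_insert_iff, not_or] at hq
    rw [cl_cons, ih _ hq.2]
    cases g with
    | had _ => rfl
    | toff x y z => simp only [Gate.target] at hq; simp [Gate.apply, hq.1]

theorem run_of_isClassical {U : Circuit} (hU : U.IsClassical) (ψ : QState) :
    U.run ψ = ψ.mapDomain (cl U) := by
  induction U generalizing ψ with
  | nil => simp [show cl [] = id from rfl]
  | cons g U ih =>
    rw [isClassical_cons] at hU
    cases g with
    | had _ => exact hU.1.elim
    | toff x y z =>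
      rw [run_cons, linExt_toff, ih hU.2, ← Finsupp.mapDomain_comp]
      rfl

theorem run_ket_of_isClassical {U : Circuit} (hU : U.IsClassical) (b : Basis) :
    U.run (ket b) = ket (cl U b) := by
  rw [run_of_isClassical hU, ket, Finsupp.mapDomain_single, ket]

theorem cl_injective {U : Circuit} (hU : U.WF) : Function.Injective (cl U) := by
  induction U with
  | nil => exact fun _ _ h => h
  | cons g U ih =>
    rw [wf_cons] at hU
    have : cl (g :: U) = cl U ∘ g.apply := rfl
    rw [this]
    refine (ih hU.2).comp ?_
    cases g with
    | had _ => exact fun _ _ h => h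
    | toff x y z => exact toff_act_injective hU.1

theorem ex_append_of_isClassical {U V : Circuit} (hV : V.IsClassical) (hW : V.WF) (b : Basis)
    (g : Basis → ℝ) : (U ++ V).ex b g = U.ex b fun b' => g (cl V b') := by
  unfold ex
  rw [run_append, run_of_isClassical hV, expect_mapDomain _ (cl_injective hW).injOn]
  rfl

theorem ex_isClassical_append {U V : Circuit} (hU : U.IsClassical) (b : Basis)
    (g : Basis → ℝ) : (U ++ V).ex b g = V.ex (cl U b) g := by
  unfold ex
  rw [run_append, run_ket_of_isClassical hU]

/-- Toffoli gates are involutions. -/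
theorem cl_reverse_cl {U : Circuit} (hU : U.WF) (b : Basis) : cl U.reverse (cl U b) = b := by
  induction U generalizing b with
  | nil => rfl
  | cons g U ih =>
    rw [wf_cons] at hU
    rw [List.reverse_cons, cl_append, cl_cons, cl_cons, ih hU.2, cl_nil]
    cases g with
    | had _ => rfl
    | toff x y z =>
      have h := hU.1
      simp only [Gate.WF, Gate.qubits, List.nodup_cons, List.mem_cons, List.not_mem_nil, or_false,
        not_or, List.nodup_nil, and_true, not_false_eq_true] at h
      obtain ⟨⟨hxy, hxz⟩, hyz⟩ := h
      simp [Gate.apply, hxz, hyz]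

/-- A Hadamard gate on a qubit in state `|0⟩` makes it a uniformly random bit. -/
theorem ex_had {q : ℕ} (b : Basis) (g : Basis → ℝ) :
    ex [Gate.had q] b g = (g (Function.update b q false) + g (Function.update b q true)) / 2 := by
  classical
  have hne : Function.update b q false ≠ Function.update b q true := by
    intro h; simpa using congrFun h q
  have h2 : ‖((1 / Real.sqrt 2 : ℝ) : ℂ)‖ ^ 2 = 1 / 2 := by
    rw [Complex.norm_real]; simp
  have h3 : ‖(if b q then (-1 : ℂ) else 1)‖ ^ 2 = 1 := by split <;> simp
  simp only [ex, run_cons, run_nil, linExt_ket, Gate.act]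
  rw [expect_smul, expect_add_of_disjoint, expect_smul, h2, h3, expect_ket, expect_ket]
  · ring
  · rw [Finset.disjoint_left]
    intro c hc hc'
    have e1 := Finsupp.support_single_subset hc
    have e2 := Finsupp.support_single_subset (Finsupp.support_smul hc')
    simp only [Finset.mem_singleton] at e1 e2
    exact hne (e1.symm.trans e2)

end Circuit

/-! ### Coherent simulation inside a larger register -/

/-- The basis state that holds `a` on the qubits `ι 0, ι 1, …` and agrees with `b` elsewhere. -/
noncomputable def emb (ι : ℕ → ℕ) (b a : Basis) : Basis := Function.extend ι a b

/-- The state `ψ`, held by the qubits `ι 0, ι 1, …`, with the other qubits as in `b`. -/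
noncomputable def place (ι : ℕ → ℕ) (b : Basis) (ψ : QState) : QState := ψ.mapDomain (emb ι b)

section emb

variable {ι : ℕ → ℕ} (hι : Function.Injective ι)
include hι

theorem emb_apply (b a : Basis) (q : ℕ) : emb ι b a (ι q) = a q := hι.extend_apply _ _ _

theorem emb_injective (b : Basis) : Function.Injective (emb ι b) := by
  intro a a' h
  funext q
  rw [← emb_apply hι b a, h, emb_apply hι]

theorem emb_update (b a : Basis) (q : ℕ) (v : Bool) :
    emb ι b (Function.update a q v) = Function.update (emb ι b a) (ι q) v := by
  funext p
  by_cases hp : ∃ p', ι p' = p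
  · obtain ⟨p', rfl⟩ := hp
    rw [emb_apply hι]
    by_cases h : p' = q
    · subst h; simp
    · rw [Function.update_of_ne h, Function.update_of_ne (fun e => h (hι e)), emb_apply hι]
  · rw [Function.update_of_ne (fun e => hp ⟨q, e.symm⟩)]
    simp [emb, Function.extend_apply' _ _ _ hp]

end emb

theorem emb_apply_of_notMem {ι : ℕ → ℕ} (b a : Basis) {q : ℕ} (hq : q ∉ Set.range ι) :
    emb ι b a q = b q := Function.extend_apply' _ _ _ hq

theorem emb_update_env {ι : ℕ → ℕ} (b a : Basis) {q : ℕ} (hq : q ∉ Set.range ι) (v : Bool) :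
    emb ι (Function.update b q v) a = Function.update (emb ι b a) q v := by
  funext p
  by_cases h : p = q
  · subst h; rw [emb_apply_of_notMem _ _ hq]; simp
  · rw [Function.update_of_ne h]
    unfold emb Function.extend
    split <;> simp [h]

theorem place_add (ι : ℕ → ℕ) (b : Basis) (ψ φ : QState) :
    place ι b (ψ + φ) = place ι b ψ + place ι b φ := Finsupp.mapDomain_add

theorem place_smul (ι : ℕ → ℕ) (b : Basis) (c : ℂ) (ψ : QState) :
    place ι b (c • ψ) = c • place ι b ψ := Finsupp.mapDomain_smul _ _

@[simp] theorem place_zero (ι : ℕ → ℕ) (b : Basis) : place ι b 0 = 0 := Finsupp.mapDomain_zero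

@[simp] theorem place_ket (ι : ℕ → ℕ) (b a : Basis) : place ι b (ket a) = ket (emb ι b a) := by
  simp [place, ket, Finsupp.mapDomain_single]

theorem mem_support_place {ι : ℕ → ℕ} {b c : Basis} {ψ : QState}
    (h : c ∈ (place ι b ψ).support) : ∃ a, c = emb ι b a := by
  classical
  obtain ⟨a, -, rfl⟩ := Finset.mem_image.1 (Finsupp.mapDomain_support h)
  exact ⟨a, rfl⟩

/-- A step of a simulation: the circuit `circ` that carries it out, a fresh qubit `scratch`, and
the operations performed on the simulated register in the two branches in which `scratch` ends up
in state `0` and `1`. -/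
structure SimBlock : Type where
  circ : Circuit
  scratch : ℕ
  op0 : Basis → QState
  op1 : Basis → QState

/-- The expected value of `g` after a sequence of two-branch operations, in which the branches do
not interfere. -/
noncomputable def branchExp (g : Basis → ℝ) : List SimBlock → QState → ℝ
  | [], ψ => expect ψ g
  | B :: c, ψ => branchExp g c (linExt B.op0 ψ) + branchExp g c (linExt B.op1 ψ)

@[simp] theorem branchExp_zero (g : Basis → ℝ) (bl : List SimBlock) : branchExp g bl 0 = 0 := by
  induction bl with
  | nil => exact expect_zero _
  | cons B bl ih => simp [branchExp, ih]

/-- `B` carries out its two operations in every environment that satisfies `P` and has its scratch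
qubit in state `0`. -/
def SimBlock.Correct (ι : ℕ → ℕ) (P : Basis → Prop) (B : SimBlock) : Prop :=
  ∀ b a, P b → b B.scratch = false → B.circ.run (ket (emb ι b a)) =
    place ι b (B.op0 a) + place ι (Function.update b B.scratch true) (B.op1 a)

theorem SimBlock.Correct.run_place {ι : ℕ → ℕ} {P : Basis → Prop} {B : SimBlock}
    (h : B.Correct ι P) {b : Basis} (hb : P b) (hs : b B.scratch = false) (ψ : QState) :
    B.circ.run (place ι b ψ) =
      place ι b (linExt B.op0 ψ) + place ι (Function.update b B.scratch true) (linExt B.op1 ψ) := by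
  induction ψ using Finsupp.induction_linear with
  | zero => simp
  | add ψ φ h1 h2 =>
    simp only [linExt_add, place_add, Circuit.run_add, h1, h2]
    abel
  | single a α =>
    rw [single_eq_smul_ket]
    simp only [linExt_smul, place_smul, Circuit.run_smul, linExt_ket, place_ket, h b a hb hs,
      smul_add]

/-- A sequence of correct steps with fresh scratch qubits simulates the sequence of operations:
nothing acts on a scratch qubit after its step, so that the branches do not interfere. -/
theorem expect_run_simulation {ι : ℕ → ℕ} (hι : Function.Injective ι) {P : Basis → Prop} {g : Basis → ℝ}
    (bl : List SimBlock)
    (hP : ∀ B ∈ bl, ∀ b, P b → P (Function.update b B.scratch true))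
    (hB : ∀ B ∈ bl, B.Correct ι P)
    (hr : ∀ B ∈ bl, B.scratch ∉ Set.range ι)
    (hd : bl.Pairwise fun B B' => B.scratch ≠ B'.scratch ∧ B.scratch ∉ B'.circ.targets)
    (hg : ∀ B ∈ bl, ∀ b, g (Function.update b B.scratch true) = g b)
    (b : Basis) (hb : P b) (hs : ∀ B ∈ bl, b B.scratch = false) (ψ : QState) :
    expect (Circuit.run (bl.flatMap SimBlock.circ) (place ι b ψ)) g =
      branchExp (fun a => g (emb ι b a)) bl ψ := by
  induction bl generalizing b ψ with
  | nil =>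
    simp only [List.flatMap_nil, Circuit.run_nil, branchExp]
    exact expect_mapDomain _ (emb_injective hι b).injOn _
  | cons B bl ih =>
    rw [List.pairwise_cons] at hd
    simp only [List.forall_mem_cons] at hP hB hr hg hs
    have hrest : B.scratch ∉ Circuit.targets (bl.flatMap SimBlock.circ) := by
      simp only [Circuit.targets_flatMap, Set.mem_iUnion, not_exists]
      exact fun B' hB' => (hd.1 B' hB').2
    have hval : ∀ (b' : Basis) (φ : QState),
        ∀ c ∈ (Circuit.run (bl.flatMap SimBlock.circ) (place ι b' φ)).support,
          c B.scratch = b' B.scratch := by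
      intro b' φ c hc
      obtain ⟨c', hc', h⟩ := Circuit.mem_support_run hc
      obtain ⟨a, rfl⟩ := mem_support_place hc'
      rw [h _ hrest, emb_apply_of_notMem _ _ hr.1]
    rw [List.flatMap_cons, Circuit.run_append, hB.1.run_place hb hs.1, Circuit.run_add,
      expect_add_of_disjoint, branchExp]
    · congr 1
      · exact ih hP.2 hB.2 hr.2 hd.2 hg.2 b hb hs.2 _
      · rw [ih hP.2 hB.2 hr.2 hd.2 hg.2 _ (hP.1 b hb)
          (fun B' hB' => by rw [Function.update_of_ne (hd.1 B' hB').1.symm]; exact hs.2 B' hB') _]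
        congr 1
        funext a
        rw [emb_update_env _ _ hr.1, hg.1]
    · rw [Finset.disjoint_left]
      intro c hc hc'
      have h1 := hval _ _ _ hc
      have h2 := hval _ _ _ hc'
      simp [h1, hs.1] at h2

/-! ### Elementary simulation steps -/

/-- Relabel the qubits of a gate. -/
def Gate.map (ι : ℕ → ℕ) : Gate → Gate
  | Gate.had q => Gate.had (ι q)
  | Gate.toff x y z => Gate.toff (ι x) (ι y) (ι z)

theorem place_act {ι : ℕ → ℕ} (hι : Function.Injective ι) (g : Gate) (b a : Basis) :
    (g.map ι).act (emb ι b a) = place ι b (g.act a) := by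
  cases g with
  | had q =>
    simp only [Gate.map, Gate.act, place_smul, place_add, place_ket, emb_update hι, emb_apply hι]
  | toff x y z =>
    simp only [Gate.map, Gate.act, place_ket, emb_update hι, emb_apply hι]

/-- A Hadamard gate on qubit `s` controlled by qubit `F`, with the help of a qubit `h` in state
`|0⟩`: if `F` is set, then `s` is swapped with `h` before and after a Hadamard gate on `h`.  If `F`
is not set, then `h` is left in the state `(|0⟩ + |1⟩) / √2`. -/
def ctrlHad (F s h : ℕ) : Circuit :=
  [Gate.toff F s h, Gate.toff F h s, Gate.had h, Gate.toff F h s, Gate.toff F s h]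

theorem run_ctrlHad {F s h : ℕ} (hFs : F ≠ s) (hFh : F ≠ h) (hsh : s ≠ h) (b : Basis)
    (hb : b h = false) : Circuit.run (ctrlHad F s h) (ket b) =
      if b F then (Gate.had s).act b else
        ((1 / Real.sqrt 2 : ℝ) : ℂ) • (ket b + ket (Function.update b h true)) := by
  have hk : ∀ x y z c b, Circuit.run [Gate.toff F x y, Gate.toff F z c] (ket b) =
      ket (Circuit.cl [Gate.toff F x y, Gate.toff F z c] b) := fun x y z c b =>
    Circuit.run_ket_of_isClassical (by simp [Circuit.IsClassical, Gate.IsClassical]) _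
  have e : ctrlHad F s h = [Gate.toff F s h, Gate.toff F h s] ++ ([Gate.had h] ++
    [Gate.toff F h s, Gate.toff F s h]) := rfl
  have h0 : Circuit.cl [Gate.toff F s h, Gate.toff F h s] b h = (b F && b s) := by
    simp [Circuit.cl, Gate.apply, hsh.symm, hb]
  have h1 : ∀ v, Circuit.cl [Gate.toff F h s, Gate.toff F s h] (Function.update
      (Circuit.cl [Gate.toff F s h, Gate.toff F h s] b) h v) =
      if b F then Function.update b s v else Function.update b h v := by
    intro v
    funext q
    by_cases hqh : q = h
    · subst hqh
      cases hF : b F <;> simp [Circuit.cl, Gate.apply, hFs, hFh, hsh, hsh.symm, hb, hF]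
    · by_cases hqs : q = s
      · subst hqs
        cases hF : b F <;> simp [Circuit.cl, Gate.apply, hFs, hFh, hsh, hb, hF]
      · cases hF : b F <;> simp [Circuit.cl, Gate.apply, hqh, hqs]
  have hh : ∀ b, Circuit.run [Gate.had h] (ket b) = (Gate.had h).act b := fun b => by simp
  rw [e, Circuit.run_append, hk, Circuit.run_append, hh, Gate.act, h0, Circuit.run_smul, Circuit.run_add, Circuit.run_smul, hk, hk, h1, h1]
  cases hF : b F
  · have : Function.update b h false = b := by rw [← hb]; simp
    simp [this]
  · simp [Gate.act]

/-- A Toffoli gate controlled by qubit `F`, with the help of a qubit `u` in state `|0⟩`. -/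
def ctrlToff (F u x y z : ℕ) : Circuit :=
  [Gate.toff F x u, Gate.toff u y z, Gate.toff F x u]

theorem run_ctrlToff {F u x y z : ℕ} (hFz : F ≠ z) (hFu : F ≠ u) (hxu : x ≠ u) (hyu : y ≠ u)
    (hzu : z ≠ u) (hxz : x ≠ z) (b : Basis) (hb : b u = false) :
    Circuit.run (ctrlToff F u x y z) (ket b) =
      if b F then (Gate.toff x y z).act b else ket b := by
  rw [Circuit.run_ket_of_isClassical (by simp [ctrlToff, Circuit.IsClassical, Gate.IsClassical])]
  have : Circuit.cl (ctrlToff F u x y z) b =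
      if b F then Function.update b z (xor (b z) (b x && b y)) else b := by
    funext q
    by_cases hqu : q = u
    · subst hqu
      cases hF : b F <;>
        simp [Circuit.cl, ctrlToff, Gate.apply, hFz, hFu, hxu, hyu, hzu, hzu.symm, hxz, hb, hF]
    · by_cases hqz : q = z
      · subst hqz
        cases hF : b F <;>
          simp [Circuit.cl, ctrlToff, Gate.apply, hyu, hzu, hb, hF]
      · cases hF : b F <;> simp [Circuit.cl, ctrlToff, Gate.apply, hqu, hqz]
  rw [this]
  cases hF : b F <;> simp [Gate.act]

theorem wf_ctrlHad {F s h : ℕ} (hFs : F ≠ s) (hFh : F ≠ h) (hsh : s ≠ h) :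
    Circuit.WF (ctrlHad F s h) := by
  simp [ctrlHad, Circuit.WF, Gate.WF, Gate.qubits, hFs, hFh, hsh, hsh.symm]

theorem wf_ctrlToff {F u x y z : ℕ} (hFx : F ≠ x) (hFu : F ≠ u) (hxu : x ≠ u) (hyu : y ≠ u)
    (hzu : z ≠ u) (hyz : y ≠ z) : Circuit.WF (ctrlToff F u x y z) := by
  simp [ctrlToff, Circuit.WF, Gate.WF, Gate.qubits, hFx, hFu, hxu, hyu.symm, hzu.symm, hyz]

/-! ### Classical gadgets -/

namespace Circuit

/-- The qubits that occur in `U`. -/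
def support (U : Circuit) : Set ℕ := {q | ∃ g ∈ U, q ∈ g.qubits}

@[simp] theorem support_nil : support [] = ∅ := by ext; simp [support]

@[simp] theorem support_cons (g : Gate) (U : Circuit) :
    support (g :: U) = {q | q ∈ g.qubits} ∪ support U := by
  ext q; simp [support]

@[simp] theorem support_flatMap {α : Type*} (l : List α) (F : α → Circuit) :
    support (l.flatMap F) = ⋃ a ∈ l, support (F a) := by
  ext q; simp only [support, List.mem_flatMap, Set.mem_ofPred_eq, Set.mem_iUnion]
  constructor
  · rintro ⟨g, ⟨a, ha, hg⟩, h⟩; exact ⟨a, ha, g, hg, h⟩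
  · rintro ⟨a, ha, g, hg, h⟩; exact ⟨g, ⟨a, ha, hg⟩, h⟩

@[simp] theorem support_reverse (U : Circuit) : support U.reverse = support U := by
  ext q; simp [support]

@[simp] theorem targets_reverse (U : Circuit) : targets U.reverse = targets U := by
  ext q; simp [targets]

theorem WF.reverse {U : Circuit} (hU : U.WF) : WF U.reverse := by
  intro g hg; exact hU g (List.mem_reverse.1 hg)

theorem IsClassical.reverse {U : Circuit} (hU : U.IsClassical) : IsClassical U.reverse := by
  intro g hg; exact hU g (List.mem_reverse.1 hg)

/-- A circuit ignores the qubits outside its support. -/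
theorem cl_congr {U : Circuit} {b b' : Basis} (S : Set ℕ) (hS : U.support ⊆ S)
    (h : ∀ q ∈ S, b q = b' q) : ∀ q ∈ S, cl U b q = cl U b' q := by
  induction U generalizing b b' with
  | nil => exact h
  | cons g U ih =>
    simp only [support_cons, Set.union_subset_iff] at hS
    refine ih hS.2 fun q hq => ?_
    cases g with
    | had _ => exact h q hq
    | toff x y z =>
      have hx : x ∈ S := hS.1 (by simp [Gate.qubits])
      have hy : y ∈ S := hS.1 (by simp [Gate.qubits])
      have hz : z ∈ S := hS.1 (by simp [Gate.qubits])
      simp only [Gate.apply, h x hx, h y hy, h z hz]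
      by_cases hqz : q = z
      · subst hqz; simp
      · simp [hqz, h q hq]

theorem cl_update_of_notMem {U : Circuit} {t : ℕ} (ht : t ∉ U.support) (b : Basis) (v : Bool) :
    cl U (Function.update b t v) = Function.update (cl U b) t v := by
  funext q
  by_cases hq : q = t
  · subst hq
    rw [cl_apply_of_notMem]
    · simp
    · rintro ⟨g, hg, rfl⟩
      exact ht ⟨g, hg, by cases g <;> simp [Gate.target, Gate.qubits]⟩
  · rw [Function.update_of_ne hq]
    exact cl_congr {t}ᶜ (fun p hp => by rintro rfl; exact ht hp)
      (fun p hp => Function.update_of_ne hp _ _) q hq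

/-- Of several blocks, only the one that mentions a qubit matters for its final value, provided
that no block writes to a qubit that another one mentions. -/
theorem cl_flatMap_of_indep {α : Type*} {l : List α} (hl : l.Nodup) {F : α → Circuit} {a : α}
    (ha : a ∈ l) (hd : ∀ a' ∈ l, a' ≠ a → Disjoint (F a').targets (F a).support) (b : Basis)
    {q : ℕ} (hq : q ∈ (F a).support) : cl (l.flatMap F) b q = cl (F a) b q := by
  have aux : ∀ l' : List α, (∀ a' ∈ l', a' ∈ l ∧ a' ≠ a) → ∀ (b : Basis) (q : ℕ),
      q ∈ (F a).support → cl (l'.flatMap F) b q = b q := by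
    intro l' hl' b q hq
    apply cl_apply_of_notMem
    simp only [targets_flatMap, Set.mem_iUnion, not_exists]
    intro a' ha' h
    exact Set.disjoint_left.1 (hd a' (hl' a' ha').1 (hl' a' ha').2) h hq
  obtain ⟨l₁, l₂, rfl⟩ := List.append_of_mem ha
  rw [List.nodup_append, List.nodup_cons] at hl
  obtain ⟨-, ⟨hl2, -⟩, hl1⟩ := hl
  rw [List.flatMap_append, List.flatMap_cons, cl_append, cl_append, aux l₂ _ _ _ hq]
  · refine cl_congr _ subset_rfl (fun p hp => aux l₁ ?_ _ _ hp) q hq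
    exact fun a' ha' => ⟨by simp [ha'], hl1 a' ha' a (by simp)⟩
  · exact fun a' ha' => ⟨by simp [ha'], fun e => hl2 (e ▸ ha')⟩

end Circuit

/-- `c ^= p ∧ (q = s)`; the qubit `one` is in state `|1⟩`. -/
def literal (one p q c : ℕ) (s : Bool) : Circuit :=
  Gate.toff p q c :: if s then [] else [Gate.toff p one c]

/-- Computes the conjunctions of the first `l` literals `pos j = sgn j` into the qubits `anc l`.
The qubits `one` and `anc 0` are in state `|1⟩`, and the other ones `anc l` in state `|0⟩`. -/
def chain (one : ℕ) (anc pos : ℕ → ℕ) (sgn : ℕ → Bool) (len : ℕ) : Circuit :=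
  (List.range len).flatMap fun l => literal one (anc l) (pos l) (anc (l + 1)) (sgn l)

/-- The qubits of a chain of conjunctions are sufficiently distinct. -/
structure ChainOK (one : ℕ) (anc pos : ℕ → ℕ) : Prop where
  inj : Function.Injective anc
  one : ∀ l, anc l ≠ one
  pos : ∀ l j, anc l ≠ pos j

section chain

variable {one : ℕ} {anc pos : ℕ → ℕ} {sgn : ℕ → Bool} {len : ℕ}

theorem chain_succ : chain one anc pos sgn (len + 1) = chain one anc pos sgn len ++
    literal one (anc len) (pos len) (anc (len + 1)) (sgn len) := by
  simp [chain, List.range_succ]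

theorem isClassical_literal {p q c : ℕ} {s : Bool} : (literal one p q c s).IsClassical := by
  cases s <;> simp [literal, Circuit.IsClassical, Gate.IsClassical]

theorem isClassical_chain : (chain one anc pos sgn len).IsClassical :=
  Circuit.IsClassical.flatMap fun _ _ => isClassical_literal

theorem wf_chain (h : ChainOK one anc pos) : (chain one anc pos sgn len).WF := by
  refine Circuit.WF.flatMap fun l _ => ?_
  have h1 : anc l ≠ anc (l + 1) := fun e => by simpa using h.inj e
  cases sgn l <;>
    simp [literal, Circuit.WF, Gate.WF, Gate.qubits, h.pos, h1, h.one, (h.pos _ _).symm,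
      (h.one _).symm]

theorem targets_chain_subset :
    (chain one anc pos sgn len).targets ⊆ {q | ∃ l < len, q = anc (l + 1)} := by
  intro q hq
  simp only [chain, Circuit.targets_flatMap, Set.mem_iUnion, List.mem_range] at hq
  obtain ⟨l, hl, hq⟩ := hq
  refine ⟨l, hl, ?_⟩
  cases hs : sgn l <;> simpa [literal, hs, Gate.target] using hq

theorem support_chain_subset :
    (chain one anc pos sgn len).support ⊆
      {q | q = one ∨ (∃ l ≤ len, q = anc l) ∨ ∃ j < len, q = pos j} := by
  intro q hq
  simp only [chain, Circuit.support_flatMap, Set.mem_iUnion, List.mem_range] at hq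
  obtain ⟨l, hl, hq⟩ := hq
  have : q = one ∨ q = anc l ∨ q = anc (l + 1) ∨ q = pos l := by
    cases hs : sgn l <;> simp [literal, hs, Gate.qubits] at hq <;> tauto
  rcases this with h | h | h | h
  · exact Or.inl h
  · exact Or.inr (Or.inl ⟨l, by omega, h⟩)
  · exact Or.inr (Or.inl ⟨l + 1, by omega, h⟩)
  · exact Or.inr (Or.inr ⟨l, hl, h⟩)

theorem cl_chain (h : ChainOK one anc pos) {b : Basis} (h1 : b one = true)
    (h0 : b (anc 0) = true) (hz : ∀ l, b (anc (l + 1)) = false) :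
    Circuit.cl (chain one anc pos sgn len) b (anc len) = true ↔ ∀ j < len, b (pos j) = sgn j := by
  induction len with
  | zero => simp [chain, h0]
  | succ len ih =>
    have hnt : ∀ q, (∀ l < len, q ≠ anc (l + 1)) →
        Circuit.cl (chain one anc pos sgn len) b q = b q := fun q hq =>
      Circuit.cl_apply_of_notMem _ _ _ fun hq' => by
        obtain ⟨l, hl, e⟩ := targets_chain_subset hq'; exact hq l hl e
    have e1 := hnt one fun l _ => (h.one _).symm
    have e2 := hnt (pos len) fun l _ => (h.pos _ _).symm
    have e3 := hnt (anc (len + 1)) fun l hl e => by have := h.inj e; omega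
    have hne : anc len ≠ anc (len + 1) := fun e => by simpa using h.inj e
    rw [chain_succ, Circuit.cl_append]
    set b' := Circuit.cl (chain one anc pos sgn len) b
    have : Circuit.cl (literal one (anc len) (pos len) (anc (len + 1)) (sgn len)) b'
        (anc (len + 1)) = (b' (anc len) && (b (pos len) == sgn len)) := by
      cases hs : sgn len <;>
        simp [literal, Circuit.cl, Gate.apply, e1, e2, e3, hne, h1, hz, (h.one _).symm]
      cases b' (anc len) <;> cases b (pos len) <;> rfl
    rw [this, Nat.forall_lt_succ_right]
    simp [ih]

end chain

/-- Adds the bit number `x` of the input register to the qubit `t`, where `x` is the number with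
the binary digits held by the qubits `pos 0, …, pos (n - 1)`.  The ancillas are restored. -/
def lookup (one : ℕ) (anc pos : ℕ → ℕ) (n t : ℕ) : Circuit :=
  (List.range (2 ^ n)).flatMap fun y => chain one anc pos (fun j => y.testBit j) n ++
    Gate.toff (anc n) y t :: (chain one anc pos (fun j => y.testBit j) n).reverse

section lookup

variable {one : ℕ} {anc pos : ℕ → ℕ} {n t : ℕ}

theorem isClassical_lookup : (lookup one anc pos n t).IsClassical :=
  Circuit.IsClassical.flatMap fun _ _ => isClassical_chain.append
    (Circuit.isClassical_cons.2 ⟨trivial, isClassical_chain.reverse⟩)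

theorem wf_lookup (h : ChainOK one anc pos) (ht : ∀ l, t ≠ anc l) (htn : 2 ^ n ≤ t)
    (hn : ∀ l, 2 ^ n ≤ anc l) : (lookup one anc pos n t).WF := by
  refine Circuit.WF.flatMap fun y hy => (wf_chain h).append
    (Circuit.wf_cons.2 ⟨?_, (wf_chain h).reverse⟩)
  rw [List.mem_range] at hy
  have h1 : anc n ≠ y := by have := hn n; omega
  have h2 : y ≠ t := by omega
  simp [Gate.WF, Gate.qubits, h1, h2, (ht n).symm]

theorem targets_lookup_subset :
    (lookup one anc pos n t).targets ⊆ {q | q = t ∨ ∃ l, q = anc (l + 1)} := by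
  intro q hq
  simp only [lookup, Circuit.targets_flatMap, Set.mem_iUnion, List.mem_range,
    Circuit.targets_append, Circuit.targets_cons, Circuit.targets_reverse, Set.mem_union,
    Set.mem_insert_iff] at hq
  obtain ⟨y, -, hq | hq | hq⟩ := hq
  · obtain ⟨l, -, e⟩ := targets_chain_subset hq; exact Or.inr ⟨l, e⟩
  · exact Or.inl hq
  · obtain ⟨l, -, e⟩ := targets_chain_subset hq; exact Or.inr ⟨l, e⟩

theorem cl_lookup (h : ChainOK one anc pos) (ht : ∀ l, t ≠ anc l) (htn : 2 ^ n ≤ t)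
    (hn : ∀ l, 2 ^ n ≤ anc l) (hto : t ≠ one) (htp : ∀ j < n, t ≠ pos j) {b : Basis}
    (h1 : b one = true) (h0 : b (anc 0) = true) (hz : ∀ l, b (anc (l + 1)) = false)
    (f : BoolFun n) (hf : ∀ i : Fin (2 ^ n), b i = tt f i) :
    Circuit.cl (lookup one anc pos n t) b =
      Function.update b t (xor (b t) (f fun j => b (pos j))) := by
  have hstep : ∀ y < 2 ^ n, ∀ v : Bool,
      Circuit.cl (chain one anc pos (fun j => y.testBit j) n ++
        Gate.toff (anc n) y t :: (chain one anc pos (fun j => y.testBit j) n).reverse)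
        (Function.update b t v) = Function.update b t
          (xor v (decide (∀ j < n, b (pos j) = y.testBit j) && b y)) := by
    intro y hy v
    have hts : t ∉ (chain one anc pos (fun j => y.testBit j) n).support := by
      intro hq
      rcases support_chain_subset hq with e | ⟨l, -, e⟩ | ⟨j, hj, e⟩
      exacts [hto e, ht l e, htp j hj e]
    have hyt : y ≠ t := by omega
    have e1 : Circuit.cl (chain one anc pos (fun j => y.testBit j) n) b y = b y :=
      Circuit.cl_apply_of_notMem _ _ _ fun hq => by
        obtain ⟨l, -, e⟩ := targets_chain_subset hq
        have := hn (l + 1); omega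
    have e2 : Circuit.cl (chain one anc pos (fun j => y.testBit j) n) b (anc n) =
        decide (∀ j < n, b (pos j) = y.testBit j) := by
      rw [Bool.eq_iff_iff, cl_chain h h1 h0 hz]; simp
    rw [Circuit.cl_append, Circuit.cl_cons, Circuit.cl_update_of_notMem hts, Gate.apply]
    simp only [Function.update_self, Function.update_of_ne (ht n).symm,
      Function.update_of_ne hyt, Function.update_idem]
    rw [Circuit.cl_update_of_notMem (by rwa [Circuit.support_reverse]),
      Circuit.cl_reverse_cl (wf_chain h), e1, e2]
  set y₀ := Nat.ofBits fun j : Fin n => b (pos j) with hy₀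
  have hlt : y₀ < 2 ^ n := Nat.ofBits_lt_two_pow _
  have hbit : ∀ j (hj : j < n), y₀.testBit j = b (pos j) := fun j hj => by
    rw [hy₀, Nat.testBit_ofBits_lt _ _ hj]
  have hmatch : ∀ y < 2 ^ n, (∀ j < n, b (pos j) = y.testBit j) ↔ y = y₀ := by
    intro y hy
    constructor
    · intro hj
      apply Nat.eq_of_testBit_eq
      intro j
      by_cases hjn : j < n
      · rw [hbit j hjn, hj j hjn]
      · have hp : 2 ^ n ≤ 2 ^ j := Nat.pow_le_pow_right (by norm_num) (by omega)
        rw [Nat.testBit_lt_two_pow (by omega), Nat.testBit_lt_two_pow (by omega)]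
    · rintro rfl j hj
      exact (hbit j hj).symm
  have hfold : ∀ k ≤ 2 ^ n, Circuit.cl ((List.range k).flatMap fun y =>
      chain one anc pos (fun j => y.testBit j) n ++
        Gate.toff (anc n) y t :: (chain one anc pos (fun j => y.testBit j) n).reverse) b =
      Function.update b t (xor (b t) (decide (y₀ < k) && b y₀)) := by
    intro k hk
    induction k with
    | zero => simp
    | succ k ih =>
      rw [List.range_succ, List.flatMap_append, Circuit.cl_append, ih (by omega),
        List.flatMap_singleton, hstep k (by omega)]
      congr 1
      have hm := hmatch k (by omega)
      by_cases hk' : k = y₀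
      · subst hk'
        rw [decide_eq_true (hm.2 rfl)]
        simp
      · rw [decide_eq_false (fun hc => hk' (hm.1 hc))]
        have : (y₀ < k + 1) ↔ y₀ < k := by omega
        simp [this]
  rw [lookup, hfold _ le_rfl]
  have e : b y₀ = f fun j => b (pos j) := by
    have := hf ⟨y₀, hlt⟩
    simp only [tt] at this
    rw [this]
    congr 1
    funext j
    exact hbit j j.2
  simp [hlt, e]

end lookup

/-- A row of a unary counter: if the qubits `C j` hold `[j ≤ c]` and the qubits `C' j` are in state
`|0⟩`, then the latter receive `[j ≤ c + d]`. -/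
def counterRow (one d : ℕ) (C C' : ℕ → ℕ) (k : ℕ) : Circuit :=
  (List.range k).flatMap fun j => Gate.toff one (C j) (C' j) ::
    if j = 0 then [] else [Gate.toff d (C (j - 1)) (C' j), Gate.toff d (C j) (C' j)]

section counterRow

variable {one d : ℕ} {C C' : ℕ → ℕ} {k : ℕ}

theorem isClassical_counterRow : (counterRow one d C C' k).IsClassical :=
  Circuit.IsClassical.flatMap fun j _ => by
    by_cases hj : j = 0 <;> simp [Circuit.IsClassical, Gate.IsClassical, hj]

theorem wf_counterRow (h1 : ∀ j, one ≠ C j) (h2 : ∀ j, one ≠ C' j) (h3 : ∀ j, d ≠ C j)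
    (h4 : ∀ j, d ≠ C' j) (h5 : ∀ i j, C i ≠ C' j) : (counterRow one d C C' k).WF :=
  Circuit.WF.flatMap fun j _ => by
    by_cases hj : j = 0 <;>
      simp [Circuit.WF, Gate.WF, Gate.qubits, hj, h1, h2, h3, h4, h5]

theorem targets_counterRow_subset :
    (counterRow one d C C' k).targets ⊆ {q | ∃ j, q = C' j} := by
  intro q hq
  simp only [counterRow, Circuit.targets_flatMap, Set.mem_iUnion, List.mem_range] at hq
  obtain ⟨j, hj, hq⟩ := hq
  refine ⟨j, ?_⟩
  by_cases hs : j = 0 <;> simpa [hs, Gate.target] using hq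

theorem cl_counterRow (hi : Function.Injective C') (h2 : ∀ j, one ≠ C' j) (h4 : ∀ j, d ≠ C' j)
    (h5 : ∀ i j, C i ≠ C' j) {b : Basis} (ho : b one = true) (hz : ∀ j, b (C' j) = false) {c : ℕ}
    (hc : ∀ j < k, b (C j) = decide (j ≤ c)) : ∀ j < k,
      Circuit.cl (counterRow one d C C' k) b (C' j) = decide (j ≤ c + (b d).toNat) := by
  have aux : ∀ i ≤ k, ∀ j, Circuit.cl (counterRow one d C C' i) b (C' j) =
      (decide (j < i) && decide (j ≤ c + (b d).toNat)) := by
    intro i hik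
    induction i with
    | zero => simp [counterRow, hz]
    | succ i ih =>
      intro j
      have hnt : ∀ q, (∀ j, q ≠ C' j) → Circuit.cl (counterRow one d C C' i) b q = b q :=
        fun q hq => Circuit.cl_apply_of_notMem _ _ _ fun hq' => by
          obtain ⟨l, e⟩ := targets_counterRow_subset hq'; exact hq l e
      have e1 := hnt one h2
      have e2 := hnt d h4
      have e3 := fun i => hnt (C i) (h5 i)
      have ih' := ih (by omega)
      have e : counterRow one d C C' (i + 1) = counterRow one d C C' i ++
          (Gate.toff one (C i) (C' i) ::
            if i = 0 then [] else [Gate.toff d (C (i - 1)) (C' i), Gate.toff d (C i) (C' i)]) := by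
        simp [counterRow, List.range_succ]
      rw [e, Circuit.cl_append]
      set b' := Circuit.cl (counterRow one d C C' i) b
      by_cases hji : j = i
      · subst hji
        have hcj := hc j (by omega)
        by_cases hj : j = 0
        · subst hj
          simp [Circuit.cl, Gate.apply, e1, e3, ih', ho, hcj]
        · have hcj' := hc (j - 1) (by omega)
          simp [Circuit.cl, Gate.apply, hj, e1, e2, e3, h4, h5, ih', ho, hcj, hcj']
          cases b d
          · simp
          · by_cases h1 : j ≤ c
            · have h2 : j ≤ c + 1 := by omega
              simp [h1, h2]
            · simp [h1]
      · have hne : C' j ≠ C' i := fun e => hji (hi e)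
        have hlt : (j < i + 1) ↔ j < i := by omega
        by_cases hj : i = 0
        · subst hj
          simp [Circuit.cl, Gate.apply, hne, ih']
          omega
        · simp [Circuit.cl, Gate.apply, hj, hne, ih', hlt]
  intro j hj
  rw [aux k le_rfl]
  simp [hj]

end counterRow

/-! ### Random bits and the preparation of a qubit in state `|1⟩` -/

/-- Hadamard gates on the qubits `X 0, …, X (n - 1)`. -/
def hadamards (X : ℕ → ℕ) (n : ℕ) : Circuit := (List.range n).flatMap fun j => [Gate.had (X j)]

theorem hadamards_succ (X : ℕ → ℕ) (n : ℕ) :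
    hadamards X (n + 1) = hadamards X n ++ [Gate.had (X n)] := by
  simp [hadamards, List.range_succ]

theorem targets_hadamards (X : ℕ → ℕ) (n : ℕ) :
    (hadamards X n).targets = {q | ∃ j < n, q = X j} := by
  ext q; simp [hadamards, Gate.target]

theorem wf_hadamards (X : ℕ → ℕ) (n : ℕ) : (hadamards X n).WF :=
  Circuit.WF.flatMap fun j _ => by simp [Circuit.WF, Gate.WF, Gate.qubits]

/-- Hadamard gates on fresh qubits produce a uniformly random string. -/
theorem ex_hadamards {X : ℕ → ℕ} (hX : Function.Injective X) (n : ℕ) (b : Basis)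
    (g : Basis → ℝ) (G : (Fin n → Bool) → ℝ)
    (hG : ∀ x b', (∀ j : Fin n, b' (X j) = x j) → (∀ q, (∀ j < n, q ≠ X j) → b' q = b q) →
      g b' = G x) :
    (hadamards X n).ex b g = (∑ x, G x) / 2 ^ n := by
  induction n generalizing g with
  | zero =>
    simp only [hadamards, List.range_zero, List.flatMap_nil, Circuit.ex_nil, pow_zero, div_one,
      Fintype.sum_unique]
    exact hG _ b (fun j => j.elim0) (fun _ _ => rfl)
  | succ n ih =>
    rw [hadamards_succ, Circuit.ex_append]
    · rw [ih _ fun x => (G (Fin.snoc x false) + G (Fin.snoc x true)) / 2]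
      · rw [← (Fin.snocEquiv fun _ => Bool).sum_comp, Fintype.sum_prod_type]
        simp only [Fintype.sum_bool, Fin.snocEquiv, Equiv.coe_fn_mk]
        rw [← Finset.sum_add_distrib, ← Finset.sum_div, pow_succ, div_div, mul_comm (2 : ℝ)]
        congr 1
        exact Finset.sum_congr rfl fun x _ => add_comm _ _
      · intro x b' h1 h2
        rw [Circuit.ex_had]
        have key : ∀ v, g (Function.update b' (X n) v) =
            G (Fin.snoc (α := fun _ => Bool) x v) := by
          intro v
          apply hG
          · intro j
            refine Fin.lastCases ?_ (fun i => ?_) j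
            · simp
            · rw [Fin.snoc_castSucc, Function.update_of_ne]
              · exact h1 i
              · intro e; have := hX e; simp at this; omega
          · intro q hq
            rw [Function.update_of_ne (hq n (by omega)), h2 q fun j hj => hq j (by omega)]
        rw [key, key]
    · rw [targets_hadamards, Set.disjoint_left]
      rintro q ⟨j, hj, rfl⟩ h
      simp only [Circuit.targets_cons, Gate.target, Circuit.targets_nil, insert_empty_eq,
        Set.mem_singleton_iff] at h
      have := hX h; omega

/-- The random bits used by `prepareOr`. -/
def prepareBits (x y : ℕ → ℕ) (J : ℕ) : Circuit :=
  (List.range J).flatMap fun j => [Gate.had (x j), Gate.had (y j)]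

/-- Replaces the qubits `o` and `o'`, both in state `|0⟩`, by the disjunction of all
`x j ∧ y j`. -/
def prepareOr (o o' : ℕ) (x y v w : ℕ → ℕ) (J : ℕ) : Circuit :=
  (List.range J).flatMap fun j =>
    [Gate.toff (x j) (y j) (v j), Gate.toff o (v j) (w j), Gate.toff (x j) (y j) o,
      Gate.toff (w j) (x j) o, Gate.toff (x j) (y j) o', Gate.toff (w j) (x j) o']

/-- The qubits used by `prepareOr` are distinct. -/
structure PrepareOK (o o' : ℕ) (x y v w : ℕ → ℕ) : Prop where
  oo' : o ≠ o'
  ox : ∀ j, o ≠ x j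
  oy : ∀ j, o ≠ y j
  ov : ∀ j, o ≠ v j
  ow : ∀ j, o ≠ w j
  ox' : ∀ j, o' ≠ x j
  oy' : ∀ j, o' ≠ y j
  ov' : ∀ j, o' ≠ v j
  ow' : ∀ j, o' ≠ w j
  xy : ∀ i j, x i ≠ y j
  xv : ∀ i j, x i ≠ v j
  xw : ∀ i j, x i ≠ w j
  yv : ∀ i j, y i ≠ v j
  yw : ∀ i j, y i ≠ w j
  vw : ∀ i j, v i ≠ w j
  x_inj : Function.Injective x
  y_inj : Function.Injective y
  v_inj : Function.Injective v
  w_inj : Function.Injective w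

section prepare

variable {o o' : ℕ} {x y v w : ℕ → ℕ} {J : ℕ}

theorem isClassical_prepareOr : (prepareOr o o' x y v w J).IsClassical :=
  Circuit.IsClassical.flatMap fun j _ => by simp [Circuit.IsClassical, Gate.IsClassical]

theorem wf_prepareOr (h : PrepareOK o o' x y v w) : (prepareOr o o' x y v w J).WF :=
  Circuit.WF.flatMap fun j _ => by
    simp [Circuit.WF, Gate.WF, Gate.qubits, h.xy, h.xv, h.yv, h.ov, h.ow, h.vw, (h.ox _).symm,
      (h.oy _).symm, (h.xw _ _).symm, (h.ow _).symm, (h.ox' _).symm, (h.oy' _).symm,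
      (h.ow' _).symm]

theorem wf_prepareBits : (prepareBits x y J).WF :=
  Circuit.WF.flatMap fun j _ => by simp [Circuit.WF, Gate.WF, Gate.qubits]

theorem targets_prepareOr_subset : (prepareOr o o' x y v w J).targets ⊆
    {q | q = o ∨ q = o' ∨ ∃ j < J, q = v j ∨ q = w j} := by
  intro q hq
  simp only [prepareOr, Circuit.targets_flatMap, Set.mem_iUnion, List.mem_range] at hq
  obtain ⟨j, hj, hq⟩ := hq
  simp [Gate.target] at hq
  simp only [Set.mem_ofPred_eq]
  rcases hq with h | h | h | h
  exacts [Or.inr (Or.inr ⟨j, hj, Or.inl h⟩), Or.inr (Or.inr ⟨j, hj, Or.inr h⟩), Or.inl h,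
    Or.inr (Or.inl h)]

theorem targets_prepareBits_subset : (prepareBits x y J).targets ⊆
    {q | ∃ j < J, q = x j ∨ q = y j} := by
  intro q hq
  simp only [prepareBits, Circuit.targets_flatMap, Set.mem_iUnion, List.mem_range] at hq
  obtain ⟨j, hj, hq⟩ := hq
  simp [Gate.target] at hq
  exact ⟨j, hj, hq⟩

theorem cl_prepareOr (h : PrepareOK o o' x y v w) {b : Basis} (ho : b o = false)
    (ho' : b o' = false) (hv : ∀ j, b (v j) = false) (hw : ∀ j, b (w j) = false) :
    Circuit.cl (prepareOr o o' x y v w J) b o = decide (∃ j < J, b (x j) ∧ b (y j)) ∧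
    Circuit.cl (prepareOr o o' x y v w J) b o' = decide (∃ j < J, b (x j) ∧ b (y j)) := by
  induction J with
  | zero => simp [prepareOr, ho, ho']
  | succ J ih =>
    have hnt : ∀ q, q ≠ o → q ≠ o' → (∀ j < J, q ≠ v j ∧ q ≠ w j) →
        Circuit.cl (prepareOr o o' x y v w J) b q = b q :=
      fun q h1 h2 h3 => Circuit.cl_apply_of_notMem _ _ _ fun hq => by
        rcases targets_prepareOr_subset hq with e | e | ⟨j, hj, e | e⟩
        exacts [h1 e, h2 e, (h3 j hj).1 e, (h3 j hj).2 e]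
    have ex := hnt (x J) (h.ox J).symm (h.ox' J).symm fun j _ => ⟨h.xv _ _, h.xw _ _⟩
    have ey := hnt (y J) (h.oy J).symm (h.oy' J).symm fun j _ => ⟨h.yv _ _, h.yw _ _⟩
    have ev := hnt (v J) (h.ov J).symm (h.ov' J).symm
      fun j hj => ⟨fun e => by have := h.v_inj e; omega, h.vw _ _⟩
    have ew := hnt (w J) (h.ow J).symm (h.ow' J).symm
      fun j hj => ⟨(h.vw _ _).symm, fun e => by have := h.w_inj e; omega⟩
    have e : prepareOr o o' x y v w (J + 1) = prepareOr o o' x y v w J ++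
        [Gate.toff (x J) (y J) (v J), Gate.toff o (v J) (w J), Gate.toff (x J) (y J) o,
        Gate.toff (w J) (x J) o, Gate.toff (x J) (y J) o', Gate.toff (w J) (x J) o'] := by
      simp [prepareOr, List.range_succ]
    rw [e, Circuit.cl_append]
    set b' := Circuit.cl (prepareOr o o' x y v w J) b
    have hd : (∃ j < J + 1, b (x j) ∧ b (y j)) ↔
        (∃ j < J, b (x j) ∧ b (y j)) ∨ (b (x J) ∧ b (y J)) := by
      simp only [Nat.lt_succ_iff_lt_or_eq, or_and_right, exists_or, exists_eq_left]
    simp only [hd, Bool.decide_or, ← ih.1]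
    have e2 : b' o' = b' o := by rw [ih.1, ih.2]
    constructor
    · simp [Circuit.cl, Gate.apply, ex, ey, ev, ew, hv, hw, h.oo'.symm, h.oo', h.ov, h.ow, h.ov',
        h.ow', h.xv, h.xw, h.yw, (h.ox _).symm, (h.oy _).symm, h.yv, (h.ow _).symm,
        (h.vw _ _).symm]
      cases b' o <;> cases b (x J) <;> cases b (y J) <;> rfl
    · simp [Circuit.cl, Gate.apply, ex, ey, ev, ew, hv, hw, h.oo'.symm, h.ov, h.ow, h.ov',
        h.ow', h.xv, h.xw, h.yw, (h.ox _).symm, (h.oy _).symm, h.yv, (h.ow _).symm,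
        (h.vw _ _).symm, (h.ox' _).symm, (h.ow' _).symm, e2]
      cases b' o <;> cases b (x J) <;> cases b (y J) <;> rfl

theorem ex_prepareBits (h : PrepareOK o o' x y v w) (b : Basis) :
    (prepareBits x y J).ex b (fun b' => if ∃ j < J, b' (x j) ∧ b' (y j) then 0 else 1) =
      (3 / 4) ^ J := by
  induction J with
  | zero => simp [prepareBits]
  | succ J ih =>
    have e : prepareBits x y (J + 1) = prepareBits x y J ++
        ([Gate.had (x J)] ++ [Gate.had (y J)]) := by
      simp [prepareBits, List.range_succ]
    have hxy := h.xy J J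
    rw [e, Circuit.ex_append]
    · rw [pow_succ, mul_comm, ← ih, ← Circuit.ex_const_mul]
      congr 1
      funext b'
      rw [Circuit.ex_append (by simp [Gate.target, hxy]), Circuit.ex_had, Circuit.ex_had,
        Circuit.ex_had]
      have key : ∀ s t : Bool, (∃ j < J + 1, Function.update (Function.update b' (x J) s) (y J) t
          (x j) = true ∧ Function.update (Function.update b' (x J) s) (y J) t (y j) = true) ↔
          (∃ j < J, b' (x j) ∧ b' (y j)) ∨ (s ∧ t) := by
        intro s t
        simp only [Nat.lt_succ_iff_lt_or_eq, or_and_right, exists_or, exists_eq_left]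
        refine or_congr ?_ (by simp [hxy])
        refine exists_congr fun j => and_congr_right fun hj => ?_
        have h1 : x j ≠ x J := fun e => by have := h.x_inj e; omega
        have h2 : y j ≠ y J := fun e => by have := h.y_inj e; omega
        simp [h1, h2, h.xy, (h.xy _ _).symm]
      simp only [key]
      by_cases hc : ∃ j < J, b' (x j) ∧ b' (y j)
      · simp [hc]
      · simp [hc]; norm_num
    · rw [Set.disjoint_left]
      intro q hq hq'
      obtain ⟨j, hj, hq⟩ := targets_prepareBits_subset hq
      simp [Gate.target] at hq'
      rcases hq with rfl | rfl <;> rcases hq' with e | e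
      · have := h.x_inj e; omega
      · exact h.xy _ _ e
      · exact h.xy _ _ e.symm
      · have := h.y_inj e; omega

end prepare

/-! ### The qubits of the tester -/

/-- The work qubits of the tester have addresses with four components, a kind `k`, a round `r`, a
sample `t` and an index `i`; the first `N` qubits hold the input. -/
@[irreducible] def ad (N k r t i : ℕ) : ℕ := N + Nat.pair k (Nat.pair r (Nat.pair t i))

@[simp] theorem ad_inj {N k r t i k' r' t' i' : ℕ} :
    ad N k r t i = ad N k' r' t' i' ↔ k = k' ∧ r = r' ∧ t = t' ∧ i = i' := by
  simp [ad, Nat.pair_eq_pair]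

theorem le_ad (N k r t i : ℕ) : N ≤ ad N k r t i := by simp [ad]

/-- A qubit in state `|1⟩`. -/
def one (N : ℕ) : ℕ := ad N 0 0 0 0

/-- Another qubit in state `|1⟩`. -/
def two (N : ℕ) : ℕ := ad N 0 0 0 1

/-- The acceptance bit after `r` rounds. -/
def accQ (N r : ℕ) : ℕ := ad N 2 r 0 0

/-- The learner's qubit `q` in round `r`. -/
def learnQ (N r q : ℕ) : ℕ := ad N 3 r 0 q

/-- The record of the learner's intermediate measurement number `i` in round `r`. -/
def measQ (N r i : ℕ) : ℕ := ad N 4 r 0 i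

/-- The ancillas of a chain of conjunctions, starting with a qubit in state `|1⟩`. -/
def ancQ (N k r t l : ℕ) : ℕ := if l = 0 then two N else ad N k r t l

@[simp] theorem ancQ_zero (N k r t : ℕ) : ancQ N k r t 0 = two N := rfl

@[simp] theorem ancQ_succ (N k r t l : ℕ) : ancQ N k r t (l + 1) = ad N k r t (l + 1) := rfl

theorem le_ancQ (N k r t l : ℕ) : N ≤ ancQ N k r t l := by
  unfold ancQ two; split <;> exact le_ad _ _ _ _ _

theorem ad_ne_ancQ {N k r t k' r' t' i : ℕ} (h : k' ≠ 0) (hk : k' ≠ k) (l : ℕ) :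
    ad N k' r' t' i ≠ ancQ N k r t l := by
  unfold ancQ two; split <;> simp [h, hk]

theorem chainOK_ancQ {N k r t k' r' t' : ℕ} (p : ℕ → ℕ) (hk0 : k ≠ 0) (h : k' ≠ 0)
    (hk : k' ≠ k) : ChainOK (one N) (ancQ N k r t) fun j => ad N k' r' t' (p j) where
  inj := by
    intro l l' e
    rcases l with _ | l <;> rcases l' with _ | l'
    · rfl
    · simp [two, hk0.symm] at e
    · simp [two, hk0] at e
    · simpa using e
  one := by
    intro l
    rcases l with _ | l
    · simp [two, one]
    · simp [one, hk0]
  pos := fun l j => (ad_ne_ancQ h hk l).symm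

/-! ### Simulating the learner -/

/-- The number of tokens of the operation whose description starts at position `p`. -/
def opLen (T : List ℕ) (p : ℕ) : ℕ :=
  if T.getD p 0 = 1 then 4 else if T.getD p 0 = 2 then 3 + T.getD (p + 1) 0 else 2

/-- The position in `T` at which the description of operation number `i` starts. -/
def opPos (T : List ℕ) (i : ℕ) : ℕ := Nat.rec 1 (fun _ p => p + opLen T p) i

/-- The simulation of operation number `i`, whose description starts at position `p` of `T`. -/
def learnStep (N n : ℕ) (T : List ℕ) (r p i : ℕ) : Circuit :=
  if p < T.length then
    if T.getD p 0 = 0 then [Gate.had (learnQ N r (T.getD (p + 1) 0))]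
    else if T.getD p 0 = 1 then
      [Gate.toff (learnQ N r (T.getD (p + 1) 0)) (learnQ N r (T.getD (p + 2) 0))
        (learnQ N r (T.getD (p + 3) 0))]
    else if T.getD p 0 = 2 then
      lookup (one N) (ancQ N 5 r 0) (fun j => learnQ N r (T.getD (p + 3 + j) 0)) n
        (learnQ N r (T.getD (p + 2) 0))
    else [Gate.toff (one N) (learnQ N r (T.getD (p + 1) 0)) (measQ N r i)]
  else []

/-- The simulation of the learner with description `T` in round `r`. -/
def learn (N n : ℕ) (T : List ℕ) (r : ℕ) : Circuit :=
  (List.range T.length).flatMap fun i => learnStep N n T r (opPos T i) i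

/-- The tokens in the description of an oracle circuit. -/
def OracleCircuit.tokens (Q : OracleCircuit) : List ℕ :=
  Q.outLen :: Q.gates.flatMap OracleGate.tokens

theorem lookup_congr {o n t : ℕ} {anc pos pos' : ℕ → ℕ} (h : ∀ j < n, pos j = pos' j) :
    lookup o anc pos n t = lookup o anc pos' n t := by
  have : ∀ sgn, chain o anc pos sgn n = chain o anc pos' sgn n := by
    intro sgn
    unfold chain
    rw [List.flatMap, List.flatMap]
    congr 1
    refine List.map_congr_left fun j hj => ?_
    rw [h j (List.mem_range.1 hj)]
  simp only [lookup, this]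

/-- The circuit that carries out an operation of the learner. -/
def OracleGate.simCirc (N n r i : ℕ) : OracleGate → Circuit
  | gate g => [g.map (learnQ N r)]
  | query xs t => lookup (one N) (ancQ N 5 r 0) (fun j => learnQ N r (xs.getD j 0)) n
      (learnQ N r t)
  | meas q => [Gate.toff (one N) (learnQ N r q) (measQ N r i)]

theorem getD_add_eq {T l rest : List ℕ} {p k : ℕ} (h : T.drop p = l ++ rest) (hk : k < l.length) :
    T.getD (p + k) 0 = l.getD k 0 := by
  have : T[p + k]? = (T.drop p)[k]? := by rw [List.getElem?_drop]
  rw [List.getD_eq_getElem?_getD, this, h, List.getElem?_append_left hk,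
    ← List.getD_eq_getElem?_getD]

theorem opLen_eq {T rest : List ℕ} {p : ℕ} {g : OracleGate} (h : T.drop p = g.tokens ++ rest) :
    opLen T p = g.tokens.length := by
  have h0 := getD_add_eq (k := 0) h
  have h1 := getD_add_eq (k := 1) h
  rcases g with (g | _) | _ | _ <;>
    simp [OracleGate.tokens, Gate.tokens] at h0 h1 ⊢ <;> simp [opLen, h0, h1] <;> omega

theorem learnStep_eq {N n r i p : ℕ} {T rest : List ℕ} {g : OracleGate} (hg : g.WF n)
    (h : T.drop p = g.tokens ++ rest) : learnStep N n T r p i = g.simCirc N n r i := by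
  have hp : p < T.length := by
    by_contra hc
    rw [List.drop_eq_nil_of_le (by omega)] at h
    rcases g with (g | _) | _ | _ <;> simp [OracleGate.tokens, Gate.tokens] at h
  rcases g with (a | ⟨a, b, c⟩) | ⟨xs, t⟩ | a
  · have h0 : T.getD p 0 = 0 := 
      getD_add_eq (k := 0) h (by simp [OracleGate.tokens, Gate.tokens])
    have h1 : T.getD (p + 1) 0 = a := 
      getD_add_eq (k := 1) h (by simp [OracleGate.tokens, Gate.tokens])
    simp only [learnStep, if_pos hp, h0, h1, if_true, OracleGate.simCirc, Gate.map]
  · have h0 : T.getD p 0 = 1 := 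
      getD_add_eq (k := 0) h (by simp [OracleGate.tokens, Gate.tokens])
    have h1 : T.getD (p + 1) 0 = a := 
      getD_add_eq (k := 1) h (by simp [OracleGate.tokens, Gate.tokens])
    have h2 : T.getD (p + 2) 0 = b := 
      getD_add_eq (k := 2) h (by simp [OracleGate.tokens, Gate.tokens])
    have h3 : T.getD (p + 3) 0 = c := 
      getD_add_eq (k := 3) h (by simp [OracleGate.tokens, Gate.tokens])
    simp only [learnStep, if_pos hp, h0, h1, h2, h3, one_ne_zero, if_false, if_true,
      OracleGate.simCirc, Gate.map]
  · have h0 : T.getD p 0 = 2 := getD_add_eq (k := 0) h (by simp [OracleGate.tokens])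
    have h2 : T.getD (p + 2) 0 = t := getD_add_eq (k := 2) h (by simp [OracleGate.tokens])
    simp only [learnStep, if_pos hp, h0, h2, OfNat.ofNat_ne_zero, OfNat.ofNat_ne_one, if_false,
      if_true, OracleGate.simCirc]
    refine lookup_congr fun j hj => ?_
    have hj' : j < xs.length := by rw [hg.1]; exact hj
    rw [add_assoc, getD_add_eq (k := 3 + j) h (by simp [OracleGate.tokens]; omega),
      show 3 + j = j + 1 + 1 + 1 by omega]
    rfl
  · have h0 : T.getD p 0 = 3 := getD_add_eq (k := 0) h (by simp [OracleGate.tokens])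
    have h1 : T.getD (p + 1) 0 = a := getD_add_eq (k := 1) h (by simp [OracleGate.tokens])
    simp only [learnStep, if_pos hp, h0, h1, OfNat.ofNat_ne_zero, OfNat.ofNat_ne_one,
      show (3 : ℕ) ≠ 2 by decide, if_false, OracleGate.simCirc]

theorem drop_opPos (Q : OracleCircuit) {i : ℕ} (hi : i ≤ Q.gates.length) :
    Q.tokens.drop (opPos Q.tokens i) = (Q.gates.drop i).flatMap OracleGate.tokens := by
  induction i with
  | zero => simp [opPos, OracleCircuit.tokens]
  | succ i ih =>
    have hi' : i < Q.gates.length := hi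
    have h := ih hi'.le
    rw [List.drop_eq_getElem_cons hi', List.flatMap_cons] at h
    have e : opPos Q.tokens (i + 1) = opPos Q.tokens i + opLen Q.tokens (opPos Q.tokens i) := rfl
    rw [e, opLen_eq h, ← List.drop_drop, h, List.drop_left]

theorem length_le_opPos (Q : OracleCircuit) {i : ℕ} (hi : Q.gates.length ≤ i) :
    Q.tokens.length ≤ opPos Q.tokens i := by
  induction i, hi using Nat.le_induction with
  | base =>
    have := drop_opPos Q le_rfl
    rw [List.drop_length, List.flatMap_nil, List.drop_eq_nil_iff] at this
    exact this
  | succ i hi ih => exact ih.trans (Nat.le_add_right _ _)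

theorem length_gates_le (Q : OracleCircuit) : Q.gates.length ≤ Q.tokens.length := by
  simp only [OracleCircuit.tokens, List.length_cons, List.length_flatMap]
  have : ∀ l : List OracleGate, l.length ≤ (l.map fun g => g.tokens.length).sum := by
    intro l
    induction l with
    | nil => simp
    | cons g l ih =>
      have : 1 ≤ g.tokens.length := by
        rcases g with (g | _) | _ | _ <;> simp [OracleGate.tokens, Gate.tokens]
      simp only [List.length_cons, List.map_cons, List.sum_cons]; omega
  have := this Q.gates
  omega

/-- The step of the simulation that carries out operation number `i` of the learner. -/
noncomputable def OracleGate.simBlock (N r : ℕ) {n : ℕ} (f : BoolFun n) (i : ℕ) :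
    OracleGate → SimBlock
  | gate g => ⟨(gate g).simCirc N n r i, measQ N r i, g.act, 0⟩
  | query xs t => ⟨(query xs t).simCirc N n r i, measQ N r i, queryAct f xs t, 0⟩
  | meas q => ⟨(meas q).simCirc N n r i, measQ N r i,
      fun a => if a q = false then ket a else 0, fun a => if a q = true then ket a else 0⟩

theorem simBlock_circ {N r n : ℕ} (f : BoolFun n) (i : ℕ) (g : OracleGate) :
    (g.simBlock N r f i).circ = g.simCirc N n r i := by cases g <;> rfl

theorem simBlock_scratch {N r n : ℕ} (f : BoolFun n) (i : ℕ) (g : OracleGate) :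
    (g.simBlock N r f i).scratch = measQ N r i := by cases g <;> rfl

theorem learn_eq {N n r : ℕ} {Q : OracleCircuit} (hQ : Q.WF n) (f : BoolFun n) :
    learn N n Q.tokens r =
      (Q.gates.mapIdx fun i g => g.simBlock N r f i).flatMap SimBlock.circ := by
  obtain ⟨k, hk⟩ := Nat.exists_eq_add_of_le (length_gates_le Q)
  have h1 : learn N n Q.tokens r = (List.range Q.gates.length).flatMap
      fun i => learnStep N n Q.tokens r (opPos Q.tokens i) i := by
    rw [learn, hk, List.range_add, List.flatMap_append]
    convert List.append_nil _ using 2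
    rw [List.flatMap_eq_nil_iff]
    intro i hi
    simp only [List.mem_map] at hi
    obtain ⟨j, -, rfl⟩ := hi
    have := length_le_opPos Q (i := Q.gates.length + j) (by omega)
    simp [learnStep, this]
  rw [h1, List.flatMap, List.flatMap]
  congr 1
  apply List.ext_getElem
  · simp
  · intro i hi _
    simp only [List.length_map, List.length_range] at hi
    have h := drop_opPos Q hi.le
    rw [List.drop_eq_getElem_cons hi, List.flatMap_cons] at h
    simp only [List.getElem_map, List.getElem_range, List.getElem_mapIdx, simBlock_circ]
    exact learnStep_eq (hQ _ (List.getElem_mem _)) h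

/-- The only qubit that an operation changes. -/
def OracleGate.target : OracleGate → List ℕ
  | gate g => [g.target]
  | query _ t => [t]
  | meas _ => []

/-- The qubits that an oracle circuit changes. -/
def OracleCircuit.targets (Q : OracleCircuit) : Finset ℕ :=
  (Q.gates.flatMap OracleGate.target).toFinset

theorem OracleCircuit.card_targets_le (Q : OracleCircuit) : Q.targets.card ≤ Q.size := by
  refine (List.toFinset_card_le _).trans ?_
  rw [List.length_flatMap, OracleCircuit.size]
  refine le_of_eq ?_
  congr 1
  refine List.map_congr_left fun g _ => ?_
  cases g <;> rfl

theorem targets_simCirc {N n r i : ℕ} {g : OracleGate} {q : ℕ}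
    (h : q ∈ (g.simCirc N n r i).targets) :
    (∃ p ∈ g.target, q = learnQ N r p) ∨ (∃ l, q = ad N 5 r 0 (l + 1)) ∨ q = measQ N r i := by
  cases g with
  | gate g => cases g <;>
      (simp [OracleGate.simCirc, Gate.map, Gate.target] at h
       simp [OracleGate.target, Gate.target, h])
  | query xs t =>
    rcases targets_lookup_subset h with e | ⟨l, e⟩
    · exact Or.inl ⟨t, by simp [OracleGate.target], e⟩
    · exact Or.inr (Or.inl ⟨l, e⟩)
  | meas p =>
    simp [OracleGate.simCirc, Gate.target] at h
    exact Or.inr (Or.inr h)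

theorem targets_learn {N n r : ℕ} {Q : OracleCircuit} (hQ : Q.WF n) {q : ℕ}
    (h : q ∈ (learn N n Q.tokens r).targets) :
    (∃ p ∈ Q.targets, q = learnQ N r p) ∨ (∃ l, q = ad N 5 r 0 (l + 1)) ∨
      ∃ i, q = measQ N r i := by
  rw [learn_eq hQ fun _ => false] at h
  simp only [Circuit.targets_flatMap, Set.mem_iUnion, List.mem_mapIdx] at h
  obtain ⟨_, ⟨i, hi, rfl⟩, h⟩ := h
  rw [simBlock_circ] at h
  rcases targets_simCirc h with ⟨p, hp, e⟩ | h | h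
  · refine Or.inl ⟨p, ?_, e⟩
    simp only [OracleCircuit.targets, List.mem_toFinset, List.mem_flatMap]
    exact ⟨_, List.getElem_mem _, hp⟩
  · exact Or.inr (Or.inl h)
  · exact Or.inr (Or.inr ⟨_, h⟩)

theorem learnQ_injective (N r : ℕ) : Function.Injective (learnQ N r) := by
  intro q q' h; simpa [learnQ] using h

theorem wf_map {g : Gate} (hg : g.WF) {ι : ℕ → ℕ} (hι : Function.Injective ι) :
    (g.map ι).WF := by
  cases g <;> simp_all [Gate.WF, Gate.map, Gate.qubits, hι.eq_iff]

theorem wf_learn {n r : ℕ} {Q : OracleCircuit} (hQ : Q.WF n) :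
    (learn (2 ^ n) n Q.tokens r).WF := by
  rw [learn_eq hQ fun _ => false]
  refine Circuit.WF.flatMap fun B hB => ?_
  rw [List.mem_mapIdx] at hB
  obtain ⟨i, hi, rfl⟩ := hB
  rw [simBlock_circ]
  have hg := hQ _ (List.getElem_mem hi)
  generalize Q.gates[i] = o at hg
  cases o with
  | gate g => simpa [OracleGate.simCirc, Circuit.WF] using wf_map hg (learnQ_injective _ r)
  | query xs t =>
    exact wf_lookup (chainOK_ancQ _ (by simp) (by simp) (by simp))
      (ad_ne_ancQ (by simp) (by simp)) (le_ad _ _ _ _ _) (le_ancQ _ _ _ _)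
  | meas q => simp [OracleGate.simCirc, Circuit.WF, Gate.WF, Gate.qubits, one, learnQ, measQ]

/-- The environment in which the learner is simulated. -/
structure LearnEnv {n : ℕ} (f : BoolFun n) (b : Basis) : Prop where
  one : b (one (2 ^ n)) = true
  two : b (two (2 ^ n)) = true
  tt : ∀ i : Fin (2 ^ n), b i = tt f i

theorem correct_simBlock {n r i : ℕ} (f : BoolFun n) {g : OracleGate} (hg : g.WF n) :
    (g.simBlock (2 ^ n) r f i).Correct (learnQ (2 ^ n) r) fun b =>
      LearnEnv f b ∧ ∀ l, b (ad (2 ^ n) 5 r 0 (l + 1)) = false := by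
  intro b a ⟨hb, hanc⟩ hs
  rw [simBlock_scratch] at hs
  have hι := learnQ_injective (2 ^ n) r
  have hout : ∀ k r' t' i', k ≠ 3 → ad (2 ^ n) k r' t' i' ∉ Set.range (learnQ (2 ^ n) r) := by
    rintro k r' t' i' hk ⟨q, e⟩
    simp [learnQ, hk.symm] at e
  cases g with
  | gate g =>
    simp only [OracleGate.simBlock, OracleGate.simCirc, Circuit.run_cons, Circuit.run_nil,
      linExt_ket, Pi.zero_apply, place_zero, add_zero]
    exact place_act hι g b a
  | query xs t =>
    simp only [OracleGate.simBlock, OracleGate.simCirc, Pi.zero_apply, place_zero, add_zero]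
    have hch : ChainOK (QLearn.one (2 ^ n)) (ancQ (2 ^ n) 5 r 0)
        (fun j => learnQ (2 ^ n) r (xs.getD j 0)) :=
      chainOK_ancQ _ (by simp) (by simp) (by simp)
    have hta : ∀ l, learnQ (2 ^ n) r t ≠ ancQ (2 ^ n) 5 r 0 l := ad_ne_ancQ (by simp) (by simp)
    rw [Circuit.run_ket_of_isClassical isClassical_lookup, queryAct, place_ket, emb_update hι,
      cl_lookup hch hta
        (le_ad _ _ _ _ _) (le_ancQ _ _ _ _) (by simp [learnQ, QLearn.one]) ?_ ?_ ?_ ?_ f ?_]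
    · simp only [emb_apply hι]
    · intro j hj
      have hx : xs.length = n := hg.1
      have ht := (List.nodup_cons.1 hg.2).1
      intro e
      rw [hι e] at ht
      apply ht
      rw [List.getD_eq_getElem _ _ (by omega)]
      exact List.getElem_mem _
    · exact (emb_apply_of_notMem _ _ (hout 0 0 0 0 (by simp))).trans hb.one
    · exact (emb_apply_of_notMem _ _ (hout 0 0 0 1 (by simp))).trans hb.two
    · intro l
      rw [ancQ_succ, emb_apply_of_notMem _ _ (hout _ _ _ _ (by simp))]; exact hanc l
    · intro j
      rw [emb_apply_of_notMem, hb.tt]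
      rintro ⟨q, e⟩
      have := le_ad (2 ^ n) 3 r 0 q
      have := j.2
      simp only [learnQ] at e; omega
  | meas q =>
    have h1 := emb_apply_of_notMem b a (hout 0 0 0 0 (by simp))
    have h2 := emb_apply_of_notMem b a (hout 4 r 0 i (by simp))
    have h3 := hb.one
    rw [QLearn.one] at h3
    rw [measQ] at hs
    rw [h3] at h1
    rw [hs] at h2
    simp only [OracleGate.simBlock, OracleGate.simCirc, Circuit.run_cons, Circuit.run_nil,
      linExt_ket, Gate.act, one, measQ, emb_apply hι, h1, h2]
    cases ha : a q
    · have : Function.update (emb (learnQ (2 ^ n) r) b a) (ad (2 ^ n) 4 r 0 i) false =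
          emb (learnQ (2 ^ n) r) b a := by rw [← h2]; simp
      simp [this]
    · simp [emb_update_env _ _ (hout 4 r 0 i (by simp))]

/-- The expected value of `g` on the outcome of an oracle circuit. -/
noncomputable def OracleCircuit.outcomeExp (Q : OracleCircuit) {n : ℕ} (f : BoolFun n)
    (g : Basis → ℝ) : ℝ :=
  branchExp g (Q.gates.mapIdx fun i o => o.simBlock 0 0 f i) (ket fun _ => false)

theorem branchExp_congr {g : Basis → ℝ} {l l' : List SimBlock}
    (h : l.map (fun B => (B.op0, B.op1)) = l'.map fun B => (B.op0, B.op1)) (ψ : QState) :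
    branchExp g l ψ = branchExp g l' ψ := by
  induction l generalizing l' ψ with
  | nil => cases l' with
    | nil => rfl
    | cons _ _ => simp at h
  | cons B l ih => cases l' with
    | nil => simp at h
    | cons B' l' =>
      simp only [List.map_cons, List.cons.injEq, Prod.mk.injEq] at h
      simp only [branchExp, h.1.1, h.1.2, ih h.2]

theorem linExt_ite_ket (P : Basis → Prop) [DecidablePred P] (ψ : QState) :
    linExt (fun a => if P a then ket a else 0) ψ = ψ.filter P := by
  induction ψ using Finsupp.induction_linear with
  | zero => simp [Finsupp.filter_zero]
  | add ψ φ h1 h2 => rw [linExt_add, h1, h2, Finsupp.filter_add]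
  | single a α =>
    rw [linExt_single]
    by_cases h : P a
    · rw [Finsupp.filter_single_of_pos _ h]; simp [h, ket]
    · rw [Finsupp.filter_single_of_neg _ h]; simp [h]

theorem finalProb_eq {n : ℕ} (f : BoolFun n) (E : Set Basis) (l : List OracleGate) (k : ℕ)
    (ψ : QState) : finalProb f E l ψ =
      branchExp (E.indicator 1) (l.mapIdx fun i o => o.simBlock 0 0 f (i + k)) ψ := by
  induction l generalizing k ψ with
  | nil => simp [finalProb, branchExp, weight_eq_expect]
  | cons o l ih =>
    rw [List.mapIdx_cons]
    have e : ∀ φ, branchExp (E.indicator 1)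
        (l.mapIdx fun i o => o.simBlock 0 0 f (i + 1 + k)) φ = finalProb f E l φ := by
      intro φ
      rw [ih (1 + k)]
      simp only [add_assoc]
    have hz : ∀ φ, linExt (0 : Basis → QState) φ = 0 := by
      intro φ; simp [linExt]
    simp only [branchExp, e]
    cases o with
    | gate g =>
      simp only [finalProb, OracleGate.simBlock, hz]
      rw [← e 0, branchExp_zero, add_zero]
    | query xs t =>
      simp only [finalProb, OracleGate.simBlock, hz]
      rw [← e 0, branchExp_zero, add_zero]
    | meas q => simp only [finalProb, OracleGate.simBlock, linExt_ite_ket]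

theorem outputProb_eq (Q : OracleCircuit) {n : ℕ} (f : BoolFun n) (S : Set (List Bool)) :
    Q.outputProb f S =
      Q.outcomeExp f (Set.indicator {b | (List.range Q.outLen).map b ∈ S} 1) := by
  rw [OracleCircuit.outputProb, OracleCircuit.outcomeExp, finalProb_eq f _ _ 0]
  rfl

/-- Simulating the learner gives the distribution of its measured outcome. -/
theorem ex_learn {n r : ℕ} {Q : OracleCircuit} (hQ : Q.WF n) (f : BoolFun n) {b : Basis}
    (hb : LearnEnv f b) (hz : ∀ k i, 3 ≤ k → b (ad (2 ^ n) k r 0 i) = false)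
    (g : Basis → ℝ) :
    (learn (2 ^ n) n Q.tokens r).ex b (fun b' => g fun q => b' (learnQ (2 ^ n) r q)) =
      Q.outcomeExp f g := by
  have hι := learnQ_injective (2 ^ n) r
  have e0 : ket b = place (learnQ (2 ^ n) r) b (ket fun _ => false) := by
    rw [place_ket]
    congr 1
    funext q
    by_cases hq : q ∈ Set.range (learnQ (2 ^ n) r)
    · obtain ⟨p, rfl⟩ := hq
      rw [emb_apply hι]; exact hz 3 p le_rfl
    · rw [emb_apply_of_notMem _ _ hq]
  rw [Circuit.ex, learn_eq hQ f, e0, expect_run_simulation hι (P := fun b =>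
      LearnEnv f b ∧ ∀ l, b (ad (2 ^ n) 5 r 0 (l + 1)) = false)]
  · simp only [emb_apply hι]
    refine branchExp_congr ?_ _
    apply List.ext_getElem
    · simp
    · intro i h1 h2
      simp only [List.getElem_map, List.getElem_mapIdx]
      cases Q.gates[i]'(by simpa using h1) <;> rfl
  · intro B hB b ⟨hb, hb'⟩
    obtain ⟨i, hi, rfl⟩ := List.mem_mapIdx.1 hB
    rw [simBlock_scratch]
    refine ⟨⟨?_, ?_, fun j => ?_⟩, fun l => ?_⟩
    · rw [Function.update_of_ne (by simp [one, measQ])]; exact hb.one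
    · rw [Function.update_of_ne (by simp [two, measQ])]; exact hb.two
    · rw [Function.update_of_ne]
      · exact hb.tt j
      · have := le_ad (2 ^ n) 4 r 0 i
        have := j.2
        simp only [measQ]; omega
    · rw [Function.update_of_ne (by simp [measQ])]; exact hb' l
  · intro B hB
    obtain ⟨i, hi, rfl⟩ := List.mem_mapIdx.1 hB
    exact correct_simBlock f (hQ _ (List.getElem_mem hi))
  · intro B hB
    obtain ⟨i, hi, rfl⟩ := List.mem_mapIdx.1 hB
    rw [simBlock_scratch]
    rintro ⟨q, e⟩
    simp [learnQ, measQ] at e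
  · rw [List.pairwise_iff_getElem]
    intro i j hi hj hij
    simp only [List.getElem_mapIdx, simBlock_scratch, simBlock_circ]
    constructor
    · simp [measQ]; omega
    · intro h
      rcases targets_simCirc h with ⟨p, -, e⟩ | ⟨l, e⟩ | e
      · simp [measQ, learnQ] at e
      · simp [measQ] at e
      · simp [measQ] at e; omega
  · intro B hB b
    obtain ⟨i, hi, rfl⟩ := List.mem_mapIdx.1 hB
    rw [simBlock_scratch]
    congr 1
    funext q
    rw [Function.update_of_ne (by simp [measQ, learnQ])]
  · exact ⟨hb, fun l => hz 5 _ (by norm_num)⟩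
  · intro B hB
    obtain ⟨i, hi, rfl⟩ := List.mem_mapIdx.1 hB
    rw [simBlock_scratch]
    exact hz 4 _ (by norm_num)

/-! ### Decoding and simulating the hypothesis -/

/-- A candidate for the position and the code of a gate in the description of a circuit: the
description is of a circuit on `m` qubits, and its gate number `i` has kind `k` and address fields
`a`, `b`, `c`. -/
structure Slot : Type where
  m : ℕ
  i : ℕ
  k : ℕ
  a : ℕ
  b : ℕ
  c : ℕ

namespace Slot

/-- A number that determines the slot. -/
def idx (s : Slot) : ℕ :=
  Nat.pair s.m (Nat.pair s.i (Nat.pair s.k (Nat.pair s.a (Nat.pair s.b s.c))))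

theorem idx_injective : Function.Injective idx := by
  rintro ⟨m, i, k, a, b, c⟩ ⟨m', i', k', a', b', c'⟩ h
  simpa [idx, Nat.pair_eq_pair] using h

/-- The length of the code of a gate of a circuit on `m` qubits. -/
def codeLen (m : ℕ) : ℕ := 2 + 3 * Nat.size m

/-- The bit number `j` of the code of the gate. -/
def codeBit (s : Slot) (j : ℕ) : Bool :=
  if j = 0 then true else if j = 1 then decide (s.k = 1) else
  if j - 2 < Nat.size s.m then s.a.testBit (j - 2) else
  if j - 2 < 2 * Nat.size s.m then s.b.testBit (j - 2 - Nat.size s.m) else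
  s.c.testBit (j - 2 - 2 * Nat.size s.m)

/-- A string contains the gate of the slot if it satisfies `litLen` literals: it starts with
`0^m 1`, the `i` preceding gates are announced by a `1`, and the code of the gate follows. -/
def litLen (s : Slot) : ℕ := s.m + 1 + s.i + codeLen s.m

/-- The position that literal number `l` inspects. -/
def litPos (s : Slot) (l : ℕ) : ℕ :=
  if l < s.m + 1 then l else
  if l < s.m + 1 + s.i then s.m + 1 + (l - (s.m + 1)) * codeLen s.m else
  s.m + 1 + s.i * codeLen s.m + (l - (s.m + 1 + s.i))

/-- The bit that literal number `l` expects. -/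
def litSgn (s : Slot) (l : ℕ) : Bool :=
  if l < s.m then false else if l < s.m + 1 + s.i then true else s.codeBit (l - (s.m + 1 + s.i))

/-- The string `z` contains the gate of the slot. -/
def On (z : ℕ → Bool) (s : Slot) : Prop := ∀ l < s.litLen, z (s.litPos l) = s.litSgn l

instance (z : ℕ → Bool) (s : Slot) : Decidable (s.On z) := by unfold On; infer_instance

/-- The gate of the slot, if its fields make sense. -/
def gate (s : Slot) : List Gate :=
  if s.k = 0 then if s.b = 0 then if s.c = 0 then [Gate.had s.a] else [] else []
  else if s.a = s.b then [] else if s.a = s.c then [] else if s.b = s.c then [] else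
    [Gate.toff s.a s.b s.c]

end Slot

/-- All slots of descriptions of length at most `L`. -/
def slots (L : ℕ) : List Slot :=
  (List.range L).flatMap fun m => (List.range L).flatMap fun i => (List.range 2).flatMap fun k =>
    (List.range m).flatMap fun a => (List.range m).flatMap fun b => (List.range m).flatMap fun c =>
      [⟨m, i, k, a, b, c⟩]

theorem nodup_flatMap_range {α : Type*} {n : ℕ} {F : ℕ → List α} (p : α → ℕ)
    (h1 : ∀ i, (F i).Nodup) (h2 : ∀ i, ∀ x ∈ F i, p x = i) :
    ((List.range n).flatMap F).Nodup := by
  rw [List.nodup_flatMap]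
  refine ⟨fun i _ => h1 i, List.nodup_range.imp fun {i j} hij => ?_⟩
  intro x hx hx'
  exact hij ((h2 i x hx).symm.trans (h2 j x hx'))

theorem nodup_slots (L : ℕ) : (slots L).Nodup := by
  refine nodup_flatMap_range Slot.m (fun m => nodup_flatMap_range Slot.i (fun i =>
    nodup_flatMap_range Slot.k (fun k => nodup_flatMap_range Slot.a (fun a =>
    nodup_flatMap_range Slot.b (fun b => nodup_flatMap_range Slot.c
      (fun c => List.nodup_singleton _) ?_) ?_) ?_) ?_) ?_) ?_
  all_goals
    intro _ x hx
    simp only [List.mem_flatMap, List.mem_singleton] at hx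
  · rw [hx]
  · obtain ⟨_, _, rfl⟩ := hx; rfl
  · obtain ⟨_, _, _, _, rfl⟩ := hx; rfl
  · obtain ⟨_, _, _, _, _, _, rfl⟩ := hx; rfl
  · obtain ⟨_, _, _, _, _, _, _, _, rfl⟩ := hx; rfl
  · obtain ⟨_, _, _, _, _, _, _, _, _, _, rfl⟩ := hx; rfl

/-- The circuit described by the string `z`. -/
def decode (L : ℕ) (z : ℕ → Bool) : Circuit :=
  (slots L).flatMap fun s => if s.On z then s.gate else []

theorem Slot.wf_gate (s : Slot) : Circuit.WF s.gate := by
  unfold Slot.gate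
  split_ifs <;> simp_all [Circuit.WF, Gate.WF, Gate.qubits]

theorem wf_decode (L : ℕ) (z : ℕ → Bool) : (decode L z).WF :=
  Circuit.WF.flatMap fun s _ => by
    split_ifs
    exacts [s.wf_gate, Circuit.wf_nil]

/-- The qubit that records whether the learner's output contains the gate of the slot. -/
def flagQ (N r : ℕ) (s : Slot) : ℕ := ancQ N 6 r s.idx s.litLen

/-- Computes all the qubits `flagQ`. -/
def flags (N r L : ℕ) : Circuit :=
  (slots L).flatMap fun s =>
    chain (one N) (ancQ N 6 r s.idx) (fun l => learnQ N r (s.litPos l)) s.litSgn s.litLen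

theorem flagQ_eq (N r : ℕ) (s : Slot) : flagQ N r s = ad N 6 r s.idx s.litLen := by
  have : s.litLen ≠ 0 := by simp [Slot.litLen, Slot.codeLen]
  simp [flagQ, ancQ, this]

theorem chainOK_flags (N r : ℕ) (s : Slot) : ChainOK (one N) (ancQ N 6 r s.idx)
    (fun l => learnQ N r (s.litPos l)) :=
  chainOK_ancQ _ (by simp) (by simp) (by simp)

theorem isClassical_flags (N r L : ℕ) : (flags N r L).IsClassical :=
  Circuit.IsClassical.flatMap fun _ _ => isClassical_chain

theorem wf_flags (N r L : ℕ) : (flags N r L).WF :=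
  Circuit.WF.flatMap fun s _ => wf_chain (chainOK_flags N r s)

theorem targets_flags {N r L q : ℕ} (h : q ∈ (flags N r L).targets) :
    ∃ t i, q = ad N 6 r t i := by
  simp only [flags, Circuit.targets_flatMap, Set.mem_iUnion] at h
  obtain ⟨s, -, h⟩ := h
  obtain ⟨l, -, e⟩ := targets_chain_subset h
  exact ⟨_, _, e⟩

theorem cl_flags {N r L : ℕ} {b : Basis} (h1 : b (one N) = true) (h2 : b (two N) = true)
    (hz : ∀ t i, b (ad N 6 r t i) = false) {s : Slot} (hs : s ∈ slots L) :
    Circuit.cl (flags N r L) b (flagQ N r s) = true ↔ s.On fun q => b (learnQ N r q) := by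
  have hsup : flagQ N r s ∈ (chain (one N) (ancQ N 6 r s.idx) (fun l => learnQ N r (s.litPos l))
      s.litSgn s.litLen).support := by
    simp only [chain, Circuit.support_flatMap, Set.mem_iUnion, List.mem_range]
    refine ⟨s.litLen - 1, by simp [Slot.litLen, Slot.codeLen], ?_⟩
    have : s.litLen - 1 + 1 = s.litLen := by simp only [Slot.litLen, Slot.codeLen]; omega
    rw [this]
    simp [literal, Gate.qubits, flagQ]
  have key := Circuit.cl_flatMap_of_indep (F := fun s => chain (one N) (ancQ N 6 r s.idx)
    (fun l => learnQ N r (s.litPos l)) s.litSgn s.litLen) (nodup_slots L) hs ?_ b hsup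
  · rw [flags, key]
    exact cl_chain (chainOK_flags N r s) h1 h2 fun l => hz _ _
  · intro s' hs' hne
    have hidx : s'.idx ≠ s.idx := fun e => hne (Slot.idx_injective e)
    rw [Set.disjoint_left]
    intro q hq hq'
    obtain ⟨l, -, rfl⟩ := targets_chain_subset hq
    rw [ancQ_succ] at hq'
    rcases support_chain_subset hq' with e | ⟨l', -, e⟩ | ⟨j, -, e⟩
    · simp [one] at e
    · rcases l' with _ | l'
      · simp [two] at e
      · simp [hidx] at e
    · simp [learnQ] at e

/-- The simulated qubit `q` in sample `t` of round `r`. -/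
def simQ (N r t q : ℕ) : ℕ := ad N 10 r t q

/-- The simulation of the gate of a slot, controlled by the flag of the slot. -/
def simStep (N r t : ℕ) (s : Slot) : Circuit :=
  if s.k = 0 then if s.b = 0 then if s.c = 0 then
    ctrlHad (flagQ N r s) (simQ N r t s.a) (ad N 11 r t s.idx) else [] else []
  else if s.a = s.b then [] else if s.a = s.c then [] else if s.b = s.c then [] else
    ctrlToff (flagQ N r s) (ad N 12 r t s.idx) (simQ N r t s.a) (simQ N r t s.b) (simQ N r t s.c)

/-- The simulation of the circuit described by the learner's output. -/
def simulate (N r t L : ℕ) : Circuit := (slots L).flatMap (simStep N r t)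

theorem wf_simulate (N r t L : ℕ) : (simulate N r t L).WF :=
  Circuit.WF.flatMap fun s _ => by
    unfold simStep
    split_ifs
    · exact wf_ctrlHad (by simp [flagQ_eq, simQ]) (by simp [flagQ_eq]) (by simp [simQ])
    all_goals first
      | exact Circuit.wf_nil
      | exact wf_ctrlToff (by simp [flagQ_eq, simQ]) (by simp [flagQ_eq]) (by simp [simQ])
          (by simp [simQ]) (by simp [simQ]) (by simp [simQ, *])

theorem targets_simStep {N r t q : ℕ} {s : Slot} (h : q ∈ (simStep N r t s).targets) :
    (∃ v, q = simQ N r t v) ∨ q = ad N 11 r t s.idx ∨ q = ad N 12 r t s.idx := by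
  unfold simStep at h
  split_ifs at h
  all_goals simp [ctrlHad, ctrlToff, Gate.target] at h
  · rcases h with rfl | rfl <;> simp [simQ]
  · rcases h with rfl | rfl <;> simp [simQ]

theorem targets_simulate {N r t L q : ℕ} (h : q ∈ (simulate N r t L).targets) :
    ∃ k i, 10 ≤ k ∧ k ≤ 12 ∧ q = ad N k r t i := by
  simp only [simulate, Circuit.targets_flatMap, Set.mem_iUnion] at h
  obtain ⟨s, -, h⟩ := h
  rcases targets_simStep h with ⟨v, e⟩ | e | e
  exacts [⟨10, v, by simp [e, simQ]⟩, ⟨11, _, by simp [e]; rfl⟩, ⟨12, _, by simp [e]; rfl⟩]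

open Classical in
/-- The simulation step for a slot, when the learner's output is `z`.  A Hadamard gate that is
switched off leaves a superposition in its scratch qubit, and in both branches the simulated
register is unchanged. -/
noncomputable def Slot.simBlock (N r t : ℕ) (z : ℕ → Bool) (s : Slot) : SimBlock where
  circ := simStep N r t s
  scratch := ad N 11 r t s.idx
  op0 := fun a => if s.On z then Circuit.run s.gate (ket a) else
    if s.gate = [Gate.had s.a] then ((1 / Real.sqrt 2 : ℝ) : ℂ) • ket a else ket a
  op1 := fun a => if s.On z then 0 else
    if s.gate = [Gate.had s.a] then ((1 / Real.sqrt 2 : ℝ) : ℂ) • ket a else 0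

theorem simQ_injective (N r t : ℕ) : Function.Injective (simQ N r t) := by
  intro q q' h; simpa [simQ] using h

theorem correct_slot_simBlock {N r t : ℕ} (z : ℕ → Bool) (s : Slot) :
    (s.simBlock N r t z).Correct (simQ N r t) fun b =>
      (b (flagQ N r s) = true ↔ s.On z) ∧ b (ad N 12 r t s.idx) = false := by
  classical
  rintro b a ⟨hF, hu⟩ hs
  have hι := simQ_injective N r t
  have hout : ∀ k r' t' i', k ≠ 10 → ad N k r' t' i' ∉ Set.range (simQ N r t) := by
    rintro k r' t' i' hk ⟨q, e⟩
    simp [simQ, hk.symm] at e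
  have hF' : emb (simQ N r t) b a (flagQ N r s) = b (flagQ N r s) := by
    rw [flagQ_eq, emb_apply_of_notMem _ _ (hout 6 _ _ _ (by simp))]
  have hs' : emb (simQ N r t) b a (ad N 11 r t s.idx) = false := by
    rw [emb_apply_of_notMem _ _ (hout 11 _ _ _ (by simp))]; exact hs
  have hu' : emb (simQ N r t) b a (ad N 12 r t s.idx) = false := by
    rw [emb_apply_of_notMem _ _ (hout 12 _ _ _ (by simp))]; exact hu
  have hnil : ∀ (_ : s.gate = []), simStep N r t s = [] →
      (s.simBlock N r t z).circ.run (ket (emb (simQ N r t) b a)) =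
      place (simQ N r t) b ((s.simBlock N r t z).op0 a) +
        place (simQ N r t) (Function.update b (s.simBlock N r t z).scratch true)
          ((s.simBlock N r t z).op1 a) := by
    intro h1 h2
    by_cases hon : s.On z <;> simp [Slot.simBlock, h1, h2, hon]
  by_cases hk : s.k = 0
  · by_cases hb : s.b = 0
    · by_cases hc : s.c = 0
      · have hg : s.gate = [Gate.had s.a] := by simp [Slot.gate, hk, hb, hc]
        have hst : simStep N r t s =
            ctrlHad (flagQ N r s) (simQ N r t s.a) (ad N 11 r t s.idx) := by
          simp [simStep, hk, hb, hc]
        simp only [Slot.simBlock, hst, hg, if_true]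
        rw [run_ctrlHad (by simp [flagQ_eq, simQ]) (by simp [flagQ_eq]) (by simp [simQ]) _ hs',
          hF']
        by_cases hon : s.On z
        · simp only [hF.2 hon, hon, if_true, place_zero, add_zero, Circuit.run_cons,
            Circuit.run_nil, linExt_ket]
          exact place_act hι (Gate.had s.a) b a
        · have : b (flagQ N r s) = false := by
            rw [← Bool.not_eq_true]; exact fun h => hon (hF.1 h)
          simp only [this, hon, if_false, place_smul, place_ket, smul_add,
            emb_update_env _ _ (hout 11 r t s.idx (by simp)), Bool.false_eq_true]
      · exact hnil (by simp [Slot.gate, hk, hb, hc]) (by simp [simStep, hk, hb, hc])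
    · exact hnil (by simp [Slot.gate, hk, hb]) (by simp [simStep, hk, hb])
  · by_cases h1 : s.a = s.b
    · exact hnil (by simp [Slot.gate, hk, h1]) (by simp [simStep, hk, h1])
    · by_cases h2 : s.a = s.c
      · exact hnil (by simp [Slot.gate, hk, h2]) (by simp [simStep, hk, h2])
      · by_cases h3 : s.b = s.c
        · exact hnil (by simp [Slot.gate, hk, h3]) (by simp [simStep, hk, h3])
        · have hg : s.gate = [Gate.toff s.a s.b s.c] := by simp [Slot.gate, hk, h1, h2, h3]
          have hst : simStep N r t s = ctrlToff (flagQ N r s) (ad N 12 r t s.idx)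
              (simQ N r t s.a) (simQ N r t s.b) (simQ N r t s.c) := by
            simp [simStep, hk, h1, h2, h3]
          simp only [Slot.simBlock, hst, hg]
          rw [run_ctrlToff (by simp [flagQ_eq, simQ]) (by simp [flagQ_eq]) (by simp [simQ])
            (by simp [simQ]) (by simp [simQ]) (by simp [simQ, h2]) _ hu', hF']
          by_cases hon : s.On z
          · simp only [hF.2 hon, hon, if_true, place_zero, add_zero, Circuit.run_cons,
              Circuit.run_nil, linExt_ket]
            exact place_act hι (Gate.toff s.a s.b s.c) b a
          · have : b (flagQ N r s) = false := by
              rw [← Bool.not_eq_true]; exact fun h => hon (hF.1 h)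
            simp [this, hon]

theorem branchExp_slots (N r t : ℕ) (z : ℕ → Bool) (g : Basis → ℝ) (l : List Slot) (ψ : QState) :
    branchExp g (l.map (Slot.simBlock N r t z)) ψ =
      expect (Circuit.run (l.flatMap fun s => if s.On z then s.gate else []) ψ)
        g := by
  classical
  induction l generalizing ψ with
  | nil => simp [branchExp]
  | cons s l ih =>
    rw [List.map_cons, branchExp, List.flatMap_cons, Circuit.run_append, ih, ih]
    have hket : linExt (fun a => ket a) ψ = ψ := by
      simp [linExt, ket]
    have hzero : linExt (fun _ => 0) ψ = 0 := by simp [linExt]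
    have hsm : linExt (fun a => ((1 / Real.sqrt 2 : ℝ) : ℂ) • ket a) ψ =
        ((1 / Real.sqrt 2 : ℝ) : ℂ) • ψ := by
      conv_rhs => rw [← hket]
      simp only [linExt, Finsupp.smul_sum]
      exact Finsupp.sum_congr fun _ _ => smul_comm _ _ _
    by_cases hon : s.On z
    · have hrun : ∀ U : Circuit, linExt (fun a => U.run (ket a)) ψ = U.run ψ := by
        intro U; rw [Circuit.run_eq_sum U ψ]; rfl
      simp only [Slot.simBlock, hon, if_true, hzero, hrun, Circuit.run_zero, expect_zero, add_zero]
    · by_cases hg : s.gate = [Gate.had s.a]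
      · simp only [Slot.simBlock, hon, hg, if_true, if_false, hsm, Circuit.run_smul, expect_smul,
          Circuit.run_nil]
        have h2 : ‖((1 / Real.sqrt 2 : ℝ) : ℂ)‖ ^ 2 = 1 / 2 := by
          rw [Complex.norm_real]; simp
        rw [h2]; ring
      · simp only [Slot.simBlock, hon, hg, if_false, hket, hzero, Circuit.run_zero, expect_zero,
          Circuit.run_nil, add_zero]

/-- Running the simulation on a register that holds `a`. -/
theorem ex_simulate {N r t L : ℕ} {z : ℕ → Bool} {b : Basis}
    (hF : ∀ s ∈ slots L, b (flagQ N r s) = true ↔ s.On z)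
    (h11 : ∀ i, b (ad N 11 r t i) = false) (h12 : ∀ i, b (ad N 12 r t i) = false)
    (g : Bool → ℝ) :
    (simulate N r t L).ex b (fun b' => g (b' (simQ N r t 0))) =
      expect ((decode L z).run (ket fun q => b (simQ N r t q))) fun a => g (a 0) := by
  have hι := simQ_injective N r t
  have e0 : ket b = place (simQ N r t) b (ket fun q => b (simQ N r t q)) := by
    rw [place_ket]
    congr 1
    funext q
    by_cases hq : q ∈ Set.range (simQ N r t)
    · obtain ⟨p, rfl⟩ := hq
      rw [emb_apply hι]
    · rw [emb_apply_of_notMem _ _ hq]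
  have e1 : simulate N r t L = ((slots L).map (Slot.simBlock N r t z)).flatMap SimBlock.circ := by
    rw [List.flatMap_map]; rfl
  rw [Circuit.ex, e1, e0, expect_run_simulation hι (P := fun b =>
      (∀ s ∈ slots L, b (flagQ N r s) = true ↔ s.On z) ∧ ∀ i, b (ad N 12 r t i) = false)]
  · simp only [emb_apply hι, branchExp_slots]
    rfl
  · intro B hB b ⟨h1, h2⟩
    obtain ⟨s, hs, rfl⟩ := List.mem_map.1 hB
    refine ⟨fun s' hs' => ?_, fun i => ?_⟩
    · rw [Function.update_of_ne (by simp [Slot.simBlock, flagQ_eq])]; exact h1 s' hs'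
    · rw [Function.update_of_ne (by simp [Slot.simBlock])]; exact h2 i
  · intro B hB
    obtain ⟨s, hs, rfl⟩ := List.mem_map.1 hB
    exact fun b a hb hz => correct_slot_simBlock z s b a ⟨hb.1 s hs, hb.2 _⟩ hz
  · intro B hB
    obtain ⟨s, hs, rfl⟩ := List.mem_map.1 hB
    rintro ⟨q, e⟩
    simp [simQ, Slot.simBlock] at e
  · rw [List.pairwise_map]
    refine (nodup_slots L).imp fun {s s'} hne => ?_
    have hidx : s.idx ≠ s'.idx := fun e => hne (Slot.idx_injective e)
    refine ⟨by simp [Slot.simBlock, hidx], fun h => ?_⟩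
    rcases targets_simStep h with ⟨v, e⟩ | e | e
    · simp [Slot.simBlock, simQ] at e
    · simp [Slot.simBlock, hidx] at e
    · simp [Slot.simBlock] at e
  · intro B hB b
    obtain ⟨s, hs, rfl⟩ := List.mem_map.1 hB
    rw [Function.update_of_ne (by simp [Slot.simBlock, simQ])]
  · exact ⟨hF, h12⟩
  · intro B hB
    obtain ⟨s, hs, rfl⟩ := List.mem_map.1 hB
    exact h11 _

/-! ### Testing the hypothesis on a random input -/

/-- Random bit number `j` of sample `t` in round `r`. -/
def randQ (N r t j : ℕ) : ℕ := ad N 7 r t j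

/-- The value of the tested function on the random input. -/
def valQ (N r t : ℕ) : ℕ := ad N 9 r t 0

/-- Whether the hypothesis disagrees with the tested function on the random input. -/
def diffQ (N r t : ℕ) : ℕ := ad N 9 r t 1

/-- The unary counter of the disagreements in the first `t` samples. -/
def countQ (N r t j : ℕ) : ℕ := ad N 13 r t j

/-- Copies the random input to the simulated register. -/
def copyInput (N n r t : ℕ) : Circuit :=
  (List.range n).flatMap fun j => [Gate.toff (one N) (randQ N r t j) (simQ N r t j)]

/-- Adds the value of the disagreement bit, and advances the counter to the row `t + 1`. -/
def countDiff (N r t k : ℕ) : Circuit :=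
  Gate.toff (one N) (simQ N r t 0) (diffQ N r t) ::
    Gate.toff (one N) (valQ N r t) (diffQ N r t) ::
      counterRow (one N) (diffQ N r t) (countQ N r t) (countQ N r (t + 1)) k

/-- Looks up the value of the tested function on the random input and copies the input to the
simulated register. -/
def loadInput (N n r t : ℕ) : Circuit :=
  lookup (one N) (ancQ N 8 r t) (randQ N r t) n (valQ N r t) ++ copyInput N n r t

/-- Runs the hypothesis on a random input and counts a disagreement with the tested function. -/
def sample (N n L k r t : ℕ) : Circuit :=
  hadamards (randQ N r t) n ++ (loadInput N n r t ++ (simulate N r t L ++ countDiff N r t k))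

section sample

variable {N n L k r t : ℕ}

theorem isClassical_copyInput : (copyInput N n r t).IsClassical :=
  Circuit.IsClassical.flatMap fun j _ => by simp [Circuit.IsClassical, Gate.IsClassical]

theorem isClassical_loadInput : (loadInput N n r t).IsClassical :=
  isClassical_lookup.append isClassical_copyInput

theorem isClassical_countDiff : (countDiff N r t k).IsClassical := by
  simp only [countDiff, Circuit.isClassical_cons]
  exact ⟨trivial, trivial, isClassical_counterRow⟩

theorem wf_countDiff : (countDiff N r t k).WF := by
  simp only [countDiff, Circuit.wf_cons]
  refine ⟨by simp [Gate.WF, Gate.qubits, one, simQ, diffQ],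
    by simp [Gate.WF, Gate.qubits, one, valQ, diffQ], wf_counterRow ?_ ?_ ?_ ?_ ?_⟩ <;>
    simp [one, countQ, diffQ]

theorem chainOK_randQ : ChainOK (one N) (ancQ N 8 r t) (randQ N r t) :=
  chainOK_ancQ (fun j => j) (by simp) (by simp) (by simp)

theorem wf_loadInput : (loadInput (2 ^ n) n r t).WF :=
  (wf_lookup chainOK_randQ (ad_ne_ancQ (by simp) (by simp)) (le_ad _ _ _ _ _)
    (le_ancQ _ _ _ _)).append (Circuit.WF.flatMap fun j _ => by
      simp [Circuit.WF, Gate.WF, Gate.qubits, one, randQ, simQ])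

theorem wf_sample : (sample (2 ^ n) n L k r t).WF :=
  (wf_hadamards _ _).append (wf_loadInput.append ((wf_simulate _ _ _ _).append wf_countDiff))

theorem targets_copyInput {q : ℕ} (h : q ∈ (copyInput N n r t).targets) :
    ∃ j, q = simQ N r t j := by
  simp only [copyInput, Circuit.targets_flatMap, Set.mem_iUnion] at h
  obtain ⟨j, -, h⟩ := h
  exact ⟨j, by simpa [Gate.target] using h⟩

theorem targets_loadInput {q : ℕ} (h : q ∈ (loadInput N n r t).targets) :
    ∃ k' i, 8 ≤ k' ∧ k' ≤ 12 ∧ q = ad N k' r t i := by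
  rw [loadInput, Circuit.targets_append] at h
  rcases h with h | h
  · rcases targets_lookup_subset h with e | ⟨l, e⟩
    exacts [⟨9, 0, by norm_num, by norm_num, e⟩, ⟨8, l + 1, by norm_num, by norm_num, e⟩]
  · obtain ⟨j, e⟩ := targets_copyInput h
    exact ⟨10, j, by norm_num, by norm_num, e⟩

theorem targets_countDiff {q : ℕ} (h : q ∈ (countDiff N r t k).targets) :
    q = diffQ N r t ∨ ∃ j, q = countQ N r (t + 1) j := by
  simp only [countDiff, Circuit.targets_cons, Gate.target, Set.mem_insert_iff] at h
  rcases h with h | h | h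
  exacts [Or.inl h, Or.inl h, Or.inr (targets_counterRow_subset h)]

/-- The qubits that are written to in sample `t` of round `r`. -/
def IsSampleQ (N r t q : ℕ) : Prop :=
  (∃ k i, 7 ≤ k ∧ k ≤ 12 ∧ q = ad N k r t i) ∨ ∃ j, q = ad N 13 r (t + 1) j

theorem targets_rest_sample {q : ℕ}
    (h : q ∈ (loadInput N n r t ++ (simulate N r t L ++ countDiff N r t k)).targets) :
    (∃ k i, 8 ≤ k ∧ k ≤ 12 ∧ q = ad N k r t i) ∨ ∃ j, q = ad N 13 r (t + 1) j := by
  simp only [Circuit.targets_append, Set.mem_union] at h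
  rcases h with h | h | h
  · exact Or.inl (targets_loadInput h)
  · obtain ⟨k, i, h1, h2, e⟩ := targets_simulate h
    exact Or.inl ⟨k, i, by omega, h2, e⟩
  · rcases targets_countDiff h with e | h
    · exact Or.inl ⟨9, 1, by norm_num, by norm_num, e⟩
    · exact Or.inr h

theorem targets_sample {q : ℕ} (h : q ∈ (sample N n L k r t).targets) : IsSampleQ N r t q := by
  rw [sample, Circuit.targets_append] at h
  rcases h with h | h
  · rw [targets_hadamards] at h
    obtain ⟨j, -, e⟩ := h
    exact Or.inl ⟨7, j, le_rfl, by norm_num, e⟩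
  · rcases targets_rest_sample h with ⟨k, i, h1, h2, e⟩ | h
    · exact Or.inl ⟨k, i, by omega, h2, e⟩
    · exact Or.inr h

theorem cl_copyInput {b : Basis} (h1 : b (one N) = true) (hz : ∀ j, b (simQ N r t j) = false)
    (j : ℕ) : Circuit.cl (copyInput N n r t) b (simQ N r t j) =
      (decide (j < n) && b (randQ N r t j)) := by
  induction n with
  | zero => simp [copyInput, hz]
  | succ n ih =>
    have hnt : ∀ q, (∀ j, q ≠ simQ N r t j) → Circuit.cl (copyInput N n r t) b q = b q :=
      fun q hq => Circuit.cl_apply_of_notMem _ _ _ fun hq' => by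
        obtain ⟨j, e⟩ := targets_copyInput hq'; exact hq j e
    have e : copyInput N (n + 1) r t =
        copyInput N n r t ++ [Gate.toff (one N) (randQ N r t n) (simQ N r t n)] := by
      simp [copyInput, List.range_succ]
    rw [e, Circuit.cl_append, Circuit.cl_cons, Circuit.cl_nil, Gate.apply,
      hnt (one N) (by simp [one, simQ]), hnt (randQ N r t n) (by simp [randQ, simQ]), h1]
    by_cases hj : j = n
    · subst hj
      simp [ih]
    · rw [Function.update_of_ne (by simpa [simQ] using hj), ih]
      have : j < n + 1 ↔ j < n := by omega
      simp [this]

/-- The situation at the beginning of sample `t` of round `r`, when `z` is the output of the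
learner. -/
structure SampleEnv (f : BoolFun n) (L r t : ℕ) (z : ℕ → Bool) (b : Basis) : Prop
    extends LearnEnv f b where
  flag : ∀ s ∈ slots L, b (flagQ (2 ^ n) r s) = true ↔ s.On z
  fresh : ∀ q t', t ≤ t' → IsSampleQ (2 ^ n) r t' q → b q = false

theorem SampleEnv.next {f : BoolFun n} {z : ℕ → Bool} {b b' : Basis}
    (h : SampleEnv f L r t z b) (hb : ∀ q, ¬ IsSampleQ (2 ^ n) r t q → b' q = b q) :
    SampleEnv f L r (t + 1) z b' where
  one := by rw [hb _ (by simp [IsSampleQ, QLearn.one]), h.one]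
  two := by rw [hb _ (by simp [IsSampleQ, QLearn.two]), h.two]
  tt i := by
    rw [hb, h.tt]
    have := i.2
    rintro (⟨k, j, -, -, e⟩ | ⟨j, e⟩)
    · have := le_ad (2 ^ n) k r t j; omega
    · have := le_ad (2 ^ n) 13 r (t + 1) j; omega
  flag s hs := by
    rw [hb _ ?_, h.flag s hs]
    rw [flagQ_eq]
    rintro (⟨k, j, hk, -, e⟩ | ⟨j, e⟩)
    · simp at e; omega
    · simp at e
  fresh q t' ht' hq := by
    rw [hb, h.fresh q t' (by omega) hq]
    rcases hq with ⟨k, i, h1, h2, rfl⟩ | ⟨j, rfl⟩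
    · rintro (⟨k', j, h3, h4, e⟩ | ⟨j, e⟩) <;> simp at e <;> omega
    · rintro (⟨k', j, h3, h4, e⟩ | ⟨j, e⟩) <;> simp at e <;> omega

theorem expect_xor (φ : QState) (v : Bool) (c : Bool → ℝ) :
    expect φ (fun a => c (xor (a 0) v)) =
      c false * weight φ {a | a 0 = v} + c true * weight φ {a | a 0 = !v} := by
  rw [weight_eq_expect, weight_eq_expect, ← expect_const_mul, ← expect_const_mul, ← expect_add]
  congr 1
  funext a
  cases ha : a 0 <;> cases v <;> simp [ha]

theorem prob_not {V : Circuit} (hV : V.WF) (x : Fin n → Bool) (v : Bool) :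
    V.prob x (!v) = 1 - V.prob x v := by
  have h := expect_xor (V.run (ket (inputBasis x))) v fun _ => 1
  have h1 : expect (V.run (ket (inputBasis x))) (fun _ => 1) = 1 :=
    Circuit.ex_const hV (inputBasis x) 1
  rw [h1] at h
  simp only [Circuit.prob]
  linarith

/-- One sample adds `1` to the counter with the probability that the hypothesis disagrees with the
tested function. -/
theorem ex_sample {f : BoolFun n} {z : ℕ → Bool} {b : Basis} (hb : SampleEnv f L r t z b) {c : ℕ}
    (hc : ∀ j < k, b (countQ (2 ^ n) r t j) = decide (j ≤ c)) (g : Basis → ℝ) (G : ℕ → ℝ)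
    (hg : ∀ b' : Basis, ∀ d : Bool, (∀ q, ¬ IsSampleQ (2 ^ n) r t q → b' q = b q) →
      (∀ j < k, b' (countQ (2 ^ n) r (t + 1) j) = decide (j ≤ c + d.toNat)) →
      g b' = G (c + d.toNat)) :
    (sample (2 ^ n) n L k r t).ex b g =
      (1 - (decode L z).agreement f) * G (c + 1) + (decode L z).agreement f * G c := by
  set V := decode L z
  have hV : V.WF := wf_decode L z
  have hz : ∀ k' i, 7 ≤ k' → k' ≤ 12 → b (ad (2 ^ n) k' r t i) = false :=
    fun k' i h1 h2 => hb.fresh _ t le_rfl (Or.inl ⟨k', i, h1, h2, rfl⟩)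
  rw [sample, Circuit.ex_append]
  swap
  · rw [targets_hadamards, Set.disjoint_left]
    rintro _ ⟨j, -, rfl⟩ h
    rcases targets_rest_sample h with ⟨k', i, h1, h2, e⟩ | ⟨j, e⟩
    · simp [randQ] at e; omega
    · simp [randQ] at e
  have hX : Function.Injective (randQ (2 ^ n) r t) := by
    intro i j h; simpa [randQ] using h
  rw [ex_hadamards hX n b _ fun x => (1 - V.prob x (f x)) * G (c + 1) + V.prob x (f x) * G c]
  · rw [Finset.sum_add_distrib, ← Finset.sum_mul, ← Finset.sum_mul, Finset.sum_sub_distrib,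
      Circuit.agreement]
    simp only [Finset.sum_const, Finset.card_univ, Fintype.card_pi, Fintype.card_bool,
      Finset.prod_const, Fintype.card_fin, nsmul_eq_mul, mul_one, Nat.cast_pow, Nat.cast_ofNat]
    have : (2 : ℝ) ^ n ≠ 0 := by positivity
    field_simp
  · intro x b₁ hx hb₁
    have hb₁' : ∀ q, (∀ j, q ≠ randQ (2 ^ n) r t j) → b₁ q = b q :=
      fun q hq => hb₁ q fun j _ => hq j
    rw [Circuit.ex_isClassical_append isClassical_loadInput,
      Circuit.ex_append_of_isClassical isClassical_countDiff wf_countDiff]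
    -- the state after loading the input
    have one₁ : b₁ (one (2 ^ n)) = true := by
      rw [hb₁' _ (by simp [one, randQ]), hb.one]
    have two₁ : b₁ (two (2 ^ n)) = true := by
      rw [hb₁' _ (by simp [two, randQ]), hb.two]
    have zero₁ : ∀ k' i, 8 ≤ k' → k' ≤ 12 → b₁ (ad (2 ^ n) k' r t i) = false := by
      intro k' i h1 h2
      rw [hb₁' _ (by simp [randQ]; omega), hz k' i (by omega) h2]
    have hlk := cl_lookup (one := one (2 ^ n)) (anc := ancQ (2 ^ n) 8 r t)
      (pos := randQ (2 ^ n) r t) (n := n) (t := valQ (2 ^ n) r t) chainOK_randQ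
      (ad_ne_ancQ (by simp) (by simp)) (le_ad _ _ _ _ _) (le_ancQ _ _ _ _)
      (by simp [valQ, one]) (by simp [valQ, randQ]) (b := b₁) one₁ two₁
      (fun l => zero₁ _ _ le_rfl (by norm_num)) f (fun i => by
        rw [hb₁' _ (fun j e => by
          have := le_ad (2 ^ n) 7 r t j; have := i.2; simp only [randQ] at e; omega), hb.tt])
    have hfx : (f fun j : Fin n => b₁ (randQ (2 ^ n) r t j)) = f x := by
      congr 1; funext j; exact hx j
    rw [hfx] at hlk
    set b₂ := Circuit.cl (loadInput (2 ^ n) n r t) b₁ with hb₂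
    have e₂ : ∀ q, (∀ k' i, 8 ≤ k' → k' ≤ 12 → q ≠ ad (2 ^ n) k' r t i) → b₂ q = b₁ q :=
      fun q hq => Circuit.cl_apply_of_notMem _ _ _ fun h => by
        obtain ⟨k', i, h1, h2, e⟩ := targets_loadInput h
        exact hq k' i h1 h2 e
    have hb₂' : b₂ = Circuit.cl (copyInput (2 ^ n) n r t)
        (Function.update b₁ (valQ (2 ^ n) r t) (xor (b₁ (valQ (2 ^ n) r t)) (f x))) := by
      rw [hb₂, loadInput, Circuit.cl_append, hlk]
    have sim₂ : (fun q => b₂ (simQ (2 ^ n) r t q)) = inputBasis x := by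
      funext q
      rw [hb₂', cl_copyInput]
      · rw [Function.update_of_ne (by simp [valQ, randQ]), inputBasis]
        by_cases hq : q < n
        · simp only [hq, decide_true, Bool.true_and, dite_true]
          exact hx ⟨q, hq⟩
        · simp [hq]
      · rw [Function.update_of_ne (by simp [valQ, one]), one₁]
      · intro j
        rw [Function.update_of_ne (by simp [valQ, simQ])]
        exact zero₁ 10 j (by norm_num) (by norm_num)
    have nt₂ : ∀ k' i, k' ≠ 9 → k' ≠ 10 → b₂ (ad (2 ^ n) k' r t i) = b₁ (ad (2 ^ n) k' r t i) := by
      intro k' i h9 h10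
      rw [hb₂', Circuit.cl_apply_of_notMem, Function.update_of_ne (by simp [valQ, h9])]
      intro h
      obtain ⟨j, e⟩ := targets_copyInput h
      simp [simQ, h10] at e
    have val₂ : b₂ (valQ (2 ^ n) r t) = f x := by
      rw [hb₂', Circuit.cl_apply_of_notMem, Function.update_self, valQ,
        zero₁ 9 0 (by norm_num) (by norm_num), Bool.false_xor]
      intro h
      obtain ⟨j, e⟩ := targets_copyInput h
      simp [simQ, valQ] at e
    have diff₂ : b₂ (diffQ (2 ^ n) r t) = false := by
      rw [hb₂', Circuit.cl_apply_of_notMem, Function.update_of_ne (by simp [valQ, diffQ])]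
      · exact zero₁ 9 1 (by norm_num) (by norm_num)
      · intro h
        obtain ⟨j, e⟩ := targets_copyInput h
        simp [simQ, diffQ] at e
    -- the effect of counting
    rw [Circuit.ex_congr (g' := fun b₃ => G (c + (xor (b₃ (simQ (2 ^ n) r t 0)) (f x)).toNat))]
    · rw [ex_simulate (z := z) (g := fun v => G (c + (xor v (f x)).toNat)), sim₂,
        expect_xor _ (f x) fun d => G (c + d.toNat)]
      · have := prob_not hV x (f x)
        simp only [Circuit.prob] at this ⊢
        rw [this]
        simp only [Bool.toNat_true, Bool.toNat_false, add_zero]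
        ring
      · intro s hs
        have hout' : ∀ q, (∀ k' i, 7 ≤ k' → q ≠ ad (2 ^ n) k' r t i) → b₂ q = b q := by
          intro q hq
          rw [e₂ q fun k' i h _ => hq k' i (by omega), hb₁' q fun j => hq 7 j le_rfl]
        rw [hout', hb.flag s hs]
        intro k' i hk'
        rw [flagQ_eq]
        simp; omega
      · intro i
        rw [nt₂ 11 i (by norm_num) (by norm_num)]
        exact zero₁ 11 i (by norm_num) (by norm_num)
      · intro i
        rw [nt₂ 12 i (by norm_num) (by norm_num)]
        exact zero₁ 12 i (by norm_num) (by norm_num)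
    · intro b₃ h₃
      have e₃ : ∀ q, (∀ k' i, 10 ≤ k' → k' ≤ 12 → q ≠ ad (2 ^ n) k' r t i) → b₃ q = b₂ q :=
        fun q hq => h₃ q fun h => by
          obtain ⟨k', i, h1, h2, e⟩ := targets_simulate h
          exact hq k' i h1 h2 e
      have back : ∀ q, ¬ (∃ k' i, 7 ≤ k' ∧ k' ≤ 12 ∧ q = ad (2 ^ n) k' r t i) → b₃ q = b q := by
        intro q hq
        push Not at hq
        rw [e₃ q fun k' i h1 h2 => hq k' i (by omega) h2,
          e₂ q fun k' i h1 h2 => hq k' i (by omega) h2,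
          hb₁' q fun j => hq 7 j le_rfl (by norm_num)]
      have one₃ : b₃ (one (2 ^ n)) = true := by
        rw [back _ (by simp [one]), hb.one]
      have diff₃ : b₃ (diffQ (2 ^ n) r t) = false := by
        rw [e₃ _ (by simp [diffQ]; omega), diff₂]
      have val₃ : b₃ (valQ (2 ^ n) r t) = f x := by
        rw [e₃ _ (by simp [valQ]; omega), val₂]
      apply hg
      · intro q hq
        rw [Circuit.cl_apply_of_notMem, back q fun h => hq (Or.inl h)]
        intro h
        rcases targets_countDiff h with e | h
        · exact hq (Or.inl ⟨9, 1, by norm_num, by norm_num, e⟩)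
        · exact hq (Or.inr h)
      · intro j hj
        have hd : Circuit.cl (countDiff (2 ^ n) r t k) b₃ = Circuit.cl (counterRow (one (2 ^ n))
            (diffQ (2 ^ n) r t) (countQ (2 ^ n) r t) (countQ (2 ^ n) r (t + 1)) k)
            (Function.update b₃ (diffQ (2 ^ n) r t)
              (xor (b₃ (simQ (2 ^ n) r t 0)) (f x))) := by
          have h1 : one (2 ^ n) ≠ diffQ (2 ^ n) r t := by simp [one, diffQ]
          have h2 : valQ (2 ^ n) r t ≠ diffQ (2 ^ n) r t := by simp [valQ, diffQ]
          rw [countDiff, Circuit.cl_cons, Circuit.cl_cons]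
          simp only [Gate.apply, Function.update_self, Function.update_of_ne h1,
            Function.update_of_ne h2, Function.update_idem, one₃, diff₃, val₃, Bool.true_and,
            Bool.false_xor]
        rw [hd, cl_counterRow (c := c) ?_ ?_ ?_ ?_ ?_ ?_ ?_ j hj, Function.update_self]
        · intro i j h; simpa [countQ] using h
        · simp [one, countQ]
        · simp [diffQ, countQ]
        · simp [countQ]
        · rw [Function.update_of_ne (by simp [one, diffQ]), one₃]
        · intro j
          rw [Function.update_of_ne (by simp [countQ, diffQ]), back _ (by simp [countQ]),
            countQ, hb.fresh _ t le_rfl (Or.inr ⟨j, rfl⟩)]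
        · intro j hj
          rw [Function.update_of_ne (by simp [countQ, diffQ]), back _ (by simp [countQ]),
            hc j hj]

end sample

/-! ### Counting disagreements -/

/-- The expected value of `G` on `c` plus the number of successes in `m` independent trials with
success probability `μ`. -/
noncomputable def binExp (μ : ℝ) (G : ℕ → ℝ) : ℕ → ℕ → ℝ
  | 0, c => G c
  | m + 1, c => μ * binExp μ G m (c + 1) + (1 - μ) * binExp μ G m c

theorem binExp_const (μ x : ℝ) (m c : ℕ) : binExp μ (fun _ => x) m c = x := by
  induction m generalizing c with
  | zero => rfl
  | succ m ih => simp only [binExp, ih]; ring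

theorem binExp_const_mul (μ x : ℝ) (G : ℕ → ℝ) (m c : ℕ) :
    binExp μ (fun c => x * G c) m c = x * binExp μ G m c := by
  induction m generalizing c with
  | zero => rfl
  | succ m ih => simp only [binExp, ih]; ring

theorem binExp_mono {μ : ℝ} (h0 : 0 ≤ μ) (h1 : μ ≤ 1) {G G' : ℕ → ℝ} (h : ∀ c, G c ≤ G' c)
    (m c : ℕ) : binExp μ G m c ≤ binExp μ G' m c := by
  induction m generalizing c with
  | zero => exact h c
  | succ m ih =>
    simp only [binExp]
    have := mul_le_mul_of_nonneg_left (ih (c + 1)) h0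
    have := mul_le_mul_of_nonneg_left (ih c) (sub_nonneg.2 h1)
    linarith

/-- The second moment of the deviation from `a`. -/
theorem binExp_sq (μ a : ℝ) (m c : ℕ) :
    binExp μ (fun c => ((c : ℝ) - a) ^ 2) m c = (c + m * μ - a) ^ 2 + m * (μ * (1 - μ)) := by
  induction m generalizing c with
  | zero => simp [binExp]
  | succ m ih => simp only [binExp, ih]; push_cast; ring

theorem Circuit.prob_nonneg (U : Circuit) {n : ℕ} (x : Fin n → Bool) (v : Bool) :
    0 ≤ U.prob x v := by
  unfold prob weight
  exact Finset.sum_nonneg fun b _ => by positivity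

theorem Circuit.prob_le_one {U : Circuit} (hU : U.WF) {n : ℕ} (x : Fin n → Bool) (v : Bool) :
    U.prob x v ≤ 1 := by
  have h1 := prob_not hU x (!v)
  have h2 := U.prob_nonneg x (!v)
  rw [Bool.not_not] at h1
  linarith

theorem Circuit.agreement_nonneg (U : Circuit) {n : ℕ} (f : BoolFun n) : 0 ≤ U.agreement f :=
  div_nonneg (Finset.sum_nonneg fun x _ => U.prob_nonneg x _) (by positivity)

theorem Circuit.agreement_le_one {U : Circuit} (hU : U.WF) {n : ℕ} (f : BoolFun n) :
    U.agreement f ≤ 1 := by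
  rw [agreement, div_le_one (by positivity)]
  refine (Finset.sum_le_sum fun x _ => prob_le_one hU x (f x)).trans ?_
  simp

/-- The samples with the numbers `t, …, t + m - 1` of round `r`. -/
def samples (N n L k r t m : ℕ) : Circuit := (List.range' t m).flatMap (sample N n L k r)

section samples

variable {N n L k r t m : ℕ}

theorem samples_succ : samples N n L k r t (m + 1) =
    sample N n L k r t ++ samples N n L k r (t + 1) m := by
  simp [samples, List.range'_succ]

theorem wf_samples : (samples (2 ^ n) n L k r t m).WF :=
  Circuit.WF.flatMap fun _ _ => wf_sample

theorem targets_samples {q : ℕ} (h : q ∈ (samples N n L k r t m).targets) :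
    ∃ t' ≥ t, IsSampleQ N r t' q := by
  simp only [samples, Circuit.targets_flatMap, Set.mem_iUnion, List.mem_range'_1] at h
  obtain ⟨t', ht', h⟩ := h
  exact ⟨t', ht'.1, targets_sample h⟩

theorem IsSampleQ.ne {q t' : ℕ} (h : IsSampleQ N r t q) (h' : IsSampleQ N r t' q) : t = t' := by
  rcases h with ⟨k, i, h1, h2, rfl⟩ | ⟨j, rfl⟩
  · rcases h' with ⟨k', i', h3, h4, e⟩ | ⟨j', e⟩ <;> simp at e <;> omega
  · rcases h' with ⟨k', i', h3, h4, e⟩ | ⟨j', e⟩ <;> simp at e <;> omega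

theorem ex_samples {f : BoolFun n} {z : ℕ → Bool} (g : Basis → ℝ) (G : ℕ → ℝ) {b : Basis}
    (hb : SampleEnv f L r t z b) {c : ℕ}
    (hc : ∀ j < k, b (countQ (2 ^ n) r t j) = decide (j ≤ c))
    (hg : ∀ (b' : Basis) (c' : ℕ), (∀ q, (∀ t', ¬ IsSampleQ (2 ^ n) r t' q) → b' q = b q) →
      (∀ j < k, b' (countQ (2 ^ n) r (t + m) j) = decide (j ≤ c')) → g b' = G c') :
    (samples (2 ^ n) n L k r t m).ex b g =
      binExp (1 - (decode L z).agreement f) G m c := by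
  induction m generalizing b t c with
  | zero =>
    simpa [samples, binExp] using hg b c (fun _ _ => rfl) (by simpa using hc)
  | succ m ih =>
    rw [samples_succ, Circuit.ex_append]
    · rw [ex_sample hb hc _ (binExp (1 - (decode L z).agreement f) G m)]
      · simp only [binExp]; ring
      · intro b₁ d h1 h2
        refine ih (hb.next h1) h2 fun b' c' h3 h4 => ?_
        refine hg b' c' (fun q hq => ?_) (by rwa [show t + (m + 1) = t + 1 + m by ring])
        rw [h3 q hq, h1 q (hq t)]
    · rw [Set.disjoint_left]
      intro q hq hq'
      obtain ⟨t', ht', h⟩ := targets_samples hq'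
      have := (targets_sample hq).ne h
      omega

end samples

/-! ### Rounds -/

/-- One round: run the learner, find the gates of its hypothesis, test the hypothesis on `M` random
inputs, and keep accepting if there are at least `θ` disagreements. -/
def round (N n : ℕ) (T : List ℕ) (L θ M r : ℕ) : Circuit :=
  learn N n T r ++ (flags N r L ++ ([Gate.toff (one N) (two N) (countQ N r 0 0)] ++
    (samples N n L (θ + 1) r 0 M ++
      [Gate.toff (accQ N r) (countQ N r M θ) (accQ N (r + 1))])))

/-- The qubits that are written to in round `r`. -/
def IsRoundQ (N r q : ℕ) : Prop := (∃ k t i, 3 ≤ k ∧ q = ad N k r t i) ∨ q = accQ N (r + 1)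

/-- The probability that the tester keeps accepting when the learner's output is `z`. -/
noncomputable def passProb {n : ℕ} (f : BoolFun n) (L θ M : ℕ) (z : Basis) : ℝ :=
  binExp (1 - (decode L z).agreement f) (fun c => if θ ≤ c then 1 else 0) M 0

theorem passProb_nonneg {n : ℕ} (f : BoolFun n) (L θ M : ℕ) (z : Basis) :
    0 ≤ passProb f L θ M z := by
  have h0 := (decode L z).agreement_nonneg f
  have h1 := Circuit.agreement_le_one (wf_decode L z) f
  rw [← binExp_const (1 - (decode L z).agreement f) 0 M 0]
  exact binExp_mono (by linarith) (by linarith) (fun c => by split_ifs <;> norm_num) _ _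

/-- The situation at the beginning of round `r`. -/
structure RoundEnv {n : ℕ} (f : BoolFun n) (r : ℕ) (b : Basis) : Prop extends LearnEnv f b where
  fresh : ∀ q r', r ≤ r' → IsRoundQ (2 ^ n) r' q → b q = false

section round

variable {n L θ M r : ℕ} {Q : OracleCircuit}

theorem wf_round (hQ : Q.WF n) : (round (2 ^ n) n Q.tokens L θ M r).WF := by
  refine (wf_learn hQ).append ((wf_flags _ _ _).append (Circuit.WF.append ?_
    (wf_samples.append ?_))) <;>
    simp [Circuit.WF, Gate.WF, Gate.qubits, one, two, countQ, accQ]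

theorem IsSampleQ.isRoundQ {N t q : ℕ} (h : IsSampleQ N r t q) : IsRoundQ N r q := by
  rcases h with ⟨k, i, h1, h2, rfl⟩ | ⟨j, rfl⟩
  exacts [Or.inl ⟨k, t, i, by omega, rfl⟩, Or.inl ⟨13, t + 1, j, by omega, rfl⟩]

theorem targets_learn' (hQ : Q.WF n) {q : ℕ} (h : q ∈ (learn (2 ^ n) n Q.tokens r).targets) :
    ∃ k i, 3 ≤ k ∧ k ≤ 5 ∧ q = ad (2 ^ n) k r 0 i := by
  rcases targets_learn hQ h with ⟨p, -, e⟩ | ⟨l, e⟩ | ⟨i, e⟩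
  exacts [⟨3, p, le_rfl, by norm_num, e⟩, ⟨5, l + 1, by norm_num, le_rfl, e⟩,
    ⟨4, i, by norm_num, by norm_num, e⟩]

theorem targets_rest_round {N q : ℕ} (h : q ∈ (flags N r L ++
    ([Gate.toff (one N) (two N) (countQ N r 0 0)] ++ (samples N n L (θ + 1) r 0 M ++
      [Gate.toff (accQ N r) (countQ N r M θ) (accQ N (r + 1))]))).targets) :
    (∃ k t i, 6 ≤ k ∧ q = ad N k r t i) ∨ q = accQ N (r + 1) := by
  simp only [Circuit.targets_append, Circuit.targets_cons, Circuit.targets_nil, Set.mem_union,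
    Set.mem_insert_iff, Set.mem_empty_iff_false, or_false, Gate.target] at h
  rcases h with h | h | h | h
  · obtain ⟨t, i, e⟩ := targets_flags h
    exact Or.inl ⟨6, t, i, le_rfl, e⟩
  · exact Or.inl ⟨13, 0, 0, by norm_num, h⟩
  · obtain ⟨t, -, ⟨k, i, h1, -, e⟩ | ⟨j, e⟩⟩ := targets_samples h
    exacts [Or.inl ⟨k, t, i, by omega, e⟩, Or.inl ⟨13, t + 1, j, by omega, e⟩]
  · exact Or.inr h

theorem targets_round (hQ : Q.WF n) {q : ℕ}
    (h : q ∈ (round (2 ^ n) n Q.tokens L θ M r).targets) : IsRoundQ (2 ^ n) r q := by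
  rw [round, Circuit.targets_append] at h
  rcases h with h | h
  · obtain ⟨k, i, h1, -, e⟩ := targets_learn' hQ h
    exact Or.inl ⟨k, 0, i, h1, e⟩
  · rcases targets_rest_round h with ⟨k, t, i, h1, e⟩ | e
    exacts [Or.inl ⟨k, t, i, by omega, e⟩, Or.inr e]

theorem IsRoundQ.eq {N r' q : ℕ} (h : IsRoundQ N r q) (h' : IsRoundQ N r' q) : r = r' := by
  rcases h with ⟨k, t, i, h1, rfl⟩ | rfl
  · rcases h' with ⟨k', t', i', h3, e⟩ | e
    · simp at e; omega
    · simp [accQ] at e; omega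
  · rcases h' with ⟨k', t', i', h3, e⟩ | e
    · simp [accQ] at e; omega
    · simp [accQ] at e; omega

theorem not_isRoundQ_one (N r : ℕ) : ¬ IsRoundQ N r (one N) := by
  rintro (⟨k, t, i, h1, e⟩ | e) <;> simp [one, accQ] at e
  omega

theorem not_isRoundQ_two (N r : ℕ) : ¬ IsRoundQ N r (two N) := by
  rintro (⟨k, t, i, h1, e⟩ | e) <;> simp [two, accQ] at e
  omega

theorem IsRoundQ.le {N q : ℕ} (h : IsRoundQ N r q) : N ≤ q := by
  rcases h with ⟨k, t, i, h1, rfl⟩ | rfl <;> exact le_ad _ _ _ _ _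

theorem RoundEnv.next {f : BoolFun n} {b b' : Basis} (h : RoundEnv f r b)
    (hb : ∀ q, ¬ IsRoundQ (2 ^ n) r q → b' q = b q) : RoundEnv f (r + 1) b' where
  one := by rw [hb _ (not_isRoundQ_one _ _), h.one]
  two := by rw [hb _ (not_isRoundQ_two _ _), h.two]
  tt i := by
    rw [hb, h.tt]
    intro e
    have := e.le
    have := i.2
    omega
  fresh q r' hr' hq := by
    rw [hb, h.fresh q r' (by omega) hq]
    intro e
    have := e.eq hq
    omega

/-- In one round the tester keeps accepting with the average of `passProb` over the outcomes of the
learner. -/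
theorem ex_round (hQ : Q.WF n) {f : BoolFun n} {b : Basis} (hb : RoundEnv f r b) (A : ℝ)
    (g : Basis → ℝ) (hg : ∀ b' : Basis, (∀ q, ¬ IsRoundQ (2 ^ n) r q → b' q = b q) →
      g b' = if b' (accQ (2 ^ n) (r + 1)) then A else 0) :
    (round (2 ^ n) n Q.tokens L θ M r).ex b g =
      Q.outcomeExp f fun z => if b (accQ (2 ^ n) r) then A * passProb f L θ M z else 0 := by
  have h0 : ∀ k t i, 3 ≤ k → b (ad (2 ^ n) k r t i) = false :=
    fun k t i hk => hb.fresh _ r le_rfl (Or.inl ⟨k, t, i, hk, rfl⟩)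
  rw [round, Circuit.ex_append]
  swap
  · rw [Set.disjoint_left]
    intro q hq hq'
    obtain ⟨k, i, h1, h2, rfl⟩ := targets_learn' hQ hq
    rcases targets_rest_round hq' with ⟨k', t, j, h3, e⟩ | e
    · simp at e; omega
    · simp [accQ] at e
  rw [← ex_learn hQ f hb.toLearnEnv fun k i hk => h0 k 0 i hk]
  refine Circuit.ex_congr fun b₁ hb₁ => ?_
  have hb₁' : ∀ q, (∀ k i, 3 ≤ k → k ≤ 5 → q ≠ ad (2 ^ n) k r 0 i) → b₁ q = b q :=
    fun q hq => hb₁ q fun h => by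
      obtain ⟨k, i, h1, h2, e⟩ := targets_learn' hQ h
      exact hq k i h1 h2 e
  have one₁ : b₁ (one (2 ^ n)) = true := by
    rw [hb₁' _ (by simp [one]; omega), hb.one]
  have two₁ : b₁ (two (2 ^ n)) = true := by
    rw [hb₁' _ (by simp [two]; omega), hb.two]
  have zero₁ : ∀ k t i, 6 ≤ k → b₁ (ad (2 ^ n) k r t i) = false := by
    intro k t i hk
    rw [hb₁' _ (by simp; omega), h0 k t i (by omega)]
  set z : Basis := fun q => b₁ (learnQ (2 ^ n) r q) with hz
  rw [Circuit.ex_isClassical_append (isClassical_flags _ _ _)]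
  set b₂ := Circuit.cl (flags (2 ^ n) r L) b₁ with hb₂
  have e₂ : ∀ q, (∀ t i, q ≠ ad (2 ^ n) 6 r t i) → b₂ q = b₁ q :=
    fun q hq => Circuit.cl_apply_of_notMem _ _ _ fun h => by
      obtain ⟨t, i, e⟩ := targets_flags h
      exact hq t i e
  rw [Circuit.ex_isClassical_append (by simp [Circuit.isClassical_cons, Circuit.isClassical_nil,
    Gate.IsClassical])]
  set b₃ := Circuit.cl [Gate.toff (one (2 ^ n)) (two (2 ^ n)) (countQ (2 ^ n) r 0 0)] b₂ with hb₃
  have hb₃' : b₃ = Function.update b₂ (countQ (2 ^ n) r 0 0) true := by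
    have h1 : b₂ (one (2 ^ n)) = true := by rw [e₂ _ (by simp [one]), one₁]
    have h2 : b₂ (two (2 ^ n)) = true := by rw [e₂ _ (by simp [two]), two₁]
    have h3 : b₂ (countQ (2 ^ n) r 0 0) = false := by
      rw [e₂ _ (by simp [countQ]), countQ, zero₁ _ _ _ (by norm_num)]
    rw [hb₃]
    simp [Gate.apply, h1, h2, h3]
  have e₃ : ∀ q, q ≠ countQ (2 ^ n) r 0 0 → b₃ q = b₂ q := fun q hq => by
    rw [hb₃', Function.update_of_ne hq]
  have out₃ : ∀ q, ¬ IsRoundQ (2 ^ n) r q → b₃ q = b q := by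
    intro q hq
    have hq' : ∀ k t i, 3 ≤ k → q ≠ ad (2 ^ n) k r t i :=
      fun k t i hk e => hq (Or.inl ⟨k, t, i, hk, e⟩)
    rw [e₃ q (hq' 13 0 0 (by norm_num)), e₂ q fun t i => hq' 6 t i (by norm_num),
      hb₁' q fun k i hk _ => hq' k 0 i hk]
  have env₃ : SampleEnv f L r 0 z b₃ :=
    { one := by rw [out₃ _ (not_isRoundQ_one _ _), hb.one]
      two := by rw [out₃ _ (not_isRoundQ_two _ _), hb.two]
      tt := fun i => by
        rw [out₃, hb.tt]
        intro e
        have := e.le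
        have := i.2
        omega
      flag := fun s hs => by
        rw [e₃ _ (by simp [flagQ_eq, countQ]), hb₂,
          cl_flags one₁ two₁ (fun t i => zero₁ 6 t i le_rfl) hs]
      fresh := fun q t' _ hq => by
        have h1 : q ≠ countQ (2 ^ n) r 0 0 := by
          rintro rfl
          rcases hq with ⟨k, i, h1, h2, e⟩ | ⟨j, e⟩ <;> simp [countQ] at e
          omega
        rw [e₃ q h1, e₂ q]
        · rcases hq with ⟨k, i, h1, h2, rfl⟩ | ⟨j, rfl⟩
          exacts [zero₁ _ _ _ (by omega), zero₁ _ _ _ (by omega)]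
        · rintro t i rfl
          rcases hq with ⟨k, i, h1, h2, e⟩ | ⟨j, e⟩ <;> simp at e
          omega }
  have cnt₃ : ∀ j < θ + 1, b₃ (countQ (2 ^ n) r 0 j) = decide (j ≤ 0) := by
    intro j _
    rw [hb₃']
    by_cases hj : j = 0
    · simp [hj]
    · rw [Function.update_of_ne (by simpa [countQ] using hj), e₂ _ (by simp [countQ]), countQ,
        zero₁ _ _ _ (by norm_num)]
      simp [hj]
  have acc₃ : ∀ r', b₃ (accQ (2 ^ n) r') = b (accQ (2 ^ n) r') := by
    intro r'
    have h' : ∀ k t i, 3 ≤ k → accQ (2 ^ n) r' ≠ ad (2 ^ n) k r t i := by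
      intro k t i hk; simp [accQ]; omega
    rw [e₃ _ (h' 13 0 0 (by norm_num)), e₂ _ fun t i => h' 6 t i (by norm_num),
      hb₁' _ fun k i hk _ => h' k 0 i hk]
  have hW : Circuit.WF [Gate.toff (accQ (2 ^ n) r) (countQ (2 ^ n) r M θ)
      (accQ (2 ^ n) (r + 1))] := by
    simp [Circuit.WF, Gate.WF, Gate.qubits, countQ, accQ]
  rw [Circuit.ex_append_of_isClassical (by simp [Circuit.isClassical_cons,
    Circuit.isClassical_nil, Gate.IsClassical]) hW]
  rw [ex_samples _ (fun c => if b (accQ (2 ^ n) r) then (if θ ≤ c then A else 0) else 0) env₃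
    cnt₃]
  · by_cases ha : b (accQ (2 ^ n) r) = true
    · simp only [ha, if_true, passProb, ← binExp_const_mul, mul_ite, mul_one, mul_zero]
    · simp only [ha, Bool.false_eq_true, if_false]
      exact binExp_const _ _ _ _
  · intro b₄ c h4 hc
    have acc₄ : ∀ r', b₄ (accQ (2 ^ n) r') = b (accQ (2 ^ n) r') := by
      intro r'
      rw [h4 _, acc₃]
      rintro t' (⟨k, i, h1, h2, e⟩ | ⟨j, e⟩) <;> simp [accQ] at e
      omega
    have hn : b (accQ (2 ^ n) (r + 1)) = false := hb.fresh _ r le_rfl (Or.inr rfl)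
    have hcθ := hc θ (by omega)
    rw [zero_add] at hcθ
    rw [hg]
    · simp [Gate.apply, acc₄, hcθ, hn]
      by_cases ha : b (accQ (2 ^ n) r) = true <;> simp [ha]
    · intro q hq
      have hne : q ≠ accQ (2 ^ n) (r + 1) := fun e => hq (Or.inr e)
      simp only [Circuit.cl_cons, Circuit.cl_nil, Gate.apply]
      rw [Function.update_of_ne hne, h4 q fun t' ht' => hq ht'.isRoundQ, out₃ q hq]

end round

section outcome

variable {n : ℕ} {f : BoolFun n} {Q : OracleCircuit}

/-- The basis state in which the first `2 ^ n` qubits hold the truth table of `f`, the qubits `one`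
and `two` hold `1`, and all other qubits hold `0`. -/
def learnBasis (f : BoolFun n) : Basis := fun q =>
  if q = one (2 ^ n) ∨ q = two (2 ^ n) then true else inputBasis (tt f) q

theorem inputBasis_ad {m : ℕ} (x : Fin m → Bool) (k r t i : ℕ) :
    inputBasis x (ad m k r t i) = false := by
  have := le_ad m k r t i
  simp [inputBasis, this]

theorem learnEnv_learnBasis (f : BoolFun n) : LearnEnv f (learnBasis f) where
  one := by simp [learnBasis]
  two := by simp [learnBasis]
  tt i := by
    have h := i.2
    have h1 := le_ad (2 ^ n) 0 0 0 0
    have h2 := le_ad (2 ^ n) 0 0 0 1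
    have : ¬ ((i : ℕ) = one (2 ^ n) ∨ (i : ℕ) = two (2 ^ n)) := by
      simp only [one, two]; omega
    simp [learnBasis, this, inputBasis]

theorem outcomeExp_eq_ex (hQ : Q.WF n) (f : BoolFun n) (g : Basis → ℝ) :
    Q.outcomeExp f g = (learn (2 ^ n) n Q.tokens 0).ex (learnBasis f)
      fun b' => g fun q => b' (learnQ (2 ^ n) 0 q) := by
  rw [ex_learn hQ f (learnEnv_learnBasis f)]
  intro k i hk
  simp [learnBasis, one, two, inputBasis_ad]
  omega

theorem outcomeExp_const (hQ : Q.WF n) (f : BoolFun n) (c : ℝ) :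
    Q.outcomeExp f (fun _ => c) = c := by
  rw [outcomeExp_eq_ex hQ, Circuit.ex_const (wf_learn hQ)]

theorem outcomeExp_add (hQ : Q.WF n) (f : BoolFun n) (g g' : Basis → ℝ) :
    Q.outcomeExp f (fun z => g z + g' z) = Q.outcomeExp f g + Q.outcomeExp f g' := by
  simp only [outcomeExp_eq_ex hQ, Circuit.ex_add]

theorem outcomeExp_const_mul (hQ : Q.WF n) (f : BoolFun n) (c : ℝ) (g : Basis → ℝ) :
    Q.outcomeExp f (fun z => c * g z) = c * Q.outcomeExp f g := by
  simp only [outcomeExp_eq_ex hQ, Circuit.ex_const_mul]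

/-- Only the qubits that the learner changes can be found in state `1`. -/
theorem outcomeExp_mono (hQ : Q.WF n) (f : BoolFun n) {g g' : Basis → ℝ}
    (h : ∀ z : Basis, (∀ q ∉ Q.targets, z q = false) → g z ≤ g' z) :
    Q.outcomeExp f g ≤ Q.outcomeExp f g' := by
  rw [outcomeExp_eq_ex hQ, outcomeExp_eq_ex hQ]
  refine Circuit.ex_mono fun b' hb' => h _ fun q hq => ?_
  rw [hb']
  · simp [learnBasis, one, two, learnQ, inputBasis_ad]
  · intro h'
    rcases targets_learn hQ h' with ⟨p, hp, e⟩ | ⟨l, e⟩ | ⟨i, e⟩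
    · rw [learnQ_injective _ _ e] at hq
      exact hq hp
    · simp [learnQ] at e
    · simp [learnQ, measQ] at e

end outcome

/-! ### The tester -/

/-- The rounds with the numbers `r, …, r + R - 1`. -/
def rounds (N n : ℕ) (T : List ℕ) (L θ M r R : ℕ) : Circuit :=
  (List.range' r R).flatMap (round N n T L θ M)

/-- The qubits of the preparation: two random bits, and scratch space. -/
def prepQ (N i j : ℕ) : ℕ := ad N 1 0 j i

/-- Prepares the random bits from which a qubit in state `1` is made. -/
def testerBits (N J : ℕ) : Circuit := prepareBits (prepQ N 0) (prepQ N 1) J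

/-- Makes the qubits `one`, `two` and `accQ N 0`, and runs the rounds. -/
def testerMain (N n : ℕ) (T : List ℕ) (L θ M R J : ℕ) : Circuit :=
  prepareOr (one N) (two N) (prepQ N 0) (prepQ N 1) (prepQ N 2) (prepQ N 3) J ++
    ([Gate.toff (one N) (two N) (accQ N 0)] ++ rounds N n T L θ M 0 R)

/-- Moves the final answer to qubit `0`, which held a bit of the input. -/
def testerOutput (N R : ℕ) : Circuit :=
  [Gate.toff (one N) 0 (accQ N R), Gate.toff (one N) (accQ N R) 0]

/-- The tester: `R` rounds, each of which has to accept. -/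
def tester (N n : ℕ) (T : List ℕ) (L θ M R J : ℕ) : Circuit :=
  (testerBits N J ++ testerMain N n T L θ M R J) ++ testerOutput N R

section tester

variable {n L θ M r R J : ℕ} {Q : OracleCircuit}

theorem prepareOK (N : ℕ) : PrepareOK (one N) (two N) (prepQ N 0) (prepQ N 1) (prepQ N 2)
    (prepQ N 3) := by
  constructor <;> intros <;> try intro i j h
  all_goals simp_all [one, two, prepQ]

theorem targets_rounds (hQ : Q.WF n) {q : ℕ}
    (h : q ∈ (rounds (2 ^ n) n Q.tokens L θ M r R).targets) :
    ∃ r' ≥ r, IsRoundQ (2 ^ n) r' q := by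
  simp only [rounds, Circuit.targets_flatMap, Set.mem_iUnion, List.mem_range'_1] at h
  obtain ⟨r', hr', h⟩ := h
  exact ⟨r', hr'.1, targets_round hQ h⟩

theorem ex_rounds (hQ : Q.WF n) {f : BoolFun n} {b : Basis} (hb : RoundEnv f r b) :
    (rounds (2 ^ n) n Q.tokens L θ M r R).ex b
      (fun b' => if b' (accQ (2 ^ n) (r + R)) then 1 else 0) =
    if b (accQ (2 ^ n) r) then Q.outcomeExp f (passProb f L θ M) ^ R else 0 := by
  induction R generalizing r b with
  | zero => simp [rounds]
  | succ R ih =>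
    have e : rounds (2 ^ n) n Q.tokens L θ M r (R + 1) = round (2 ^ n) n Q.tokens L θ M r ++
        rounds (2 ^ n) n Q.tokens L θ M (r + 1) R := by
      simp [rounds, List.range'_succ]
    rw [e, Circuit.ex_append]
    · rw [ex_round hQ hb (Q.outcomeExp f (passProb f L θ M) ^ R)]
      · split_ifs
        · rw [outcomeExp_const_mul hQ, pow_succ]
        · exact outcomeExp_const hQ f 0
      · intro b' hb'
        rw [← ih (hb.next hb')]
        congr! 6 with b''
        omega
    · rw [Set.disjoint_left]
      intro q hq hq'
      obtain ⟨r', hr', h⟩ := targets_rounds hQ hq'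
      have := (targets_round hQ hq).eq h
      omega

theorem zero_ne_ad (k r t i : ℕ) : 0 ≠ ad (2 ^ n) k r t i := by
  have := le_ad (2 ^ n) k r t i
  have : 0 < 2 ^ n := by positivity
  omega

theorem wf_testerOutput : (testerOutput (2 ^ n) R).WF := by
  have h1 := zero_ne_ad (n := n) 0 0 0 0
  have h2 := zero_ne_ad (n := n) 2 R 0 0
  simp [testerOutput, Circuit.WF, Gate.WF, Gate.qubits, one, accQ, h1.symm, h2, h2.symm]

theorem wf_rounds (hQ : Q.WF n) : (rounds (2 ^ n) n Q.tokens L θ M r R).WF :=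
  Circuit.WF.flatMap fun _ _ => wf_round hQ

theorem wf_testerMain (hQ : Q.WF n) : (testerMain (2 ^ n) n Q.tokens L θ M R J).WF :=
  (wf_prepareOr (prepareOK _)).append (Circuit.WF.append
    (by simp [Circuit.WF, Gate.WF, Gate.qubits, one, two, accQ]) (wf_rounds hQ))

theorem wf_testerBits : (testerBits (2 ^ n) J).WF := wf_prepareBits

theorem wf_tester (hQ : Q.WF n) : (tester (2 ^ n) n Q.tokens L θ M R J).WF :=
  (wf_testerBits.append (wf_testerMain hQ)).append wf_testerOutput

theorem disjoint_targets_testerBits (hQ : Q.WF n) : Disjoint (testerBits (2 ^ n) J).targets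
    (testerMain (2 ^ n) n Q.tokens L θ M R J).targets := by
  rw [Set.disjoint_left]
  intro q hq hq'
  obtain ⟨j, -, hq⟩ := targets_prepareBits_subset hq
  obtain ⟨i, hi, rfl⟩ : ∃ i < 2, q = prepQ (2 ^ n) i j := by
    rcases hq with e | e
    exacts [⟨0, by norm_num, e⟩, ⟨1, by norm_num, e⟩]
  simp only [testerMain, Circuit.targets_append, Circuit.targets_cons, Circuit.targets_nil,
    Set.mem_union, Set.mem_insert_iff, Set.mem_empty_iff_false, or_false, Gate.target] at hq'
  rcases hq' with h | h | h
  · rcases targets_prepareOr_subset h with e | e | ⟨j', -, e | e⟩ <;>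
      simp [prepQ, one, two] at e <;> omega
  · simp [prepQ, accQ] at h
  · obtain ⟨r', -, ⟨k, t, i, h1, e⟩ | e⟩ := targets_rounds hQ h
    · simp [prepQ] at e; omega
    · simp [prepQ, accQ] at e

/-- If one of the pairs of random bits is `(1, 1)`, then the tester accepts with the probability
that all the rounds accept. -/
theorem ex_testerMain (hQ : Q.WF n) {f : BoolFun n} {b : Basis}
    (hb : ∀ q, (∀ i < 2, ∀ j, q ≠ prepQ (2 ^ n) i j) → b q = inputBasis (tt f) q)
    (hor : ∃ j < J, b (prepQ (2 ^ n) 0 j) ∧ b (prepQ (2 ^ n) 1 j)) :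
    (testerMain (2 ^ n) n Q.tokens L θ M R J).ex b
      (fun b' => if Circuit.cl (testerOutput (2 ^ n) R) b' 0 = true then 1 else 0) =
    Q.outcomeExp f (passProb f L θ M) ^ R := by
  have hz : ∀ k r t i, (k = 1 → 2 ≤ i) → b (ad (2 ^ n) k r t i) = false := by
    intro k r t i h
    rw [hb, inputBasis_ad]
    intro i' hi' j e
    simp [prepQ] at e
    omega
  rw [testerMain, Circuit.ex_isClassical_append isClassical_prepareOr]
  have h1 := cl_prepareOr (J := J) (prepareOK (2 ^ n)) (b := b) (hz _ _ _ _ (by simp))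
    (hz _ _ _ _ (by simp)) (fun j => hz _ _ _ _ (by simp)) (fun j => hz _ _ _ _ (by simp))
  set b₁ := Circuit.cl (prepareOr (one (2 ^ n)) (two (2 ^ n)) (prepQ (2 ^ n) 0) (prepQ (2 ^ n) 1)
    (prepQ (2 ^ n) 2) (prepQ (2 ^ n) 3) J) b with hb₁
  have one₁ : b₁ (one (2 ^ n)) = true := by rw [h1.1]; simpa using hor
  have two₁ : b₁ (two (2 ^ n)) = true := by rw [h1.2]; simpa using hor
  have out₁ : ∀ q, q ≠ one (2 ^ n) → q ≠ two (2 ^ n) → (∀ i j, q ≠ prepQ (2 ^ n) i j) →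
      b₁ q = inputBasis (tt f) q := by
    intro q h1 h2 h3
    rw [hb₁, Circuit.cl_apply_of_notMem, hb q fun i _ => h3 i]
    intro h
    rcases targets_prepareOr_subset h with e | e | ⟨j', -, e | e⟩
    exacts [h1 e, h2 e, h3 _ _ e, h3 _ _ e]
  rw [Circuit.ex_isClassical_append (by simp [Circuit.isClassical_cons, Circuit.isClassical_nil,
    Gate.IsClassical])]
  have hb₂ : Circuit.cl [Gate.toff (one (2 ^ n)) (two (2 ^ n)) (accQ (2 ^ n) 0)] b₁ =
      Function.update b₁ (accQ (2 ^ n) 0) true := by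
    have h3 : b₁ (accQ (2 ^ n) 0) = false := by
      rw [out₁ _ (by simp [accQ, one]) (by simp [accQ, two]) (by simp [accQ, prepQ]), accQ,
        inputBasis_ad]
    simp [Gate.apply, one₁, two₁, h3]
  rw [hb₂]
  set b₂ := Function.update b₁ (accQ (2 ^ n) 0) true with hb₂'
  have out₂ : ∀ q, q ≠ accQ (2 ^ n) 0 → b₂ q = b₁ q := fun q hq => Function.update_of_ne hq _ _
  have env : RoundEnv f 0 b₂ :=
    { one := by rw [out₂ _ (by simp [one, accQ]), one₁]
      two := by rw [out₂ _ (by simp [two, accQ]), two₁]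
      tt := fun i => by
        have h : ∀ k r t i', (i : ℕ) ≠ ad (2 ^ n) k r t i' := by
          intro k r t i' e
          have := le_ad (2 ^ n) k r t i'
          have := i.2
          omega
        rw [out₂ _ (h _ _ _ _), out₁ _ (h _ _ _ _) (h _ _ _ _) fun _ _ => h _ _ _ _]
        simp [inputBasis]
      fresh := by
        rintro q r' - (⟨k, t, i, hk, rfl⟩ | rfl)
        · rw [out₂ _ (by simp [accQ]; omega), out₁ _ (by simp [one]; omega) (by simp [two]; omega)
            (by simp [prepQ]; omega), inputBasis_ad]
        · rw [out₂ _ (by simp [accQ]), out₁ _ (by simp [one, accQ]) (by simp [two, accQ])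
            (by simp [prepQ, accQ]), accQ, inputBasis_ad] }
  have hmain := ex_rounds (L := L) (θ := θ) (M := M) (R := R) hQ env
  rw [zero_add] at hmain
  simp only [hb₂', Function.update_self, if_true] at hmain
  rw [← hmain]
  refine Circuit.ex_congr fun b₃ h₃ => ?_
  have one₃ : b₃ (one (2 ^ n)) = true := by
    rw [h₃, out₂ _ (by simp [one, accQ]), one₁]
    intro h
    obtain ⟨r', -, h⟩ := targets_rounds hQ h
    exact not_isRoundQ_one _ _ h
  have n1 : one (2 ^ n) ≠ accQ (2 ^ n) R := by simp [one, accQ]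
  have n2 : (0 : ℕ) ≠ accQ (2 ^ n) R := zero_ne_ad _ _ _ _
  simp only [testerOutput, Circuit.cl_cons, Circuit.cl_nil, Gate.apply, Function.update_self,
    Function.update_of_ne n1, Function.update_of_ne n2, one₃, Bool.true_and]
  cases b₃ 0 <;> cases b₃ (accQ (2 ^ n) R) <;> rfl

theorem prob_tester (hQ : Q.WF n) (f : BoolFun n) :
    (tester (2 ^ n) n Q.tokens L θ M R J).prob (tt f) true ≤
      Q.outcomeExp f (passProb f L θ M) ^ R + (3 / 4) ^ J ∧
    Q.outcomeExp f (passProb f L θ M) ^ R * (1 - (3 / 4) ^ J) ≤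
      (tester (2 ^ n) n Q.tokens L θ M R J).prob (tt f) true := by
  set P := Q.outcomeExp f (passProb f L θ M) ^ R
  set I : Basis → ℝ := fun b => if ∃ j < J, b (prepQ (2 ^ n) 0 j) ∧ b (prepQ (2 ^ n) 1 j)
    then 0 else 1 with hI
  have hEI : (testerBits (2 ^ n) J).ex (inputBasis (tt f)) I = (3 / 4) ^ J :=
    ex_prepareBits (prepareOK _) _
  set g : Basis → ℝ := fun b =>
    if Circuit.cl (testerOutput (2 ^ n) R) b 0 = true then 1 else 0 with hg
  have hprob : (tester (2 ^ n) n Q.tokens L θ M R J).prob (tt f) true =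
      (testerBits (2 ^ n) J).ex (inputBasis (tt f)) fun b' =>
        (testerMain (2 ^ n) n Q.tokens L θ M R J).ex b' g := by
    rw [← Circuit.ex_append (disjoint_targets_testerBits hQ)]
    have e := Circuit.ex_append_of_isClassical (U := testerBits (2 ^ n) J ++
      testerMain (2 ^ n) n Q.tokens L θ M R J) (V := testerOutput (2 ^ n) R)
      (by simp [testerOutput, Circuit.isClassical_cons, Circuit.isClassical_nil,
        Gate.IsClassical]) wf_testerOutput (inputBasis (tt f)) (fun b => if b 0 = true then 1 else 0)
    rw [← e, Circuit.prob, weight_eq_expect, tester, Circuit.ex]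
    congr 1
    funext b
    by_cases hb : b 0 = true <;> simp [hb]
  have hmain : ∀ b : Basis, (∀ q ∉ (testerBits (2 ^ n) J).targets, b q = inputBasis (tt f) q) →
      I b = 0 → (testerMain (2 ^ n) n Q.tokens L θ M R J).ex b g = P := by
    intro b hb hIb
    refine ex_testerMain hQ (fun q hq => hb q fun h => ?_) ?_
    · obtain ⟨j, -, e | e⟩ := targets_prepareBits_subset h
      exacts [hq 0 (by norm_num) j e, hq 1 (by norm_num) j e]
    · by_contra hc
      simp [hI, hc] at hIb
  have hg0 : ∀ b, 0 ≤ (testerMain (2 ^ n) n Q.tokens L θ M R J).ex b g := by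
    intro b
    rw [← Circuit.ex_const (wf_testerMain (L := L) (θ := θ) (M := M) (R := R) (J := J) hQ) b 0]
    exact Circuit.ex_mono fun b' _ => by simp only [hg]; split_ifs <;> norm_num
  have hg1 : ∀ b, (testerMain (2 ^ n) n Q.tokens L θ M R J).ex b g ≤ 1 := by
    intro b
    rw [← Circuit.ex_const (wf_testerMain (L := L) (θ := θ) (M := M) (R := R) (J := J) hQ) b 1]
    exact Circuit.ex_mono fun b' _ => by simp only [hg]; split_ifs <;> norm_num
  have hIb : ∀ b, I b = 0 ∨ I b = 1 := fun b => by simp only [hI]; split_ifs <;> simp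
  have hp0 : 0 ≤ Q.outcomeExp f (passProb f L θ M) := by
    rw [← outcomeExp_const hQ f 0]
    exact outcomeExp_mono hQ f fun z _ => passProb_nonneg f L θ M z
  have hP : 0 ≤ P := pow_nonneg hp0 R
  rw [hprob]
  constructor
  · rw [← hEI, ← Circuit.ex_const (wf_testerBits (n := n) (J := J)) (inputBasis (tt f)) P,
      ← Circuit.ex_add]
    refine Circuit.ex_mono fun b hb => ?_
    rcases hIb b with h | h
    · rw [hmain b hb h, h, add_zero]
    · rw [h]; linarith [hg1 b]
  · have e : P * (1 - (3 / 4) ^ J) = (testerBits (2 ^ n) J).ex (inputBasis (tt f))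
        fun b => P + (-P) * I b := by
      rw [Circuit.ex_add, Circuit.ex_const wf_testerBits, Circuit.ex_const_mul, hEI]
      ring
    rw [e]
    refine Circuit.ex_mono fun b hb => ?_
    rcases hIb b with h | h
    · rw [hmain b hb h, h]; linarith
    · rw [h]; linarith [hg0 b]

end tester

/-! ### Decoding the description of a circuit -/

theorem flatMap_range_eq_single {α : Type*} {n i : ℕ} (hi : i < n) {F : ℕ → List α}
    (h : ∀ j < n, j ≠ i → F j = []) : (List.range n).flatMap F = F i := by
  have aux : ∀ n' ≤ n, (List.range n').flatMap F = if i < n' then F i else [] := by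
    intro n' hn'
    induction n' with
    | zero => simp
    | succ n' ih =>
      rw [List.range_succ, List.flatMap_append, ih (by omega)]
      rcases lt_trichotomy i n' with hlt | rfl | hgt
      · simp [hlt, h n' (by omega) (by omega), Nat.lt_succ_of_lt hlt]
      · simp
      · simp [h n' (by omega) (by omega), show ¬ i < n' by omega, show ¬ i < n' + 1 by omega]
  rw [aux n le_rfl, if_pos hi]

theorem getD_flatMap_of_length {α β : Type*} {F : α → List β} {c : ℕ} (hF : ∀ a, (F a).length = c)
    (l : List α) {i j : ℕ} (hi : i < l.length) (hj : j < c) (d : β) :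
    (l.flatMap F).getD (i * c + j) d = (F l[i]).getD j d := by
  induction l generalizing i with
  | nil => simp at hi
  | cons a l ih =>
    rw [List.flatMap_cons]
    rcases i with _ | i
    · rw [List.getD_append _ _ _ _ (by rw [hF]; omega)]
      simp
    · rw [List.getD_append_right _ _ _ _ (by rw [hF, Nat.succ_mul]; omega), hF]
      have : (i + 1) * c + j - c = i * c + j := by rw [Nat.succ_mul]; omega
      rw [this, ih (by simpa using hi)]
      simp

theorem eq_of_testBit_eq_of_lt {m a b : ℕ} (ha : a < m) (hb : b < m)
    (h : ∀ j < Nat.size m, a.testBit j = b.testBit j) : a = b := by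
  refine Nat.eq_of_testBit_eq fun j => ?_
  by_cases hj : j < Nat.size m
  · exact h j hj
  · have hm : m < 2 ^ j :=
      (Nat.lt_size_self m).trans_le (Nat.pow_le_pow_right (by norm_num) (by omega))
    rw [Nat.testBit_lt_two_pow (ha.trans hm), Nat.testBit_lt_two_pow (hb.trans hm)]

/-- The slot of gate number `i` of a circuit on `m` qubits. -/
def Gate.slot (m i : ℕ) : Gate → Slot
  | had q => ⟨m, i, 0, q, 0, 0⟩
  | toff a b c => ⟨m, i, 1, a, b, c⟩

theorem length_gateCode (m : ℕ) (g : Gate) :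
    (Circuit.gateCode (Nat.size m) g).length = Slot.codeLen m := by
  cases g <;> simp [Circuit.gateCode, Circuit.addr, Slot.codeLen] <;> ring

theorem getD_addr {w j : ℕ} (q : ℕ) (hj : j < w) :
    (Circuit.addr w q).getD j false = q.testBit j := by
  simp [Circuit.addr, hj]

theorem gateCode_eq (m i : ℕ) (g : Gate) : Circuit.gateCode (Nat.size m) g =
    [true, decide ((g.slot m i).k = 1)] ++ (Circuit.addr (Nat.size m) (g.slot m i).a ++
      (Circuit.addr (Nat.size m) (g.slot m i).b ++ Circuit.addr (Nat.size m) (g.slot m i).c)) := by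
  cases g with
  | had q =>
    have h0 : Circuit.addr (Nat.size m) 0 = List.replicate (Nat.size m) false := by
      simp [Circuit.addr, List.map_const']
    simp [Circuit.gateCode, Gate.slot, h0, two_mul]
  | toff a b c => simp [Circuit.gateCode, Gate.slot]

theorem getD_gateCode {m i j : ℕ} (g : Gate) (hj : j < Slot.codeLen m) :
    (Circuit.gateCode (Nat.size m) g).getD j false = (g.slot m i).codeBit j := by
  have hl : ∀ q, (Circuit.addr (Nat.size m) q).length = Nat.size m := by simp [Circuit.addr]
  have hm : (g.slot m i).m = m := by cases g <;> rfl
  rw [gateCode_eq m i, Slot.codeBit, hm]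
  simp only [Slot.codeLen] at hj
  rcases j with _ | _ | j
  · simp
  · simp
  · simp only [Nat.add_eq_zero_iff, one_ne_zero, and_false, if_false, Nat.add_eq_right,
      List.cons_append, List.nil_append, List.getD_cons_succ]
    rw [show j + 1 + 1 - 2 = j from rfl]
    split_ifs with h1 h2
    · rw [List.getD_append _ _ _ _ (by rwa [hl]), getD_addr _ h1]
    · rw [List.getD_append_right _ _ _ _ (by rw [hl]; omega), hl,
        List.getD_append _ _ _ _ (by rw [hl]; omega), getD_addr _ (by omega)]
    · rw [List.getD_append_right _ _ _ _ (by rw [hl]; omega), hl,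
        List.getD_append_right _ _ _ _ (by rw [hl]; omega), hl, getD_addr _ (by omega)]
      congr 1
      omega

section code

variable {m : ℕ} {U : Circuit}

theorem length_gateCodes (m : ℕ) (U : Circuit) :
    (U.flatMap (Circuit.gateCode (Nat.size m))).length = U.length * Slot.codeLen m := by
  simp [List.length_flatMap, length_gateCode]

theorem length_code (m : ℕ) (U : Circuit) :
    (U.code m).length = m + 1 + U.length * Slot.codeLen m + 1 := by
  simp only [Circuit.code, List.length_append, List.length_replicate, List.length_singleton,
    length_gateCodes]

theorem getD_code_of_lt {p : ℕ} (hp : p < m) (U : Circuit) : (U.code m).getD p false = false := by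
  rw [Circuit.code, List.append_assoc, List.append_assoc,
    List.getD_append _ _ _ _ (by simpa using hp)]
  simp [hp]

theorem getD_code_self (U : Circuit) : (U.code m).getD m false = true := by
  simp [Circuit.code, List.append_assoc]

theorem getD_code_gate {i j : ℕ} (hi : i < U.length) (hj : j < Slot.codeLen m) :
    (U.code m).getD (m + 1 + i * Slot.codeLen m + j) false = (U[i].slot m i).codeBit j := by
  have hlt : i * Slot.codeLen m + j < U.length * Slot.codeLen m := by
    have := Nat.mul_le_mul_right (Slot.codeLen m) (Nat.succ_le_of_lt hi)
    rw [Nat.succ_mul] at this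
    omega
  rw [Circuit.code, List.getD_append _ _ _ _ (by
    rw [List.length_append, length_gateCodes]; simp; omega),
    List.getD_append_right _ _ _ _ (by simp; omega)]
  have : m + 1 + i * Slot.codeLen m + j - (List.replicate m false ++ [true]).length =
      i * Slot.codeLen m + j := by simp; omega
  rw [this, getD_flatMap_of_length (length_gateCode m) U hi hj, getD_gateCode]
  exact hj

theorem getD_code_end (U : Circuit) :
    (U.code m).getD (m + 1 + U.length * Slot.codeLen m) false = false := by
  rw [Circuit.code, List.getD_append_right _ _ _ _ (by
    rw [List.length_append, length_gateCodes]; simp)]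
  rw [List.length_append, length_gateCodes]
  simp

theorem codeBit_zero (s : Slot) : s.codeBit 0 = true := by simp [Slot.codeBit]

/-- In the description of a circuit only the slots of its gates are present. -/
theorem on_iff (hU : U.OnQubits m) {z : ℕ → Bool}
    (hz : ∀ p < (U.code m).length, z p = (U.code m).getD p false) {s : Slot}
    (hk : s.k < 2) (ha : s.a < s.m) (hb : s.b < s.m) (hc : s.c < s.m) :
    s.On z ↔ s.m = m ∧ ∃ h : s.i < U.length, s = U[s.i].slot m s.i := by
  have hlen := length_code m U
  have hc0 : 0 < Slot.codeLen m := by simp [Slot.codeLen]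
  have z_lt : ∀ p < m, z p = false := fun p hp => by
    rw [hz p (by omega), getD_code_of_lt hp]
  have z_self : z m = true := by rw [hz m (by omega), getD_code_self]
  have z_gate : ∀ i (hi : i < U.length) j, j < Slot.codeLen m →
      z (m + 1 + i * Slot.codeLen m + j) = (U[i].slot m i).codeBit j := fun i hi j hj => by
    have := Nat.mul_le_mul_right (Slot.codeLen m) (Nat.succ_le_of_lt hi)
    rw [Nat.succ_mul] at this
    rw [hz _ (by omega), getD_code_gate hi hj]
  have z_end : z (m + 1 + U.length * Slot.codeLen m) = false := by
    rw [hz _ (by omega), getD_code_end]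
  have slot_m : ∀ (g : Gate) i, (g.slot m i).m = m := by intro g i; cases g <;> rfl
  have slot_i : ∀ (g : Gate) i, (g.slot m i).i = i := by intro g i; cases g <;> rfl
  constructor
  · intro hon
    have hm : s.m = m := by
      rcases lt_trichotomy s.m m with h | h | h
      · have := hon s.m (by simp [Slot.litLen, Slot.codeLen]; omega)
        rw [Slot.litPos, if_pos (by omega), z_lt _ h] at this
        simp [Slot.litSgn] at this
        omega
      · exact h
      · have := hon m (by simp [Slot.litLen, Slot.codeLen]; omega)
        rw [Slot.litPos, if_pos (by omega), z_self, Slot.litSgn, if_pos h] at this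
        simp at this
    have hi : s.i < U.length := by
      by_contra hi
      rcases (not_lt.1 hi).lt_or_eq with h | h
      · -- the end marker would have to announce a gate
        have := hon (s.m + 1 + U.length) (by simp only [Slot.litLen]; omega)
        rw [Slot.litPos, if_neg (by omega), if_pos (by omega), Slot.litSgn, if_neg (by omega),
          if_pos (by omega), Nat.add_sub_cancel_left, hm, z_end] at this
        simp at this
      · have := hon (s.m + 1 + s.i) (by simp only [Slot.litLen, Slot.codeLen]; omega)
        rw [Slot.litPos, if_neg (by omega), if_neg (by omega), Slot.litSgn, if_neg (by omega),
          if_neg (by omega), Nat.sub_self, codeBit_zero, hm, ← h, add_zero, z_end] at this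
        simp at this
    have hbit : ∀ j < Slot.codeLen m, s.codeBit j = (U[s.i].slot m s.i).codeBit j := by
      intro j hj
      have := hon (s.m + 1 + s.i + j) (by simp only [Slot.litLen, hm]; omega)
      rw [Slot.litPos, if_neg (by omega), if_neg (by omega), Slot.litSgn, if_neg (by omega),
        if_neg (by omega), Nat.add_sub_cancel_left, hm, z_gate _ hi j hj] at this
      exact this.symm
    have hg : ∀ q ∈ U[s.i].qubits, q < m := hU.2 _ (List.getElem_mem hi)
    have key : ∀ s' : Slot, s'.m = m → s'.i = s.i → s'.k < 2 → s'.a < m → s'.b < m → s'.c < m →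
        (∀ j < Slot.codeLen m, s.codeBit j = s'.codeBit j) → s = s' := by
      rintro ⟨m', i', k', a', b', c'⟩ h1 h2 h3 h4 h5 h6 h7
      obtain ⟨m₀, i₀, k, a, b, c⟩ := s
      simp only at hk ha hb hc hm h1 h2 h3 h4 h5 h6
      have hsz : Slot.codeLen m = 2 + 3 * Nat.size m := rfl
      rw [hm] at ha hb hc
      have e1 : k = k' := by
        have := h7 1 (by omega)
        simp [Slot.codeBit] at this
        omega
      have e2 : a = a' := eq_of_testBit_eq_of_lt ha h4 fun j hj => by
        have := h7 (j + 2) (by omega)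
        simpa [Slot.codeBit, hm, h1, hj] using this
      have e3 : b = b' := eq_of_testBit_eq_of_lt hb h5 fun j hj => by
        have := h7 (Nat.size m + j + 2) (by omega)
        simpa [Slot.codeBit, hm, h1, hj, two_mul] using this
      have e4 : c = c' := eq_of_testBit_eq_of_lt hc h6 fun j hj => by
        have := h7 (2 * Nat.size m + j + 2) (by omega)
        have h8 : ¬ 2 * Nat.size m + j < Nat.size m := by omega
        simpa [Slot.codeBit, hm, h1, hj, h8] using this
      rw [hm, h1, h2, e1, e2, e3, e4]
    refine ⟨hm, hi, key _ (slot_m _ _) (slot_i _ _) ?_ ?_ ?_ ?_ hbit⟩ <;>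
      revert hg <;> cases U[s.i] <;> simp [Gate.slot, Gate.qubits] <;> omega
  · rintro ⟨hm, hi, hs⟩ l hl
    simp only [Slot.litLen, hm] at hl
    simp only [Slot.litPos, Slot.litSgn, hm]
    by_cases h1 : l < m
    · simp [h1, Nat.lt_succ_of_lt h1, z_lt l h1]
    · by_cases h2 : l < m + 1
      · obtain rfl : l = m := by omega
        have h4 : l < l + 1 + s.i := by omega
        simp [z_self, h4]
      · by_cases h3 : l < m + 1 + s.i
        · simp only [h1, h2, h3, if_true, if_false]
          have := z_gate (l - (m + 1)) (by omega) 0 hc0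
          rwa [add_zero, codeBit_zero] at this
        · simp only [h1, h2, h3, if_false]
          rw [z_gate _ hi _ (by omega), ← hs]

theorem gate_slot {g : Gate} (hg : g.WF) (m i : ℕ) : (g.slot m i).gate = [g] := by
  cases g with
  | had q => simp [Gate.slot, Slot.gate]
  | toff a b c =>
    simp only [Gate.WF, Gate.qubits, List.nodup_cons, List.mem_cons, List.not_mem_nil, or_false,
      not_or, List.nodup_nil, and_true, not_false_eq_true] at hg
    simp [Gate.slot, Slot.gate, hg]

theorem flatMap_range_singleton (U : Circuit) {L : ℕ} (hL : U.length ≤ L) :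
    ((List.range L).flatMap fun i => if h : i < U.length then [U[i]] else []) = U := by
  obtain ⟨d, rfl⟩ := Nat.exists_eq_add_of_le hL
  induction d with
  | zero =>
    apply List.ext_getElem?
    intro i
    have e : ((List.range U.length).flatMap fun i => if h : i < U.length then [U[i]] else []) =
        (List.finRange U.length).map fun i => U[i] := by
      rw [← List.flatMap_pure_eq_map, ← List.map_coe_finRange_eq_range, List.flatMap_map]
      exact List.flatMap_congr fun i _ => by simp [i.2]
    rw [add_zero, e]
    congr 1
    exact List.ext_getElem (by simp) (by simp)
  | succ d ih =>
    rw [← add_assoc, List.range_succ, List.flatMap_append, ih (by omega)]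
    simp

/-- Decoding recovers a circuit from its description. -/
theorem decode_eq (hU : U.OnQubits m) {L : ℕ} {z : ℕ → Bool}
    (h : U.code m <+: (List.range L).map z) : decode L z = U := by
  have hlen := length_code m U
  have hL : (U.code m).length ≤ L := by simpa using h.length_le
  have hc0 : 0 < Slot.codeLen m := by simp [Slot.codeLen]
  have hUl : U.length ≤ U.length * Slot.codeLen m := Nat.le_mul_of_pos_right _ hc0
  have hz : ∀ p < (U.code m).length, z p = (U.code m).getD p false := by
    intro p hp
    rw [List.getD_eq_getElem _ _ hp, List.IsPrefix.getElem h hp]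
    simp
  have hon := fun {s : Slot} => on_iff hU hz (s := s)
  have slot_m : ∀ (g : Gate) i, (g.slot m i).m = m := by intro g i; cases g <;> rfl
  set B : Slot → Circuit := fun s => if s.On z then s.gate else [] with hB
  have hB' : ∀ s : Slot, ¬ s.On z → B s = [] := fun s hs => by simp [hB, hs]
  rw [decode, slots]
  simp only [List.flatMap_assoc, List.flatMap_cons, List.flatMap_nil, List.append_nil]
  change ((List.range L).flatMap fun m => (List.range L).flatMap fun i => (List.range 2).flatMap
    fun k => (List.range m).flatMap fun a => (List.range m).flatMap fun b =>
      (List.range m).flatMap fun c => B ⟨m, i, k, a, b, c⟩) = U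
  rw [flatMap_range_eq_single (i := m) (by omega)]
  · conv_rhs => rw [← flatMap_range_singleton U (L := L) (by omega)]
    refine List.flatMap_congr fun i _ => ?_
    split_ifs with hi
    · have hg : ∀ q ∈ U[i].qubits, q < m := hU.2 _ (List.getElem_mem hi)
      have hgw : U[i].WF := hU.1 _ (List.getElem_mem hi)
      set s := U[i].slot m i with hs
      have hsk : s.k < 2 ∧ s.a < m ∧ s.b < m ∧ s.c < m := by
        rw [hs]
        revert hg
        cases U[i] <;> simp [Gate.slot, Gate.qubits] <;> omega
      have hsm : s.m = m := slot_m _ _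
      have hsi : s.i = i := by rw [hs]; cases U[i] <;> rfl
      have hne : ∀ k a b c, k < 2 → a < m → b < m → c < m →
          (k ≠ s.k ∨ a ≠ s.a ∨ b ≠ s.b ∨ c ≠ s.c) → B ⟨m, i, k, a, b, c⟩ = [] := by
        intro k a b c hk ha hb hc h
        apply hB'
        rw [hon hk ha hb hc]
        rintro ⟨-, _, e⟩
        have e' : (⟨m, i, k, a, b, c⟩ : Slot) = s := e
        rw [← e'] at h
        simp at h
      rw [flatMap_range_eq_single hsk.1, flatMap_range_eq_single hsk.2.1,
        flatMap_range_eq_single hsk.2.2.1, flatMap_range_eq_single hsk.2.2.2]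
      · have e : (⟨m, i, s.k, s.a, s.b, s.c⟩ : Slot) = s := by
          rw [← hsm, ← hsi]
        rw [e, hB]
        simp only
        rw [if_pos, gate_slot hgw]
        rw [hon hsk.1 (by omega) (by omega) (by omega)]
        exact ⟨hsm, by omega, by simp only [hsi]; exact hs⟩
      · intro c hc h
        exact hne _ _ _ _ hsk.1 hsk.2.1 hsk.2.2.1 hc (by simp [h])
      · intro b hb h
        simp only [List.flatMap_eq_nil_iff, List.mem_range]
        exact fun c hc => hne _ _ _ _ hsk.1 hsk.2.1 hb hc (by simp [h])
      · intro a ha h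
        simp only [List.flatMap_eq_nil_iff, List.mem_range]
        exact fun b hb c hc => hne _ _ _ _ hsk.1 ha hb hc (by simp [h])
      · intro k hk h
        simp only [List.flatMap_eq_nil_iff, List.mem_range]
        exact fun a ha b hb c hc => hne _ _ _ _ hk ha hb hc (by simp [h])
    · simp only [List.flatMap_eq_nil_iff, List.mem_range]
      intro k hk a ha b hb c hc
      apply hB'
      rw [hon hk ha hb hc]
      rintro ⟨-, h, -⟩
      exact hi h
  · intro m' _ hm'
    simp only [List.flatMap_eq_nil_iff, List.mem_range]
    intro i _ k hk a ha b hb c hc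
    apply hB'
    rw [hon hk ha hb hc]
    rintro ⟨h, -⟩
    exact hm' h

end code

/-! ### The hypotheses of the learner on a random function -/

/-- By Hoeffding's inequality, a fixed circuit has a large agreement with few functions. -/
theorem card_agreement_ge {n : ℕ} {V : Circuit} (hV : V.WF) {G : ℝ} (hG : 0 ≤ G)
    (S : Finset (BoolFun n)) (hS : ∀ f ∈ S, 1 / 2 + G / 2 ^ n ≤ V.agreement f) :
    (S.card : ℝ) ≤ 2 ^ 2 ^ n * Real.exp (-(2 * G ^ 2 / 2 ^ n)) := by
  classical
  set N : ℝ := 2 ^ n with hN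
  have hN0 : 0 < N := by positivity
  set d : (Fin n → Bool) → ℝ := fun x => V.prob x true - 1 / 2 with hd
  set σ : Bool → ℝ := fun v => if v then 1 else -1 with hσ
  have hd2 : ∀ x, d x ^ 2 ≤ 1 / 4 := by
    intro x
    have h0 := V.prob_nonneg x true
    have h1 := Circuit.prob_le_one hV x true
    simp only [hd]
    nlinarith
  have hagr : ∀ f : BoolFun n, V.agreement f = 1 / 2 + (∑ x, σ (f x) * d x) / N := by
    intro f
    have e : ∀ x, V.prob x (f x) = 1 / 2 + σ (f x) * d x := by
      intro x
      have := prob_not hV x true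
      simp only [Bool.not_true] at this
      cases f x <;> simp [hσ, hd, this]
      ring
    rw [Circuit.agreement, Finset.sum_congr rfl fun x _ => e x, Finset.sum_add_distrib]
    simp only [Finset.sum_const, Finset.card_univ, Fintype.card_pi, Fintype.card_bool,
      Finset.prod_const, Fintype.card_fin, nsmul_eq_mul, Nat.cast_pow, Nat.cast_ofNat]
    rw [add_div, ← hN, mul_div_cancel_left₀ _ hN0.ne']
  -- the exponential moment method, with the optimal parameter
  set t : ℝ := 4 * G / N with ht
  have ht0 : 0 ≤ t := by positivity
  have hterm : ∀ f ∈ S, (1 : ℝ) ≤ Real.exp (-(t * G)) * ∏ x, Real.exp (t * (σ (f x) * d x)) := by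
    intro f hf
    have h := hS f hf
    rw [hagr, add_le_add_iff_left, div_le_div_iff_of_pos_right hN0] at h
    rw [← Real.exp_sum, ← Real.exp_add, ← Finset.mul_sum]
    apply Real.one_le_exp
    have := mul_le_mul_of_nonneg_left h ht0
    linarith
  have hprod : ∑ f : BoolFun n, ∏ x, Real.exp (t * (σ (f x) * d x)) ≤
      2 ^ 2 ^ n * Real.exp (N * (t ^ 2 / 8)) := by
    have e := Finset.prod_univ_sum (fun _ : Fin n → Bool => (Finset.univ : Finset Bool))
      (fun x v => Real.exp (t * (σ v * d x)))
    rw [Fintype.piFinset_univ] at e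
    rw [← e]
    have hx : ∀ x, ∑ v, Real.exp (t * (σ v * d x)) ≤ 2 * Real.exp (t ^ 2 / 8) := by
      intro x
      have h1 := Real.cosh_le_exp_half_sq (t * d x)
      have h2 : Real.exp ((t * d x) ^ 2 / 2) ≤ Real.exp (t ^ 2 / 8) := by
        apply Real.exp_le_exp.2
        have := mul_le_mul_of_nonneg_left (hd2 x) (sq_nonneg t)
        nlinarith
      rw [Real.cosh_eq] at h1
      rw [Fintype.sum_bool]
      simp only [hσ, if_true, Bool.false_eq_true, if_false, one_mul, neg_mul, mul_neg]
      linarith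
    refine (Finset.prod_le_prod (fun x _ => Finset.sum_nonneg fun v _ => (Real.exp_pos _).le)
      fun x _ => hx x).trans_eq ?_
    rw [Finset.prod_const, Finset.card_univ, Fintype.card_pi, mul_pow, ← Real.exp_nat_mul]
    simp [hN]
  calc (S.card : ℝ) = ∑ f ∈ S, (1 : ℝ) := by simp
    _ ≤ ∑ f ∈ S, Real.exp (-(t * G)) * ∏ x, Real.exp (t * (σ (f x) * d x)) :=
      Finset.sum_le_sum hterm
    _ ≤ ∑ f : BoolFun n, Real.exp (-(t * G)) * ∏ x, Real.exp (t * (σ (f x) * d x)) :=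
      Finset.sum_le_sum_of_subset_of_nonneg (Finset.subset_univ _) fun f _ _ =>
        mul_nonneg (Real.exp_pos _).le (Finset.prod_nonneg fun x _ => (Real.exp_pos _).le)
    _ = Real.exp (-(t * G)) * ∑ f : BoolFun n, ∏ x, Real.exp (t * (σ (f x) * d x)) := by
      rw [Finset.mul_sum]
    _ ≤ Real.exp (-(t * G)) * (2 ^ 2 ^ n * Real.exp (N * (t ^ 2 / 8))) :=
      mul_le_mul_of_nonneg_left hprod (Real.exp_pos _).le
    _ = 2 ^ 2 ^ n * Real.exp (-(2 * G ^ 2 / N)) := by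
      rw [mul_left_comm, ← Real.exp_add]
      congr 2
      rw [ht]
      field_simp
      ring

/-- A possible outcome of a learner is described by the set of the changed qubits that hold `1`, so
that there are few possible hypotheses, and most functions agree well with none of them. -/
theorem half_le_card {n : ℕ} (Q : OracleCircuit) (L : ℕ) {G : ℝ} (hG : 0 ≤ G)
    (hG2 : 2 ^ n * (Q.size + 2) ≤ 2 * G ^ 2) (S : Finset (BoolFun n))
    (hS : ∀ f, f ∉ S → ∃ z : Basis, (∀ q ∉ Q.targets, z q = false) ∧
      1 / 2 + G / 2 ^ n ≤ (decode L z).agreement f) :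
    (2 : ℝ) ^ 2 ^ n / 2 ≤ S.card := by
  classical
  set B : Finset ℕ → Finset (BoolFun n) := fun A => Finset.univ.filter fun f =>
    1 / 2 + G / 2 ^ n ≤ (decode L fun q => decide (q ∈ A)).agreement f with hB
  have hN0 : (0 : ℝ) < 2 ^ n := by positivity
  have hBcard : ∀ A, ((B A).card : ℝ) ≤ 2 ^ 2 ^ n * Real.exp (-(Q.size + 2)) := by
    intro A
    refine (card_agreement_ge (wf_decode _ _) hG (B A) fun f hf => (Finset.mem_filter.1 hf).2).trans
      (mul_le_mul_of_nonneg_left (Real.exp_le_exp.2 (neg_le_neg ?_)) (by positivity))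
    rw [le_div_iff₀ hN0]
    linarith
  have hcover : (Finset.univ : Finset (BoolFun n)) ⊆ S ∪ Q.targets.powerset.biUnion B := by
    intro f _
    by_cases hf : f ∈ S
    · exact Finset.mem_union_left _ hf
    · obtain ⟨z, hz, h⟩ := hS f hf
      refine Finset.mem_union_right _ (Finset.mem_biUnion.2 ⟨Q.targets.filter fun q => z q = true,
        Finset.mem_powerset.2 (Finset.filter_subset _ _), Finset.mem_filter.2
          ⟨Finset.mem_univ _, ?_⟩⟩)
      have e : (fun q => decide (q ∈ Q.targets.filter fun q => z q = true)) = z := by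
        funext q
        by_cases hq : q ∈ Q.targets
        · simp [hq]
        · simp [hq, hz q hq]
      rwa [e]
  have h1 : ((Q.targets.powerset.biUnion B).card : ℝ) ≤ 2 ^ 2 ^ n / 2 := by
    calc ((Q.targets.powerset.biUnion B).card : ℝ)
        ≤ ∑ A ∈ Q.targets.powerset, ((B A).card : ℝ) := by exact_mod_cast Finset.card_biUnion_le
      _ ≤ ∑ A ∈ Q.targets.powerset, 2 ^ 2 ^ n * Real.exp (-(Q.size + 2)) :=
        Finset.sum_le_sum fun A _ => hBcard A
      _ = 2 ^ Q.targets.card * (2 ^ 2 ^ n * Real.exp (-(Q.size + 2))) := by simp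
      _ ≤ 2 ^ Q.size * (2 ^ 2 ^ n * Real.exp (-(Q.size + 2))) := by
        gcongr
        · norm_num
        · exact Q.card_targets_le
      _ ≤ 2 ^ 2 ^ n / 2 := by
        have h2 : (2 : ℝ) ^ (Q.size + 1) ≤ Real.exp (Q.size + 2) := by
          have h3 : (2 : ℝ) ≤ Real.exp 1 := by
            have := Real.add_one_le_exp (1 : ℝ); linarith
          calc (2 : ℝ) ^ (Q.size + 1) ≤ Real.exp 1 ^ (Q.size + 1) := by gcongr
            _ = Real.exp (Q.size + 1) := by rw [← Real.exp_nat_mul]; simp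
            _ ≤ Real.exp (Q.size + 2) := Real.exp_le_exp.2 (by linarith)
        rw [Real.exp_neg, le_div_iff₀ (by norm_num)]
        have h4 := Real.exp_pos ((Q.size : ℝ) + 2)
        rw [pow_succ] at h2
        have h5 : (2 : ℝ) ^ Q.size * 2 * (Real.exp (Q.size + 2))⁻¹ ≤ 1 := by
          rw [← div_eq_mul_inv, div_le_one h4]; exact h2
        have h6 : (0 : ℝ) ≤ 2 ^ 2 ^ n := by positivity
        nlinarith [mul_le_mul_of_nonneg_left h5 h6]
  have h2 : (2 : ℝ) ^ 2 ^ n ≤ S.card + (Q.targets.powerset.biUnion B).card := by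
    have h3 := (Finset.card_le_card hcover).trans (Finset.card_union_le _ _)
    rw [Finset.card_univ] at h3
    have h4 : Fintype.card (BoolFun n) = 2 ^ 2 ^ n := by simp
    rw [h4] at h3
    exact_mod_cast h3
  linarith

/-- Every Boolean function is determined by its truth table. -/
theorem tt_injective {n : ℕ} : Function.Injective (tt (n := n)) := by
  intro f f' h
  funext x
  obtain ⟨y, hy⟩ : ∃ y : Fin (2 ^ n), ∀ j : Fin n, y.val.testBit j = x j := by
    refine ⟨⟨Nat.ofBits x, Nat.ofBits_lt_two_pow x⟩, fun j => ?_⟩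
    simp
  have := congrFun h y
  simp only [tt] at this
  rwa [show (fun j : Fin n => y.val.testBit j) = x from funext hy] at this

/-! ### The acceptance probability of the tester -/

section passProb

variable {n : ℕ} {f : BoolFun n} {L θ M : ℕ} {z : Basis} {a : ℝ}

theorem agreement_mem (f : BoolFun n) (L : ℕ) (z : Basis) :
    0 ≤ 1 - (decode L z).agreement f ∧ 1 - (decode L z).agreement f ≤ 1 := by
  have h0 := (decode L z).agreement_nonneg f
  have h1 := Circuit.agreement_le_one (wf_decode L z) f
  constructor <;> linarith

theorem variance_le (M : ℕ) (μ : ℝ) (ha : 0 < a) :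
    (a ^ 2)⁻¹ * binExp μ (fun c => ((c : ℝ) - M * μ) ^ 2) M 0 ≤ M / (4 * a ^ 2) := by
  rw [binExp_sq]
  have : μ * (1 - μ) ≤ 1 / 4 := by nlinarith [sq_nonneg (μ - 1 / 2)]
  have := mul_le_mul_of_nonneg_left this (Nat.cast_nonneg (α := ℝ) M)
  rw [inv_mul_eq_div, div_le_div_iff₀ (by positivity) (by positivity)]
  push_cast
  nlinarith [sq_nonneg a]

/-- Chebyshev's inequality. -/
theorem passProb_le (ha : 0 < a) (h : M * (1 - (decode L z).agreement f) + a ≤ θ) :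
    passProb f L θ M z ≤ M / (4 * a ^ 2) := by
  obtain ⟨h0, h1⟩ := agreement_mem f L z
  refine le_trans ?_ (variance_le M (1 - (decode L z).agreement f) ha)
  rw [passProb, ← binExp_const_mul]
  refine binExp_mono h0 h1 (fun c => ?_) _ _
  split_ifs with hc
  · have hc' : (θ : ℝ) ≤ c := by exact_mod_cast hc
    rw [inv_mul_eq_div, one_le_div (by positivity)]
    apply pow_le_pow_left₀ ha.le
    linarith
  · positivity

/-- Chebyshev's inequality. -/
theorem le_passProb (ha : 0 < a) (h : θ + a ≤ M * (1 - (decode L z).agreement f)) :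
    1 - M / (4 * a ^ 2) ≤ passProb f L θ M z := by
  obtain ⟨h0, h1⟩ := agreement_mem f L z
  have hv := variance_le M (1 - (decode L z).agreement f) ha
  set μ := 1 - (decode L z).agreement f
  have key : binExp μ (fun c => 1 - (a ^ 2)⁻¹ * ((c : ℝ) - M * μ) ^ 2) M 0 ≤
      passProb f L θ M z := by
    refine binExp_mono h0 h1 (fun c => ?_) _ _
    split_ifs with hc
    · have : 0 ≤ (a ^ 2)⁻¹ * ((c : ℝ) - M * μ) ^ 2 := by positivity
      linarith
    · have hc' : (c : ℝ) ≤ θ := by exact_mod_cast (not_le.1 hc).le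
      rw [sub_nonpos, inv_mul_eq_div, one_le_div (by positivity), ← neg_sq ((c : ℝ) - M * μ)]
      apply pow_le_pow_left₀ ha.le
      linarith
  have e : ∀ m c (F : ℕ → ℝ), binExp μ (fun c => 1 - F c) m c = 1 - binExp μ F m c := by
    intro m
    induction m with
    | zero => intro c F; rfl
    | succ m ih => intro c F; simp only [binExp, ih]; ring
  rw [e, binExp_const_mul] at key
  linarith

end passProb

/-- The threshold on the number of disagreements in a round of `400 * 2 ^ n` samples. -/
def threshold (N G : ℕ) : ℕ := 200 * N - 800 * G

section correctness

variable {n : ℕ} {f : BoolFun n} {Q : OracleCircuit} {γ : ℝ} {G : ℕ}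

/-- The tester made from the learner `Q`, with the concrete parameters. -/
def naturalTester (n : ℕ) (Q : OracleCircuit) (G : ℕ) : Circuit :=
  tester (2 ^ n) n Q.tokens Q.outLen (threshold (2 ^ n) G) (400 * 2 ^ n) 200 8

/-- `G / 2 ^ n` is about the largest advantage that hypotheses have on a random function. -/
structure IsGap (n s G : ℕ) : Prop where
  le : 2 ^ n * (s + 2) ≤ 2 * G ^ 2
  lt : 2 * (G - 1) ^ 2 < 2 ^ n * (s + 2)

theorem IsGap.three_mul_le (hG : IsGap n Q.size G) (hγ0 : 0 ≤ γ)
    (hγ : 50 * (Q.size : ℝ) + 5000 ≤ γ ^ 2 * 2 ^ n) : 3 * (G : ℝ) ≤ γ * 2 ^ n := by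
  have h1 : (1 : ℝ) ≤ 2 ^ n := one_le_pow₀ (by norm_num)
  have hlt : 2 * ((G : ℝ) - 1) ^ 2 ≤ 2 ^ n * (Q.size + 2) := by
    rcases Nat.eq_zero_or_pos G with rfl | hpos
    · push_cast
      nlinarith [Nat.cast_nonneg (α := ℝ) Q.size]
    · have := hG.lt.le
      have e : ((G - 1 : ℕ) : ℝ) = (G : ℝ) - 1 := by push_cast [hpos]; ring
      rw [← e]
      exact_mod_cast this
  have hsq : (3 * (G : ℝ)) ^ 2 ≤ (γ * 2 ^ n) ^ 2 := by
    have h2 := mul_le_mul_of_nonneg_left hγ (zero_le_one.trans h1)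
    nlinarith [sq_nonneg ((G : ℝ) - 2)]
  exact le_of_sq_le_sq hsq (by positivity)

theorem IsGap.pow_le_sq (hG : IsGap n Q.size G) : (2 : ℝ) ^ n ≤ (G : ℝ) ^ 2 := by
  have : ((2 ^ n * (Q.size + 2) : ℕ) : ℝ) ≤ ((2 * G ^ 2 : ℕ) : ℝ) := by exact_mod_cast hG.le
  push_cast at this
  have h2 : (0 : ℝ) < 2 ^ n := by positivity
  nlinarith [Nat.cast_nonneg (α := ℝ) Q.size]

theorem IsGap.failure_le (hG : IsGap n Q.size G) :
    ((400 * 2 ^ n : ℕ) : ℝ) / (4 * (400 * (G : ℝ)) ^ 2) ≤ 1 / 1600 := by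
  have h := hG.pow_le_sq
  have h2 : (0 : ℝ) < 2 ^ n := by positivity
  rw [div_le_div_iff₀ (by nlinarith) (by norm_num)]
  push_cast
  nlinarith

theorem IsGap.pos (hG : IsGap n Q.size G) : (0 : ℝ) < G := by
  have h := hG.pow_le_sq
  have h2 : (0 : ℝ) < 2 ^ n := by positivity
  rcases Nat.eq_zero_or_pos G with rfl | hpos
  · norm_num at h; linarith
  · exact_mod_cast hpos

theorem cast_threshold (hG : IsGap n Q.size G) (hγ0 : 0 ≤ γ) (hγ1 : γ ≤ 1 / 2)
    (hγ : 50 * (Q.size : ℝ) + 5000 ≤ γ ^ 2 * 2 ^ n) :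
    (threshold (2 ^ n) G : ℝ) = 200 * 2 ^ n - 800 * G := by
  have h := hG.three_mul_le hγ0 hγ
  have h2 : (0 : ℝ) < 2 ^ n := by positivity
  have h3 : 800 * (G : ℝ) ≤ 200 * 2 ^ n := by nlinarith
  have h4 : 800 * G ≤ 200 * 2 ^ n := by exact_mod_cast h3
  rw [threshold, Nat.cast_sub h4]
  push_cast
  ring

/-- Functions with which no possible hypothesis agrees well are accepted. -/
theorem accept (hQ : Q.WF n) (hG : IsGap n Q.size G) (hγ0 : 0 ≤ γ) (hγ1 : γ ≤ 1 / 2)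
    (hγ : 50 * (Q.size : ℝ) + 5000 ≤ γ ^ 2 * 2 ^ n)
    (hf : ∀ z : Basis, (∀ q ∉ Q.targets, z q = false) →
      (decode Q.outLen z).agreement f < 1 / 2 + G / 2 ^ n) :
    2 / 3 ≤ (naturalTester n Q G).prob (tt f) true := by
  have h2 : (0 : ℝ) < 2 ^ n := by positivity
  have hp : 1 - 1 / 1600 ≤
      Q.outcomeExp f (passProb f Q.outLen (threshold (2 ^ n) G) (400 * 2 ^ n)) := by
    rw [← outcomeExp_const hQ f (1 - 1 / 1600)]
    refine outcomeExp_mono hQ f fun z hz => ?_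
    have hpass := le_passProb (f := f) (L := Q.outLen) (z := z) (θ := threshold (2 ^ n) G)
      (M := 400 * 2 ^ n) (a := 400 * G) (mul_pos (by norm_num) hG.pos) ?_
    · linarith [hG.failure_le]
    · rw [cast_threshold hG hγ0 hγ1 hγ]
      have h := mul_lt_mul_of_pos_left (hf z hz) h2
      rw [mul_add, mul_div_cancel₀ _ h2.ne'] at h
      push_cast
      linarith
  have hpow : 7 / 8 ≤
      Q.outcomeExp f (passProb f Q.outLen (threshold (2 ^ n) G) (400 * 2 ^ n)) ^ 200 := by
    have h := one_add_mul_le_pow (a := -(1 / 1600 : ℝ)) (by norm_num) 200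
    have h' := pow_le_pow_left₀ (by norm_num) hp 200
    refine le_trans ?_ (h.trans (le_of_eq_of_le ?_ h'))
    · norm_num
    · ring
  have h := (prob_tester (L := Q.outLen) (θ := threshold (2 ^ n) G) (M := 400 * 2 ^ n) (R := 200)
    (J := 8) hQ f).2
  refine le_trans ?_ h
  nlinarith

/-- Functions that are learned are rejected. -/
theorem reject (hQ : Q.WF n) (hG : IsGap n Q.size G) (hγ0 : 0 ≤ γ) (hγ1 : γ ≤ 1 / 2)
    (hγ : 50 * (Q.size : ℝ) + 5000 ≤ γ ^ 2 * 2 ^ n) {ε : ℝ} (hε : ε ≤ 1 / 2 - γ)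
    (hf : 1 / 100 ≤ Q.outputProb f {z | IsGoodHypothesis f ε z}) :
    (naturalTester n Q G).prob (tt f) true ≤ 1 / 3 := by
  classical
  have h2 : (0 : ℝ) < 2 ^ n := by positivity
  set E : Set Basis := {b | (List.range Q.outLen).map b ∈ {z | IsGoodHypothesis f ε z}} with hE
  rw [outputProb_eq] at hf
  have hp : Q.outcomeExp f (passProb f Q.outLen (threshold (2 ^ n) G) (400 * 2 ^ n)) ≤
      1 + (-(1599 / 1600)) * Q.outcomeExp f (E.indicator 1) := by
    rw [← outcomeExp_const_mul hQ]
    conv_rhs => rw [← outcomeExp_const hQ f 1]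
    rw [← outcomeExp_add hQ]
    refine outcomeExp_mono hQ f fun z _ => ?_
    by_cases hz : z ∈ E
    · obtain ⟨m, U, -, hU, hcode, hagr⟩ := id hz
      have hpass := passProb_le (f := f) (L := Q.outLen) (z := z) (θ := threshold (2 ^ n) G)
        (M := 400 * 2 ^ n) (a := 400 * G) (mul_pos (by norm_num) hG.pos) ?_
      · have := hG.failure_le
        rw [Set.indicator_of_mem hz, Pi.one_apply]
        linarith
      · rw [cast_threshold hG hγ0 hγ1 hγ, decode_eq hU hcode]
        have h := hG.three_mul_le hγ0 hγ
        have h' : (1 / 2 + γ) * 2 ^ n ≤ U.agreement f * 2 ^ n :=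
          mul_le_mul_of_nonneg_right (by linarith) h2.le
        push_cast
        linarith
    · rw [Set.indicator_of_notMem hz, mul_zero, add_zero]
      obtain ⟨h0, h1⟩ := agreement_mem f Q.outLen z
      refine (binExp_mono h0 h1 (G' := fun _ => 1) (fun c => ?_) _ _).trans_eq
        (binExp_const _ _ _ _)
      split_ifs <;> norm_num
  have hp' : Q.outcomeExp f (passProb f Q.outLen (threshold (2 ^ n) G) (400 * 2 ^ n)) ≤
      9901 / 10000 := by linarith
  have hp0 : 0 ≤ Q.outcomeExp f (passProb f Q.outLen (threshold (2 ^ n) G) (400 * 2 ^ n)) := by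
    rw [← outcomeExp_const hQ f 0]
    exact outcomeExp_mono hQ f fun z _ => passProb_nonneg _ _ _ _ _
  have h := (prob_tester (L := Q.outLen) (θ := threshold (2 ^ n) G) (M := 400 * 2 ^ n) (R := 200)
    (J := 8) hQ f).1
  have h' := pow_le_pow_left₀ hp0 hp' 200
  refine h.trans ((add_le_add_left h' _).trans ?_)
  norm_num

/-- A function that is learned agrees well with a possible hypothesis. -/
theorem exists_hypothesis (hQ : Q.WF n) {ε : ℝ}
    (hf : 1 / 100 ≤ Q.outputProb f {z | IsGoodHypothesis f ε z}) :
    ∃ z : Basis, (∀ q ∉ Q.targets, z q = false) ∧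
      1 - ε ≤ (decode Q.outLen z).agreement f := by
  classical
  by_contra! hc
  rw [outputProb_eq] at hf
  have h : Q.outcomeExp f (Set.indicator {b | (List.range Q.outLen).map b ∈
      {z | IsGoodHypothesis f ε z}} 1) ≤ 0 := by
    rw [← outcomeExp_const hQ f 0]
    refine outcomeExp_mono hQ f fun z hz => le_of_eq (Set.indicator_of_notMem ?_ _)
    rintro ⟨m, U, -, hU, hcode, hagr⟩
    have := hc z hz
    rw [decode_eq hU hcode] at this
    linarith
  linarith

/-- The tester is correct if the learner is. -/
theorem naturalTester_correct {C : Set (BoolFun n)} (hQ : Q.WF n) (hG : IsGap n Q.size G)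
    (hγ0 : 0 ≤ γ) (hγ1 : γ ≤ 1 / 2) (hγ : 50 * (Q.size : ℝ) + 5000 ≤ γ ^ 2 * 2 ^ n) {ε : ℝ}
    (hε : ε ≤ 1 / 2 - γ)
    (hC : ∀ f ∈ C, 1 / 100 ≤ Q.outputProb f {z | IsGoodHypothesis f ε z}) :
    (∀ f ∈ C, (naturalTester n Q G).prob (tt f) true ≤ 1 / 3) ∧
    ∃ Γ : Finset (Fin (2 ^ n) → Bool), (1 / 2 : ℝ) ≤ (Γ.card : ℝ) / 2 ^ (2 ^ n) ∧
      ∀ w ∈ Γ, (∀ f : BoolFun n, tt f = w → f ∉ C) ∧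
        2 / 3 ≤ (naturalTester n Q G).prob w true := by
  classical
  refine ⟨fun f hf => reject hQ hG hγ0 hγ1 hγ hε (hC f hf), ?_⟩
  set S : Finset (BoolFun n) := Finset.univ.filter fun f =>
    ∀ z : Basis, (∀ q ∉ Q.targets, z q = false) →
      (decode Q.outLen z).agreement f < 1 / 2 + G / 2 ^ n with hS
  have hcard := half_le_card Q Q.outLen (G := G) (Nat.cast_nonneg _) (by exact_mod_cast hG.le) S
    fun f hf => by
      simp only [hS, Finset.mem_filter, Finset.mem_univ, true_and] at hf
      push Not at hf
      exact hf
  have hinj : Function.Injective (tt (n := n)) := tt_injective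
  refine ⟨S.image tt, ?_, fun w hw => ?_⟩
  · rw [Finset.card_image_of_injective _ hinj, le_div_iff₀ (by positivity)]
    linarith
  · obtain ⟨f, hf, rfl⟩ := Finset.mem_image.1 hw
    have hf' := (Finset.mem_filter.1 hf).2
    refine ⟨fun f' e hf'' => ?_, accept hQ hG hγ0 hγ1 hγ hf'⟩
    rw [hinj e] at hf''
    obtain ⟨z, hz, h⟩ := exists_hypothesis hQ (hC f hf'')
    have h1 := hf' z hz
    have h2 : (0 : ℝ) < 2 ^ n := by positivity
    have h3 : (G : ℝ) / 2 ^ n ≤ γ := by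
      rw [div_le_iff₀ h2]
      have := hG.three_mul_le hγ0 hγ
      nlinarith [hG.pos]
    linarith

end correctness

/-! ### Running times -/

/-- Started with memory `m`, the program halts with memory `m'` within `B` steps. -/
def Prog.Run (p : Prog) (m m' : Mem) (B : ℕ) : Prop := ∃ t ≤ B, p.Runs m m' t

/-- `f` is bounded by a polynomial in `S`. -/
def PolyB {α : Type*} (S f : α → ℕ) : Prop := ∃ k, ∀ a, f a ≤ (S a + 2) ^ k

namespace PolyB

variable {α : Type*} {S f g : α → ℕ}

theorem mono (hg : PolyB S g) (h : ∀ a, f a ≤ g a) : PolyB S f := by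
  obtain ⟨k, hk⟩ := hg
  exact ⟨k, fun a => (h a).trans (hk a)⟩

theorem const (c : ℕ) : PolyB S fun _ => c :=
  ⟨c, fun a => (Nat.lt_two_pow_self).le.trans (Nat.pow_le_pow_left (by omega) c)⟩

theorem self : PolyB S S := ⟨1, fun a => by rw [pow_one]; omega⟩

theorem mul (hf : PolyB S f) (hg : PolyB S g) : PolyB S fun a => f a * g a := by
  obtain ⟨k, hk⟩ := hf
  obtain ⟨l, hl⟩ := hg
  exact ⟨k + l, fun a => by rw [pow_add]; exact Nat.mul_le_mul (hk a) (hl a)⟩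

theorem add (hf : PolyB S f) (hg : PolyB S g) : PolyB S fun a => f a + g a := by
  obtain ⟨k, hk⟩ := hf
  obtain ⟨l, hl⟩ := hg
  refine ⟨k + l + 1, fun a => ?_⟩
  have h1 := (hk a).trans (Nat.pow_le_pow_right (show 0 < S a + 2 by omega) (Nat.le_add_right k l))
  have h2 := (hl a).trans (Nat.pow_le_pow_right (show 0 < S a + 2 by omega) (Nat.le_add_left l k))
  rw [pow_succ]
  nlinarith [Nat.zero_le ((S a + 2) ^ (k + l) * S a)]

theorem pow (hf : PolyB S f) (c : ℕ) : PolyB S fun a => f a ^ c := by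
  obtain ⟨k, hk⟩ := hf
  exact ⟨k * c, fun a => by rw [pow_mul]; exact Nat.pow_le_pow_left (hk a) c⟩

theorem trans {S' : α → ℕ} (hf : PolyB S' f) (hS : PolyB S S') : PolyB S f := by
  obtain ⟨k, hk⟩ := hf
  exact ((hS.add (const 2)).pow k).mono hk

theorem comp {β : Type*} (hf : PolyB S f) (h : β → α) : PolyB (fun b => S (h b)) fun b => f (h b) := by
  obtain ⟨k, hk⟩ := hf
  exact ⟨k, fun b => hk (h b)⟩

end PolyB

namespace Prog

variable {p q p0 p1 pe : Prog} {m m' m₁ m₂ m₃ : Mem} {B B' : ℕ} {r d e : ℕ}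

theorem Run.mono (h : p.Run m m' B) (hB : B ≤ B') : p.Run m m' B' := by
  obtain ⟨t, ht, hr⟩ := h
  exact ⟨t, ht.trans hB, hr⟩

theorem Run.of_eq (h : p.Run m m₁ B) (e : m₁ = m') : p.Run m m' B := e ▸ h

theorem run_skip (m : Mem) : skip.Run m m 1 := ⟨1, le_rfl, .skip m⟩

theorem run_push (r : ℕ) (v : Bool) (m : Mem) :
    (push r v).Run m (Function.update m r (v :: m r)) 1 := ⟨1, le_rfl, .push r v m⟩

theorem run_pop (r : ℕ) (m : Mem) :
    (pop r).Run m (Function.update m r (m r).tail) 1 := ⟨1, le_rfl, .pop r m⟩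

theorem Run.seq (h : p.Run m₁ m₂ B) (h' : q.Run m₂ m₃ B') : (p.seq q).Run m₁ m₃ (B + B') := by
  obtain ⟨t, ht, hr⟩ := h
  obtain ⟨t', ht', hr'⟩ := h'
  exact ⟨t + t', by omega, .seq hr hr'⟩

theorem Run.branch_nil (hm : m r = []) (h : pe.Run m m' B) :
    (branch r pe p0 p1).Run m m' (B + 1) := by
  obtain ⟨t, ht, hr⟩ := h
  exact ⟨t + 1, by omega, .branchEmpty (by simp [hm]) hr⟩

theorem Run.branch_false {l : List Bool} (hm : m r = false :: l) (h : p0.Run m m' B) :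
    (branch r pe p0 p1).Run m m' (B + 1) := by
  obtain ⟨t, ht, hr⟩ := h
  exact ⟨t + 1, by omega, .branchZero (by simp [hm]) hr⟩

theorem Run.branch_true {l : List Bool} (hm : m r = true :: l) (h : p1.Run m m' B) :
    (branch r pe p0 p1).Run m m' (B + 1) := by
  obtain ⟨t, ht, hr⟩ := h
  exact ⟨t + 1, by omega, .branchOne (by simp [hm]) hr⟩

theorem run_loop_done (hm : m r = []) : (loop r p).Run m m 1 := ⟨1, le_rfl, .loopDone hm⟩

theorem Run.loop_step (hm : m₁ r ≠ []) (h : p.Run m₁ m₂ B) (h' : (loop r p).Run m₂ m₃ B') :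
    (loop r p).Run m₁ m₃ (B + B' + 1) := by
  obtain ⟨t, ht, hr⟩ := h
  obtain ⟨t', ht', hr'⟩ := h'
  exact ⟨t + t' + 1, by omega, .loopStep hm hr hr'⟩

/-- A loop that runs through the memories `s 0, …, s n`. -/
theorem run_loop (s : ℕ → Mem) (n : ℕ) (h1 : ∀ i < n, s i r ≠ [])
    (h2 : ∀ i < n, p.Run (s i) (s (i + 1)) B) (h3 : s n r = []) :
    (loop r p).Run (s 0) (s n) (n * (B + 1) + 1) := by
  have aux : ∀ k ≤ n, (loop r p).Run (s (n - k)) (s n) (k * (B + 1) + 1) := by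
    intro k
    induction k with
    | zero => intro _; simpa using run_loop_done h3
    | succ k ih =>
      intro hk
      have e : n - (k + 1) + 1 = n - k := by omega
      have h := h2 (n - (k + 1)) (by omega)
      rw [e] at h
      exact (Run.loop_step (h1 _ (by omega)) h (ih (by omega))).mono (by ring_nf; omega)
  simpa using aux n le_rfl

/-- Empties a register. -/
def clear (r : ℕ) : Prog := loop r (pop r)

theorem run_clear (r : ℕ) (m : Mem) :
    (clear r).Run m (Function.update m r []) (2 * (m r).length + 1) := by
  have h := run_loop (p := pop r) (r := r) (B := 1)
    (fun i => Function.update m r ((m r).drop i)) (m r).length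
    (fun i hi => by simpa using hi)
    (fun i hi => (run_pop r _).of_eq (by simp)) (by simp)
  simp only [List.drop_zero, Function.update_eq_self, List.drop_length] at h
  exact h.mono (by omega)

/-- Moves the contents of register `r` to the top of register `d`, which reverses it. -/
def move (r d : ℕ) : Prog :=
  loop r (branch r skip ((pop r).seq (push d false)) ((pop r).seq (push d true)))

theorem run_move (hrd : r ≠ d) (m : Mem) :
    (move r d).Run m (Function.update (Function.update m r []) d ((m r).reverse ++ m d))
      (4 * (m r).length + 1) := by
  have h := run_loop (p := branch r skip ((pop r).seq (push d false)) ((pop r).seq (push d true)))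
    (r := r) (B := 3) (fun i => Function.update (Function.update m r ((m r).drop i)) d
      (((m r).take i).reverse ++ m d)) (m r).length
    (fun i hi => by simpa [hrd] using hi) (fun i hi => ?_) (by simp [hrd])
  · simp only [List.drop_zero, Function.update_eq_self, List.drop_length, List.take_zero,
      List.reverse_nil, List.nil_append, List.take_length] at h
    exact h.mono (by omega)
  · have e : (m r).drop i = (m r)[i] :: (m r).drop (i + 1) := List.drop_eq_getElem_cons hi
    have e' : ((m r).take (i + 1)).reverse = (m r)[i] :: ((m r).take i).reverse := by
      rw [List.take_succ_eq_append_getElem hi]; simp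
    generalize (m r)[i] = v at e e'
    have hstep : ((pop r).seq (push d v)).Run (Function.update (Function.update m r ((m r).drop i)) d
        (((m r).take i).reverse ++ m d)) (Function.update (Function.update m r ((m r).drop (i + 1)))
        d (((m r).take (i + 1)).reverse ++ m d)) 2 := by
      refine ((run_pop r _).seq (run_push d v _)).of_eq ?_
      rw [e']
      funext x
      by_cases h1 : x = d
      · subst h1; simp [hrd.symm]
      · by_cases h2 : x = r
        · subst h2; simp [h1]
        · simp [h1, h2]
    cases v
    · exact Run.branch_false (l := (m r).drop (i + 1)) (by simp [hrd, e]) hstep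
    · exact Run.branch_true (l := (m r).drop (i + 1)) (by simp [hrd, e]) hstep

/-- Adds a copy of the number in register `r` to register `d`, with the help of register `e`. -/
def copy (r d e : ℕ) : Prog :=
  (loop r ((pop r).seq ((push d true).seq (push e true)))).seq (move e r)

theorem run_copy (hrd : r ≠ d) (hre : r ≠ e) (hde : d ≠ e) {m : Mem} {k : ℕ}
    (hr : m r = List.replicate k true) (he : m e = []) :
    (copy r d e).Run m (Function.update m d (List.replicate k true ++ m d)) (8 * k + 2) := by
  have h := run_loop (p := (pop r).seq ((push d true).seq (push e true))) (r := r) (B := 3)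
    (fun i => Function.update (Function.update (Function.update m r (List.replicate (k - i) true)) d
      (List.replicate i true ++ m d)) e (List.replicate i true)) k
    (fun i hi => by simp [hrd, hre]; omega) (fun i hi => ?_) (by simp [hrd, hre])
  · have h0 : Function.update (Function.update (Function.update m r (List.replicate (k - 0) true)) d
        (List.replicate 0 true ++ m d)) e (List.replicate 0 true) = m := by
      rw [Nat.sub_zero, ← hr, Function.update_eq_self, List.replicate_zero, List.nil_append,
        Function.update_eq_self, ← he, Function.update_eq_self]
    rw [h0] at h
    refine ((h.seq (run_move hre.symm _)).of_eq ?_).mono ?_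
    · funext x
      by_cases h1 : x = r
      · subst h1; simp [hrd, hre, hr]
      · by_cases h2 : x = e
        · subst h2; simp [h1, he, hde.symm]
        · by_cases h3 : x = d
          · subst h3; simp [h1, h2]
          · simp [h1, h2, h3]
    · simp; omega
  · refine ((run_pop r _).seq ((run_push d true _).seq (run_push e true _))).of_eq ?_
    have e1 : k - (i + 1) = k - i - 1 := by omega
    funext x
    by_cases h1 : x = r
    · subst h1; simp [hrd, hre, e1]
    · by_cases h2 : x = e
      · subst h2; simp [h1, hde.symm, List.replicate_succ]
      · by_cases h3 : x = d
        · subst h3; simp [h1, h2, List.replicate_succ]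
        · simp [h1, h2, h3]

/-- Pushes `k` ones. -/
def pushes (d : ℕ) : ℕ → Prog
  | 0 => skip
  | k + 1 => (pushes d k).seq (push d true)

theorem run_pushes (d k : ℕ) (m : Mem) :
    (pushes d k).Run m (Function.update m d (List.replicate k true ++ m d)) (k + 1) := by
  induction k with
  | zero => simpa [pushes] using run_skip m
  | succ k ih =>
    refine ((ih.seq (run_push d true _)).of_eq ?_).mono (by omega)
    simp [List.replicate_succ]

end Prog

/-! ### Numbers and lists computed in polynomial time -/

/-- The situation in which an expression with parameter `a` is evaluated.  Register `0` holds a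
table of numbers, register `1` collects the output, and the other registers below `base` may hold
values that depend on `a`. -/
structure Ctx (α : Type) where
  base : ℕ
  two_le : 2 ≤ base
  Inv : α → Mem → Prop
  tbl : α → List ℕ
  /-- The quantity in which running times have to be polynomial. -/
  size : α → ℕ
  congr : ∀ {a m m'}, Inv a m → (∀ r < base, r ≠ 1 → m' r = m r) → Inv a m'
  table : ∀ {a m}, Inv a m → m 0 = unary (tbl a)
  length_le : ∀ a, (unary (tbl a)).length ≤ size a

namespace Ctx

variable {α : Type} (c : Ctx α)

/-- A further parameter, held in unary by register `D`. -/
def push (D : ℕ) (hD : c.base ≤ D) : Ctx (α × ℕ) where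
  base := D + 1
  two_le := by have := c.two_le; omega
  Inv a m := c.Inv a.1 m ∧ m D = List.replicate a.2 true
  tbl a := c.tbl a.1
  size a := c.size a.1 + a.2
  congr := fun ⟨h, h'⟩ hm => by
    have := c.two_le
    exact ⟨c.congr h fun r hr => hm r (by omega), by rw [hm D (by omega) (by omega), h']⟩
  table h := c.table h.1
  length_le a := (c.length_le a.1).trans (Nat.le_add_right _ _)

variable {c}

theorem Inv.update {a : α} {m : Mem} (h : c.Inv a m) {r : ℕ} (hr : r = 1 ∨ c.base ≤ r)
    (l : List Bool) : c.Inv a (Function.update m r l) :=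
  c.congr h fun r' h1 h2 => Function.update_of_ne (by omega) _ _

end Ctx

theorem PolyB.exists_bound {α : Type} {S f : α → ℕ} {t : α × ℕ → ℕ}
    (ht : PolyB (fun p => S p.1 + p.2) t) (hf : PolyB S f) :
    ∃ B, PolyB S B ∧ ∀ a, ∀ x ≤ f a, t (a, x) ≤ B a := by
  obtain ⟨k, hk⟩ := ht
  refine ⟨fun a => (S a + f a + 2) ^ k, ((PolyB.self.add hf).add (PolyB.const 2)).pow k,
    fun a x hx => (hk (a, x)).trans (Nat.pow_le_pow_left ?_ k)⟩
  simp only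
  omega

/-- `f` is computed in polynomial time: for every register `D` from which on all registers are
empty, some program writes `f a` to the register `D` and changes nothing else. -/
def NumE {α : Type} (c : Ctx α) (f : α → ℕ) : Prop :=
  PolyB c.size f ∧ ∀ D ≥ c.base, ∃ (p : Prog) (t : α → ℕ), PolyB c.size t ∧
    ∀ a m, c.Inv a m → (∀ r ≥ D, m r = []) →
      p.Run m (Function.update m D (List.replicate (f a) true)) (t a)

/-- The property `P` is decided in polynomial time. -/
def CondE {α : Type} (c : Ctx α) (P : α → Prop) : Prop :=
  ∃ f, NumE c f ∧ ∀ a, P a ↔ f a = 0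

/-- The list `f` is printed in polynomial time. -/
def PrintE {α : Type} (c : Ctx α) (f : α → List ℕ) : Prop :=
  ∀ D ≥ c.base, ∃ (p : Prog) (t : α → ℕ), PolyB c.size t ∧
    ∀ a m, c.Inv a m → (∀ r ≥ D, m r = []) →
      p.Run m (Function.update m 1 ((unary (f a)).reverse ++ m 1)) (t a)

namespace NumE

variable {α : Type} {c : Ctx α} {f g h : α → ℕ}

theorem congr (hf : NumE c f) (e : ∀ a, f a = g a) : NumE c g := by
  rwa [← funext e]

theorem weaken {D : ℕ} {hD : c.base ≤ D} (hf : NumE c f) :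
    NumE (c.push D hD) fun a => f a.1 := by
  refine ⟨(hf.1.comp Prod.fst).trans (PolyB.self.mono fun a => Nat.le_add_right _ _), fun D' hD' => ?_⟩
  obtain ⟨p, t, ht, hp⟩ := hf.2 D' (by have : D + 1 ≤ D' := hD'; omega)
  exact ⟨p, fun a => t a.1, (ht.comp Prod.fst).trans (PolyB.self.mono fun a => Nat.le_add_right _ _),
    fun a m ha hm => hp a.1 m ha.1 hm⟩

/-- The number in a register is computed by copying it. -/
theorem of_register {r : ℕ} (hr : r < c.base) (hf : ∀ a m, c.Inv a m → m r = List.replicate (f a) true)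
    (hs : ∀ a, f a ≤ c.size a) : NumE c f := by
  refine ⟨PolyB.self.mono hs, fun D hD => ⟨Prog.copy r D (D + 1), fun a => 8 * f a + 2,
    (((PolyB.const 8).mul (PolyB.self.mono hs)).add (PolyB.const 2)), fun a m ha hm => ?_⟩⟩
  refine (Prog.run_copy (by omega) (by omega) (by omega) (hf a m ha) (hm _ (by omega))).of_eq ?_
  rw [hm D le_rfl, List.append_nil]

theorem var {D : ℕ} {hD : c.base ≤ D} : NumE (c.push D hD) Prod.snd :=
  of_register (r := D) (Nat.lt_succ_self D) (fun _ _ ha => ha.2) fun _ => Nat.le_add_left _ _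

theorem const (k : ℕ) : NumE c fun _ => k := by
  refine ⟨PolyB.const k, fun D hD => ⟨Prog.pushes D k, fun _ => k + 1, PolyB.const _,
    fun a m _ hm => ?_⟩⟩
  refine (Prog.run_pushes D k m).of_eq ?_
  rw [hm D le_rfl, List.append_nil]

/-- Evaluating two expressions into consecutive registers. -/
theorem pair_run (hf : NumE c f) (hg : NumE c g) (D : ℕ) (hD : c.base ≤ D) :
    ∃ (p : Prog) (t : α → ℕ), PolyB c.size t ∧ ∀ a m, c.Inv a m → (∀ r ≥ D, m r = []) →
      p.Run m (Function.update (Function.update m D (List.replicate (f a) true)) (D + 1)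
        (List.replicate (g a) true)) (t a) := by
  obtain ⟨p, t, ht, hp⟩ := hf.2 D hD
  obtain ⟨q, s, hs, hq⟩ := hg.2 (D + 1) (by omega)
  refine ⟨p.seq q, _, ht.add hs, fun a m ha hm => (hp a m ha hm).seq (hq a _ (ha.update (by omega) _) ?_)⟩
  intro r hr
  rw [Function.update_of_ne (by omega), hm r (by omega)]

theorem add (hf : NumE c f) (hg : NumE c g) : NumE c fun a => f a + g a := by
  refine ⟨hf.1.add hg.1, fun D hD => ?_⟩
  obtain ⟨p, t, ht, hp⟩ := pair_run hf hg D hD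
  refine ⟨p.seq (Prog.move (D + 1) D), _, ht.add
    (((PolyB.const 4).mul hg.1).add (PolyB.const 1)), fun a m ha hm => ?_⟩
  refine ((hp a m ha hm).seq ((Prog.run_move (by omega) _).mono (by simp))).of_eq ?_
  funext x
  by_cases h1 : x = D
  · subst h1
    simp [add_comm]
  · by_cases h2 : x = D + 1
    · subst h2
      simp [hm]
    · simp [h1, h2]

theorem sub (hf : NumE c f) (hg : NumE c g) : NumE c fun a => f a - g a := by
  refine ⟨hf.1.mono fun a => Nat.sub_le _ _, fun D hD => ?_⟩
  obtain ⟨p, t, ht, hp⟩ := pair_run hf hg D hD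
  refine ⟨p.seq (Prog.loop (D + 1) ((Prog.pop (D + 1)).seq (Prog.pop D))), _, ht.add
    ((hg.1.mul (PolyB.const 3)).add (PolyB.const 1)), fun a m ha hm => ?_⟩
  refine (hp a m ha hm).seq ?_
  have h := Prog.run_loop (p := (Prog.pop (D + 1)).seq (Prog.pop D)) (r := D + 1) (B := 2)
    (fun i => Function.update (Function.update m D (List.replicate (f a - i) true)) (D + 1)
      (List.replicate (g a - i) true)) (g a) (fun i hi => by simp; omega) (fun i hi => ?_) (by simp)
  · refine h.of_eq ?_
    funext x
    by_cases h1 : x = D + 1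
    · subst h1; simp [hm]
    · simp [h1]
  · refine ((Prog.run_pop _ _).seq (Prog.run_pop _ _)).of_eq ?_
    funext x
    by_cases h1 : x = D + 1
    · subst h1; simp [Nat.sub_sub]
    · by_cases h2 : x = D
      · subst h2; simp [Nat.sub_sub]
      · simp [h1, h2]

/-- Case distinction on whether `f` vanishes. -/
theorem ite_zero (hf : NumE c f) (hg : NumE c g) (hh : NumE c h) :
    NumE c fun a => if f a = 0 then g a else h a := by
  refine ⟨(hg.1.add hh.1).mono fun a => by split_ifs <;> omega, fun D hD => ?_⟩
  obtain ⟨p, t, ht, hp⟩ := hf.2 D hD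
  obtain ⟨q, s, hs, hq⟩ := hg.2 D hD
  obtain ⟨q', s', hs', hq'⟩ := hh.2 D hD
  refine ⟨p.seq (Prog.branch D q Prog.skip ((Prog.clear D).seq q')), _,
    ht.add ((hs.add (hs'.add (((PolyB.const 2).mul hf.1).add (PolyB.const 1)))).add (PolyB.const 1)),
    fun a m ha hm => (hp a m ha hm).seq ?_⟩
  have e : ∀ l, Function.update (Function.update m D l) D [] = m := by
    intro l
    rw [Function.update_idem, ← hm D le_rfl, Function.update_eq_self]
  rcases Nat.eq_zero_or_pos (f a) with h0 | h0
  · have e0 : Function.update m D (List.replicate (f a) true) = m := by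
      rw [h0, List.replicate_zero, ← hm D le_rfl, Function.update_eq_self]
    rw [e0]
    simp only [if_pos h0]
    exact (Prog.Run.branch_nil (hm D le_rfl) (hq a m ha hm)).mono (by omega)
  · have hc := Prog.run_clear D (Function.update m D (List.replicate (f a) true))
    rw [e] at hc
    refine Prog.Run.branch_true (l := List.replicate (f a - 1) true) ?_
      (((hc.seq (hq' a m ha hm)).of_eq (by simp [h0.ne'])).mono ?_)
    · rw [Function.update_self, ← List.replicate_succ]; congr 1; omega
    · simp; omega

/-- Primitive recursion, if the values do not grow too fast. -/
theorem natRec {n : α → ℕ} {s : (α × ℕ) × ℕ → ℕ} (hn : NumE c n) (hf : NumE c f)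
    (hs : ∀ (D D' : ℕ) (hD : c.base ≤ D) (hD' : (c.push D hD).base ≤ D'),
      NumE ((c.push D hD).push D' hD') s)
    {V : α → ℕ} (hV : PolyB c.size V)
    (hb : ∀ a, ∀ i ≤ n a, (Nat.rec (f a) (fun i v => s ((a, v), i)) i : ℕ) ≤ V a) :
    NumE c fun a => (Nat.rec (f a) (fun i v => s ((a, v), i)) (n a) : ℕ) := by
  refine ⟨hV.mono fun a => hb a _ le_rfl, fun D hD => ?_⟩
  set F : α → ℕ → ℕ := fun a i => Nat.rec (f a) (fun i v => s ((a, v), i)) i with hF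
  obtain ⟨p, t, ht, hp⟩ := pair_run hf hn D hD
  obtain ⟨q, u, hu, hq⟩ := (hs D (D + 2) hD (show D + 1 ≤ D + 2 by omega)).2 (D + 3)
    (show D + 3 ≤ D + 3 by omega)
  obtain ⟨k, hk⟩ := hu
  set B : α → ℕ := fun a => (c.size a + V a + n a + 2) ^ k + 6 * V a + 4 with hB
  have hBp : PolyB c.size B := ((((PolyB.self.add hV).add hn.1).add (PolyB.const 2)).pow k).add
    ((PolyB.const 6).mul hV) |>.add (PolyB.const 4)
  refine ⟨p.seq ((Prog.loop (D + 1) ((Prog.pop (D + 1)).seq (q.seq ((Prog.clear D).seq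
    ((Prog.move (D + 3) D).seq (Prog.push (D + 2) true)))))).seq (Prog.clear (D + 2))), _,
    ht.add (((hn.1.mul (hBp.add (PolyB.const 1))).add (PolyB.const 1)).add
      (((PolyB.const 2).mul hn.1).add (PolyB.const 1))), fun a m ha hm => (hp a m ha hm).seq ?_⟩
  set st : ℕ → Mem := fun i => Function.update (Function.update (Function.update m D
    (List.replicate (F a i) true)) (D + 1) (List.replicate (n a - i) true)) (D + 2)
    (List.replicate i true) with hst
  have hloop := Prog.run_loop (r := D + 1) (B := B a)
    (p := (Prog.pop (D + 1)).seq (q.seq ((Prog.clear D).seq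
      ((Prog.move (D + 3) D).seq (Prog.push (D + 2) true))))) st (n a)
    (fun i hi => by simp [hst]; omega) (fun i hi => ?_) (by simp [hst])
  · have h0 : st 0 = Function.update (Function.update m D (List.replicate (f a) true)) (D + 1)
        (List.replicate (n a) true) := by
      funext x
      by_cases h2 : x = D + 2
      · subst h2; simp [hst, hm]
      · simp [hst, hF, h2]
    rw [← h0]
    refine ((hloop.seq (Prog.run_clear (D + 2) _)).of_eq ?_).mono (by simp [hst])
    funext x
    by_cases h2 : x = D + 2
    · subst h2; simp [hm]
    · by_cases h1 : x = D + 1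
      · subst h1; simp [hst, hm]
      · simp [hst, h1, h2, hF]
  · have hv := hb a i hi.le
    have hv' := hb a (i + 1) hi
    set m₁ : Mem := Function.update (Function.update (Function.update m D
      (List.replicate (F a i) true)) (D + 1) (List.replicate (n a - (i + 1)) true)) (D + 2)
      (List.replicate i true) with hm₁
    have r1 : (Prog.pop (D + 1)).Run (st i) m₁ 1 := by
      refine (Prog.run_pop _ _).of_eq ?_
      funext x
      by_cases h1 : x = D + 1
      · subst h1; simp [hst, hm₁, Nat.sub_sub]
      · simp [hst, hm₁, h1]
        by_cases h2 : x = D + 2 <;> simp [h2, h1]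
    have hinv : ((c.push D hD).push (D + 2) (show D + 1 ≤ D + 2 by omega)).Inv ((a, F a i), i)
        m₁ := by
      refine ⟨⟨?_, by simp [hm₁]⟩, by simp [hm₁]⟩
      exact ((ha.update (Or.inr hD) _).update (by omega) _).update (by omega) _
    have r2 := hq ((a, F a i), i) m₁ hinv fun r hr => by
      simp [hm₁, show r ≠ D by omega, show r ≠ D + 1 by omega, show r ≠ D + 2 by omega,
        hm r (by omega)]
    have e : s ((a, F a i), i) = F a (i + 1) := rfl
    rw [e] at r2
    have r3 := Prog.run_clear D (Function.update m₁ (D + 3) (List.replicate (F a (i + 1)) true))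
    have r4 := Prog.run_move (r := D + 3) (d := D) (by omega)
      (Function.update (Function.update m₁ (D + 3) (List.replicate (F a (i + 1)) true)) D [])
    refine ((r1.seq (r2.seq (r3.seq (r4.seq (Prog.run_push _ _ _))))).of_eq ?_).mono ?_
    · funext x
      by_cases h1 : x = D
      · subst h1; simp [hst]
      · by_cases h2 : x = D + 1
        · subst h2; simp [hst, hm₁]
        · by_cases h3 : x = D + 2
          · subst h3; simp [hst, hm₁, List.replicate_succ]
          · by_cases h4 : x = D + 3
            · subst h4; simp [hst, hm]
            · simp [hst, hm₁, h1, h2, h3, h4]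
    · have hu' := hk ((a, F a i), i)
      have : (c.size a + F a i + i + 2) ^ k ≤ (c.size a + V a + n a + 2) ^ k :=
        Nat.pow_le_pow_left (by have : F a i ≤ V a := hv; omega) k
      have hu'' : u ((a, F a i), i) ≤ (c.size a + V a + n a + 2) ^ k := hu'.trans this
      have h5 : (m₁ D).length = F a i := by simp [hm₁]
      have h6 : F a i ≤ V a := hv
      have h7 : F a (i + 1) ≤ V a := hv'
      have h8 : B a = (c.size a + V a + n a + 2) ^ k + 6 * V a + 4 := rfl
      simp [h5]
      omega

theorem mul (hf : NumE c f) (hg : NumE c g) : NumE c fun a => f a * g a := by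
  have e : ∀ a i, (Nat.rec 0 (fun _ v => v + g a) i : ℕ) = i * g a := by
    intro a i
    induction i with
    | zero => simp
    | succ i ih => rw [Nat.succ_mul, ← ih]
  refine (natRec (s := fun p => p.1.2 + g p.1.1) hf (const 0) (fun D D' hD hD' =>
    (var.weaken).add hg.weaken.weaken) (hf.1.mul hg.1) fun a i hi => ?_).congr fun a => e a _
  exact (e a i).trans_le (Nat.mul_le_mul_right _ hi)

end NumE

/-! ### Reading the table -/

/-- Reading one bit of a table in unary: `i` is the number of tokens still to be skipped, `j` the
number of tokens finished after that, and `v` the part of the wanted token read so far. -/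
def scanStep : Bool → ℕ × ℕ × ℕ → ℕ × ℕ × ℕ
  | true, (i, j, v) => (i, j, if i = 0 then if j = 0 then v + 1 else v else v)
  | false, (i, j, v) => if i = 0 then (i, j + 1, v) else (i - 1, j, v)

theorem foldl_scanStep_replicate (k i j v : ℕ) :
    (List.replicate k true).foldl (fun s b => scanStep b s) (i, j, v) =
      (i, j, if i = 0 then if j = 0 then v + k else v else v) := by
  induction k generalizing v with
  | zero => simp
  | succ k ih =>
    rw [List.replicate_succ, List.foldl_cons, scanStep, ih]
    split_ifs <;> simp
    omega

theorem unary_cons (k : ℕ) (T : List ℕ) :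
    unary (k :: T) = List.replicate k true ++ false :: unary T := by simp [unary]

theorem unary_append (T T' : List ℕ) : unary (T ++ T') = unary T ++ unary T' := by simp [unary]

theorem foldl_scanStep_unary (T : List ℕ) (i j v : ℕ) :
    (unary T).foldl (fun s b => scanStep b s) (i, j, v) =
      (i - T.length, j + (T.length - i), if j = 0 then v + T.getD i 0 else v) := by
  induction T generalizing i j v with
  | nil => simp [unary]
  | cons k T ih =>
    rw [unary_cons, List.foldl_append, foldl_scanStep_replicate, List.foldl_cons, scanStep]
    rcases i with _ | i
    · rw [if_pos rfl, ih]
      simp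
      omega
    · rw [if_neg (by omega), ih]
      simp

/-- Scans the table, copying it in reverse to register `s`. -/
def scan (d x y s : ℕ) : Prog :=
  Prog.loop 0 (Prog.branch 0 Prog.skip
    ((Prog.pop 0).seq ((Prog.push s false).seq
      (Prog.branch x (Prog.push y true) (Prog.pop x) (Prog.pop x))))
    ((Prog.pop 0).seq ((Prog.push s true).seq
      (Prog.branch x (Prog.branch y (Prog.push d true) Prog.skip Prog.skip) Prog.skip Prog.skip))))

/-- The memory during a scan of the table. -/
def scanMem (m : Mem) (d x y s : ℕ) (l l' : List Bool) (σ : ℕ × ℕ × ℕ) : Mem :=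
  Function.update (Function.update (Function.update (Function.update (Function.update m 0 l) s l') x
    (List.replicate σ.1 true)) y (List.replicate σ.2.1 true)) d (List.replicate σ.2.2 true)

theorem run_scan {d x y s : ℕ} (h : [0, s, x, y, d].Nodup) (m : Mem) (l l' : List Bool)
    (σ : ℕ × ℕ × ℕ) : (scan d x y s).Run (scanMem m d x y s l l' σ)
      (scanMem m d x y s [] (l.reverse ++ l') (l.foldl (fun s b => scanStep b s) σ))
      (7 * l.length + 1) := by
  simp only [List.nodup_cons, List.mem_cons, List.not_mem_nil, or_false, not_or, List.nodup_nil,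
    and_true, not_false_eq_true] at h
  obtain ⟨⟨h1, h2, h3, h4⟩, ⟨h5, h6, h7⟩, ⟨h8, h9⟩, h10⟩ := h
  induction l generalizing l' σ with
  | nil => exact Prog.run_loop_done (by simp [scanMem, h1, h2, h3, h4])
  | cons b l ih =>
    have hstep : (Prog.branch 0 Prog.skip
        ((Prog.pop 0).seq ((Prog.push s false).seq
          (Prog.branch x (Prog.push y true) (Prog.pop x) (Prog.pop x))))
        ((Prog.pop 0).seq ((Prog.push s true).seq (Prog.branch x
          (Prog.branch y (Prog.push d true) Prog.skip Prog.skip) Prog.skip Prog.skip)))).Run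
        (scanMem m d x y s (b :: l) l' σ) (scanMem m d x y s l (b :: l') (scanStep b σ)) 6 := by
      have hd0 : scanMem m d x y s (b :: l) l' σ 0 = b :: l := by
        simp [scanMem, h1, h2, h3, h4]
      have hmove : ((Prog.pop 0).seq (Prog.push s b)).Run (scanMem m d x y s (b :: l) l' σ)
          (scanMem m d x y s l (b :: l') σ) 2 := by
        refine ((Prog.run_pop _ _).seq (Prog.run_push _ _ _)).of_eq ?_
        funext r
        simp only [scanMem, Function.update_apply]
        split_ifs <;> simp_all
      obtain ⟨t, ht, hr⟩ := hmove
      cases hr with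
      | seq r1 r2 =>
        rename_i m₂ t1 t2
        obtain ⟨i, j, v⟩ := σ
        have hx : scanMem m d x y s l (b :: l') (i, j, v) x = List.replicate i true := by
          simp [scanMem, h8, h9]
        have hy : scanMem m d x y s l (b :: l') (i, j, v) y = List.replicate j true := by
          simp [scanMem, h10]
        have hdd : scanMem m d x y s l (b :: l') (i, j, v) d = List.replicate v true := by
          simp [scanMem]
        cases b with
        | false =>
          refine (Prog.Run.branch_false hd0 (Prog.Run.seq ⟨t1, le_rfl, r1⟩
            (Prog.Run.seq ⟨t2, le_rfl, r2⟩ (B' := 2) ?_))).mono (by omega)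
          rcases i with _ | i
          · refine Prog.Run.branch_nil hx ((Prog.run_push _ _ _).of_eq ?_)
            rw [hy]
            funext r
            simp only [scanMem, scanStep, Function.update_apply]
            split_ifs <;> simp_all [List.replicate_succ]
          · refine Prog.Run.branch_true (l := List.replicate i true) (by rw [hx]; rfl)
              ((Prog.run_pop _ _).of_eq ?_)
            rw [hx]
            funext r
            simp only [scanMem, scanStep, Function.update_apply]
            split_ifs <;> simp_all
        | true =>
          refine (Prog.Run.branch_true hd0 (Prog.Run.seq ⟨t1, le_rfl, r1⟩
            (Prog.Run.seq ⟨t2, le_rfl, r2⟩ (B' := 3) ?_))).mono (by omega)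
          rcases i with _ | i
          · rcases j with _ | j
            · refine Prog.Run.branch_nil hx (Prog.Run.branch_nil hy
                ((Prog.run_push _ _ _).of_eq ?_))
              rw [hdd]
              funext r
              simp only [scanMem, scanStep, Function.update_apply]
              split_ifs <;> simp_all [List.replicate_succ]
            · refine Prog.Run.branch_nil hx (Prog.Run.branch_true (l := List.replicate j true)
                (by rw [hy]; rfl) ((Prog.run_skip _).of_eq ?_))
              simp [scanStep]
          · refine (Prog.Run.branch_true (l := List.replicate i true) (by rw [hx]; rfl)
              ((Prog.run_skip _).of_eq ?_)).mono (by omega)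
            simp [scanStep]
    refine ((Prog.Run.loop_step (by simp [scanMem, h1, h2, h3, h4]) hstep
      (ih (b :: l') (scanStep b σ))).of_eq ?_).mono ?_
    · simp
    · simp; omega

theorem length_le_unary (T : List ℕ) : T.length ≤ (unary T).length := by
  induction T with
  | nil => simp
  | cons k T ih => rw [unary_cons]; simp; omega

theorem getD_le_unary (T : List ℕ) (i : ℕ) : T.getD i 0 ≤ (unary T).length := by
  induction T generalizing i with
  | nil => simp
  | cons k T ih =>
    rw [unary_cons]
    rcases i with _ | i
    · simp
    · have := ih i
      simp at this ⊢
      omega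

namespace NumE

variable {α : Type} {c : Ctx α} {f g h : α → ℕ}

/-- The table is left unchanged by scanning it and moving the copy back. -/
theorem run_scan_move {d x y s : ℕ} (hn : [0, s, x, y, d].Nodup) {m : Mem} {T : List ℕ} {i : ℕ}
    (h0 : m 0 = unary T) (hs : m s = []) (hx : m x = List.replicate i true) (hy : m y = [])
    (hd : m d = []) :
    ((scan d x y s).seq (Prog.move s 0)).Run m (Function.update (Function.update (Function.update m x
      (List.replicate (i - T.length) true)) y (List.replicate (T.length - i) true)) d
      (List.replicate (T.getD i 0) true)) (11 * (unary T).length + 2) := by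
  have hst : scanMem m d x y s (unary T) [] (i, 0, 0) = m := by
    simp only [scanMem, List.replicate_zero]
    rw [← h0, Function.update_eq_self, ← hs, Function.update_eq_self, ← hx, Function.update_eq_self,
      hs, ← hy, Function.update_eq_self, hy, ← hd, Function.update_eq_self]
  have h1 := run_scan hn m (unary T) [] (i, 0, 0)
  rw [hst, foldl_scanStep_unary] at h1
  simp only [List.nodup_cons, List.mem_cons, List.not_mem_nil, or_false, not_or, List.nodup_nil,
    and_true, not_false_eq_true] at hn
  obtain ⟨⟨n1, n2, n3, n4⟩, ⟨n5, n6, n7⟩, ⟨n8, n9⟩, n10⟩ := hn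
  have h2 := Prog.run_move (r := s) (d := 0) (Ne.symm n1) (scanMem m d x y s []
    ((unary T).reverse ++ []) (i - T.length, 0 + (T.length - i), if 0 = 0 then 0 + T.getD i 0 else 0))
  refine ((h1.seq h2).of_eq ?_).mono ?_
  · funext r
    simp only [scanMem, Function.update_apply]
    split_ifs <;> simp_all
  · simp [scanMem, n5, n6, n7]
    omega

/-- Looking up an entry of the table. -/
theorem tok (hf : NumE c f) : NumE c fun a => (c.tbl a).getD (f a) 0 := by
  refine ⟨PolyB.self.mono fun a => (getD_le_unary _ _).trans (c.length_le a), fun D hD => ?_⟩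
  have h2 := c.two_le
  obtain ⟨p, t, ht, hp⟩ := hf.2 (D + 1) (by omega)
  refine ⟨p.seq (((scan D (D + 1) (D + 2) (D + 3)).seq (Prog.move (D + 3) 0)).seq
    ((Prog.clear (D + 1)).seq (Prog.clear (D + 2)))), _, ht.add
      (((PolyB.const 11).mul PolyB.self).add (PolyB.const 2) |>.add
        ((((PolyB.const 2).mul hf.1).add (PolyB.const 1)).add
          (((PolyB.const 2).mul PolyB.self).add (PolyB.const 1)))), fun a m ha hm => ?_⟩
  refine (hp a m ha fun r hr => hm r (by omega)).seq ?_
  have hl := c.length_le a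
  have hl' := length_le_unary (c.tbl a)
  have h1 := run_scan_move (d := D) (x := D + 1) (y := D + 2) (s := D + 3) (T := c.tbl a) (i := f a)
    (m := Function.update m (D + 1) (List.replicate (f a) true)) (by simp; omega)
    (by rw [Function.update_of_ne (by omega), c.table ha])
    (by rw [Function.update_of_ne (by omega), hm _ (by omega)]) (by simp)
    (by rw [Function.update_of_ne (by omega), hm _ (by omega)])
    (by rw [Function.update_of_ne (by omega), hm _ (by omega)])
  refine ((h1.mono (by omega)).seq (((Prog.run_clear (D + 1) _).mono ?_).seq
    ((Prog.run_clear (D + 2) _).mono ?_))).of_eq ?_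
  · simp
  · simp; omega
  · funext r
    by_cases h1 : r = D
    · subst h1; simp
    · by_cases h2 : r = D + 1
      · subst h2; simp [hm]
      · by_cases h3 : r = D + 2
        · subst h3; simp [hm]
        · simp [h1, h2, h3]

/-- The length of the table. -/
theorem length_tbl : NumE c fun a => (c.tbl a).length := by
  refine ⟨PolyB.self.mono fun a => (length_le_unary _).trans (c.length_le a), fun D hD => ?_⟩
  have h2 := c.two_le
  refine ⟨((scan (D + 1) (D + 2) D (D + 3)).seq (Prog.move (D + 3) 0)).seq (Prog.clear (D + 1)), _,
      (((PolyB.const 11).mul PolyB.self).add (PolyB.const 2) |>.add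
        (((PolyB.const 2).mul PolyB.self).add (PolyB.const 1))), fun a m ha hm => ?_⟩
  have hl := c.length_le a
  have h1 := run_scan_move (d := D + 1) (x := D + 2) (y := D) (s := D + 3) (T := c.tbl a) (i := 0)
    (m := m) (by simp; omega) (c.table ha) (hm _ (by omega)) (by rw [hm _ (by omega)]; rfl)
    (hm _ (by omega)) (hm _ (by omega))
  refine ((h1.mono (by omega)).seq ((Prog.run_clear (D + 1) _).mono ?_)).of_eq ?_
  · have := getD_le_unary (c.tbl a) 0
    simp at this ⊢
    omega
  · funext r
    by_cases h1 : r = D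
    · subst h1; simp
    · by_cases h2 : r = D + 1
      · subst h2; simp [hm]
      · by_cases h3 : r = D + 2
        · subst h3; simp [hm]
        · simp [h1, h2, h3]

theorem ite {P : α → Prop} [DecidablePred P] (hP : CondE c P) (hg : NumE c g) (hh : NumE c h) :
    NumE c fun a => if P a then g a else h a := by
  obtain ⟨f, hf, e⟩ := hP
  exact (ite_zero hf hg hh).congr fun a => by simp [e]

end NumE

namespace CondE

variable {α : Type} {c : Ctx α} {f g : α → ℕ} {P R : α → Prop}

theorem congr (h : CondE c P) (e : ∀ a, P a ↔ R a) : CondE c R := by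
  obtain ⟨f, hf, hP⟩ := h
  exact ⟨f, hf, fun a => (e a).symm.trans (hP a)⟩

theorem le (hf : NumE c f) (hg : NumE c g) : CondE c fun a => f a ≤ g a :=
  ⟨_, hf.sub hg, fun _ => Nat.sub_eq_zero_iff_le.symm⟩

theorem lt (hf : NumE c f) (hg : NumE c g) : CondE c fun a => f a < g a :=
  le (hf.add (NumE.const 1)) hg

theorem eq (hf : NumE c f) (hg : NumE c g) : CondE c fun a => f a = g a :=
  ⟨_, (hf.sub hg).add (hg.sub hf), fun a => by omega⟩

end CondE

namespace PrintE

variable {α : Type} {c : Ctx α} {f g : α → List ℕ}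

theorem congr (hf : PrintE c f) (e : ∀ a, f a = g a) : PrintE c g := by
  rwa [← funext e]

theorem nil : PrintE c fun _ => [] := fun D _ =>
  ⟨Prog.skip, _, PolyB.const 1, fun a m _ _ => (Prog.run_skip m).of_eq (by simp [unary])⟩

theorem append (hf : PrintE c f) (hg : PrintE c g) : PrintE c fun a => f a ++ g a := by
  intro D hD
  have h2 := c.two_le
  obtain ⟨p, t, ht, hp⟩ := hf D hD
  obtain ⟨q, s, hs, hq⟩ := hg D hD
  refine ⟨p.seq q, _, ht.add hs, fun a m ha hm => ((hp a m ha hm).seq (hq a _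
    (ha.update (Or.inl rfl) _) ?_)).of_eq ?_⟩
  · intro r hr
    rw [Function.update_of_ne (by omega), hm r hr]
  · simp [unary_append]

/-- Printing one number. -/
theorem singleton {k : α → ℕ} (hk : NumE c k) : PrintE c fun a => [k a] := by
  intro D hD
  have h2 := c.two_le
  obtain ⟨p, t, ht, hp⟩ := hk.2 D hD
  refine ⟨p.seq ((Prog.move D 1).seq (Prog.push 1 false)), _, ht.add
    ((((PolyB.const 4).mul hk.1).add (PolyB.const 1)).add (PolyB.const 1)), fun a m ha hm => ?_⟩
  refine ((hp a m ha hm).seq (((Prog.run_move (by omega) _).mono (by simp)).seq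
    (Prog.run_push _ _ _))).of_eq ?_
  funext r
  by_cases h1 : r = 1
  · subst h1
    simp [unary, show (1 : ℕ) ≠ D by omega]
  · by_cases h3 : r = D
    · subst h3; simp [h1, hm]
    · simp [h1, h3]

theorem ite {P : α → Prop} [DecidablePred P] (hP : CondE c P) (hf : PrintE c f)
    (hg : PrintE c g) : PrintE c fun a => if P a then f a else g a := by
  intro D hD
  have h2 := c.two_le
  obtain ⟨k, hk, e⟩ := hP
  obtain ⟨p, t, ht, hp⟩ := hk.2 D hD
  obtain ⟨q, s, hs, hq⟩ := hf D hD
  obtain ⟨q', s', hs', hq'⟩ := hg D hD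
  refine ⟨p.seq (Prog.branch D q Prog.skip ((Prog.clear D).seq q')), _,
    ht.add ((hs.add (hs'.add (((PolyB.const 2).mul hk.1).add (PolyB.const 1)))).add (PolyB.const 1)),
    fun a m ha hm => (hp a m ha hm).seq ?_⟩
  rcases Nat.eq_zero_or_pos (k a) with h0 | h0
  · have e0 : Function.update m D (List.replicate (k a) true) = m := by
      rw [h0, List.replicate_zero, ← hm D le_rfl, Function.update_eq_self]
    rw [e0]
    simp only [if_pos ((e a).2 h0)]
    exact (Prog.Run.branch_nil (hm D le_rfl) (hq a m ha hm)).mono (by omega)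
  · have hc := Prog.run_clear D (Function.update m D (List.replicate (k a) true))
    rw [Function.update_idem] at hc
    have e1 : Function.update m D [] = m := by rw [← hm D le_rfl, Function.update_eq_self]
    rw [e1] at hc
    simp only [if_neg (mt (e a).1 h0.ne')]
    refine Prog.Run.branch_true (l := List.replicate (k a - 1) true) ?_
      ((hc.seq (hq' a m ha hm)).mono ?_)
    · rw [Function.update_self, ← List.replicate_succ]; congr 1; omega
    · simp; omega

/-- Printing a list for every number below `n`. -/
theorem flatMap {n : α → ℕ} {g : α × ℕ → List ℕ} (hn : NumE c n)
    (hg : ∀ (D : ℕ) (hD : c.base ≤ D), PrintE (c.push D hD) g) :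
    PrintE c fun a => (List.range (n a)).flatMap fun i => g (a, i) := by
  intro D hD
  have h2 := c.two_le
  obtain ⟨p, t, ht, hp⟩ := hn.2 D hD
  obtain ⟨q, u, hu, hq⟩ := hg (D + 1) (by omega) (D + 2) (show D + 2 ≤ D + 2 by omega)
  obtain ⟨B, hB, hub⟩ := PolyB.exists_bound hu hn.1
  refine ⟨p.seq ((Prog.loop D ((Prog.pop D).seq (q.seq (Prog.push (D + 1) true)))).seq
    (Prog.clear (D + 1))), _, ht.add (((hn.1.mul ((hB.add (PolyB.const 2)).add (PolyB.const 1))).add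
      (PolyB.const 1)).add (((PolyB.const 2).mul hn.1).add (PolyB.const 1))), fun a m ha hm => ?_⟩
  refine (hp a m ha hm).seq ?_
  set st : ℕ → Mem := fun i => Function.update (Function.update (Function.update m D
    (List.replicate (n a - i) true)) (D + 1) (List.replicate i true)) 1
    ((unary ((List.range i).flatMap fun i => g (a, i))).reverse ++ m 1) with hst
  have n1 : D ≠ 1 := by omega
  have n2 : D ≠ 0 := by omega
  have hloop := Prog.run_loop (r := D) (B := B a + 2)
    (p := (Prog.pop D).seq (q.seq (Prog.push (D + 1) true))) st (n a)
    (fun i hi => by simp [hst, n1]; omega) (fun i hi => ?_) (by simp [hst, n1])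
  · have h0 : st 0 = Function.update m D (List.replicate (n a) true) := by
      funext x
      by_cases h1 : x = 1
      · subst h1; simp [hst, unary, n1.symm]
      · by_cases h2 : x = D + 1
        · subst h2; simp [hst, hm, n2]
        · simp [hst, h1, h2]
    rw [← h0]
    refine ((hloop.seq (Prog.run_clear (D + 1) _)).of_eq ?_).mono (by simp [hst, n2])
    funext x
    by_cases h2 : x = D + 1
    · subst h2; simp [hm, n2]
    · by_cases h1 : x = 1
      · subst h1; simp [hst, n2]
      · by_cases h3 : x = D
        · subst h3; simp [hst, h1, hm]
        · simp [hst, h1, h2, h3]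
  · set m₁ : Mem := Function.update (Function.update (Function.update m D
      (List.replicate (n a - (i + 1)) true)) (D + 1) (List.replicate i true)) 1
      ((unary ((List.range i).flatMap fun i => g (a, i))).reverse ++ m 1) with hm₁
    have r1 : (Prog.pop D).Run (st i) m₁ 1 := by
      refine (Prog.run_pop _ _).of_eq ?_
      funext x
      by_cases h1 : x = D
      · subst h1; simp [hst, hm₁, n1, Nat.sub_sub]
      · simp only [hst, hm₁, Function.update_apply]
        split_ifs <;> simp_all
    have hinv : (c.push (D + 1) (show c.base ≤ D + 1 by omega)).Inv (a, i) m₁ := by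
      refine ⟨((ha.update (Or.inr hD) _).update (by omega) _).update (Or.inl rfl) _, ?_⟩
      simp [hm₁, n2]
    have r2 := hq (a, i) m₁ hinv fun r hr => by
      simp [hm₁, show r ≠ D by omega, show r ≠ D + 1 by omega, show r ≠ 1 by omega,
        hm r (by omega)]
    refine ((r1.seq (r2.seq (Prog.run_push _ _ _))).of_eq ?_).mono ?_
    · funext x
      by_cases h2 : x = D + 1
      · subst h2; simp [hst, hm₁, n2, List.replicate_succ]
      · by_cases h1 : x = 1
        · subst h1
          simp [hst, hm₁, n2, List.range_succ, unary_append]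
        · simp [hst, hm₁, h1, h2]
    · have := hub a i hi.le
      omega

end PrintE

/-! ### Extending the parameters -/

/-- The context `c'` has the parameters of `c` among its own. -/
structure Ctx.Le {α β : Type} (c : Ctx α) (c' : Ctx β) (π : β → α) : Prop where
  tbl : ∀ b, c'.tbl b = c.tbl (π b)
  num : ∀ {f : α → ℕ}, NumE c f → NumE c' fun b => f (π b)

/-- `f a x` is computed in polynomial time, whatever computable number `x` is. -/
def NumE₂ {α : Type} (c : Ctx α) (f : α → ℕ → ℕ) : Prop :=
  ∀ ⦃β : Type⦄ ⦃c' : Ctx β⦄ ⦃π : β → α⦄ ⦃x : β → ℕ⦄, c.Le c' π → NumE c' x →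
    NumE c' fun b => f (π b) (x b)

section basic

variable {α β δ : Type} {c : Ctx α} {c' : Ctx β} {c'' : Ctx δ} {π : β → α} {ρ : δ → β}

theorem Ctx.Le.trans (h : c.Le c' π) (h' : c'.Le c'' ρ) : c.Le c'' fun d => π (ρ d) :=
  ⟨fun d => (h'.tbl d).trans (h.tbl _), fun hf => h'.num (h.num hf)⟩

theorem Ctx.le_push {D : ℕ} (hD : c.base ≤ D) : c.Le (c.push D hD) Prod.fst :=
  ⟨fun _ => rfl, fun h => h.weaken⟩

theorem NumE₂.lift {f : α → ℕ → ℕ} (hf : NumE₂ c f) (h : c.Le c' π) :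
    NumE₂ c' fun b => f (π b) := fun _ _ _ _ h' hx => hf (h.trans h') hx

theorem NumE.tok_le (h : c.Le c' π) {f : β → ℕ} (hf : NumE c' f) :
    NumE c' fun b => (c.tbl (π b)).getD (f b) 0 := hf.tok.congr fun b => by rw [h.tbl]

theorem NumE.recursion {n f : α → ℕ} {s : α → ℕ → ℕ → ℕ} (hn : NumE c n) (hf : NumE c f)
    (hs : ∀ ⦃β : Type⦄ ⦃c' : Ctx β⦄ ⦃π : β → α⦄ ⦃i v : β → ℕ⦄, c.Le c' π → NumE c' i → NumE c' v →
      NumE c' fun b => s (π b) (i b) (v b))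
    {V : α → ℕ} (hV : PolyB c.size V)
    (hb : ∀ a, ∀ i ≤ n a, (Nat.rec (f a) (s a) i : ℕ) ≤ V a) :
    NumE c fun a => (Nat.rec (f a) (s a) (n a) : ℕ) :=
  NumE.natRec (s := fun p => s p.1.1 p.2 p.1.2) hn hf (fun _ _ hD hD' =>
    hs ((Ctx.le_push hD).trans (Ctx.le_push hD')) NumE.var NumE.var.weaken) hV hb

theorem PrintE.flatMap_range {n : α → ℕ} {g : α → ℕ → List ℕ} (hn : NumE c n)
    (hg : ∀ ⦃β : Type⦄ ⦃c' : Ctx β⦄ ⦃π : β → α⦄ ⦃i : β → ℕ⦄, c.Le c' π → NumE c' i →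
      PrintE c' fun b => g (π b) (i b)) :
    PrintE c fun a => (List.range (n a)).flatMap (g a) :=
  PrintE.flatMap (g := fun p => g p.1 p.2) hn fun _ hD => hg (Ctx.le_push hD) NumE.var

end basic

/-! ### Arithmetic -/

section arithmetic

variable {α : Type} {c : Ctx α} {f g N k r t i : α → ℕ}

theorem NumE.succ (hf : NumE c f) : NumE c fun a => f a + 1 := hf.add (NumE.const 1)

theorem rec_div_two (n : ℕ) : (Nat.rec 0 (fun i v => i - v) n : ℕ) = n / 2 := by
  induction n with
  | zero => rfl
  | succ n ih =>
    change n - (Nat.rec 0 (fun i v => i - v) n : ℕ) = _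
    rw [ih]
    omega

theorem NumE.div_two (hf : NumE c f) : NumE c fun a => f a / 2 :=
  (NumE.recursion (s := fun _ i v => i - v) hf (NumE.const 0) (fun _ _ _ _ _ _ hi hv => hi.sub hv)
    hf.1 fun a i hi => by rw [rec_div_two]; omega).congr fun a => rec_div_two _

theorem rec_div_pow (n j : ℕ) : (Nat.rec n (fun _ v => v / 2) j : ℕ) = n / 2 ^ j := by
  induction j with
  | zero => simp
  | succ j ih => rw [pow_succ, ← Nat.div_div_eq_div_mul, ← ih]

theorem NumE.div_pow (hf : NumE c f) (hg : NumE c g) : NumE c fun a => f a / 2 ^ g a :=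
  (NumE.recursion (s := fun _ _ v => v / 2) hg hf (fun _ _ _ _ _ _ _ hv => hv.div_two)
    hf.1 fun a i _ => by rw [rec_div_pow]; exact Nat.div_le_self _ _).congr fun a => rec_div_pow _ _

theorem CondE.testBit (hf : NumE c f) (hg : NumE c g) :
    CondE c fun a => (f a).testBit (g a) = true := by
  have h := hf.div_pow hg
  refine (CondE.eq (h.sub (h.div_two.add h.div_two)) (NumE.const 1)).congr fun a => ?_
  rw [Nat.testBit_eq_decide_div_mod_eq, decide_eq_true_iff]
  omega

theorem rec_size (n j : ℕ) :
    (Nat.rec 0 (fun i v => if n / 2 ^ i = 0 then v else v + 1) j : ℕ) = min j (Nat.size n) := by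
  induction j with
  | zero => simp
  | succ j ih =>
    change (if n / 2 ^ j = 0 then _ else _ + 1) = _
    rw [ih]
    have h := Nat.lt_size (m := j) (n := n)
    split_ifs with hj
    all_goals rw [Nat.div_eq_zero_iff] at hj
    · have : ¬ j < Nat.size n := by
        rw [h]
        rcases hj with hj | hj
        · simp at hj
        · omega
      omega
    · have : j < Nat.size n := by rw [h]; push Not at hj; exact hj.2
      omega

theorem size_le_self (n : ℕ) : Nat.size n ≤ n := Nat.size_le.2 Nat.lt_two_pow_self

theorem NumE.size (hf : NumE c f) : NumE c fun a => Nat.size (f a) :=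
  (NumE.recursion (s := fun a i v => if f a / 2 ^ i = 0 then v else v + 1) hf (NumE.const 0)
    (fun _ _ _ _ _ hπ hi hv => NumE.ite (CondE.eq ((hπ.num hf).div_pow hi) (NumE.const 0)) hv
      hv.succ)
    hf.1 fun a i hi => by rw [rec_size]; omega).congr fun a => by
      rw [rec_size, min_eq_right (size_le_self _)]

theorem NumE.pair (hf : NumE c f) (hg : NumE c g) : NumE c fun a => Nat.pair (f a) (g a) :=
  (NumE.ite (CondE.lt hf hg) ((hg.mul hg).add hf) (((hf.mul hf).add hf).add hg)).congr
    fun _ => rfl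

theorem NumE.ad (hN : NumE c N) (hk : NumE c k) (hr : NumE c r) (ht : NumE c t) (hi : NumE c i) :
    NumE c fun a => QLearn.ad (N a) (k a) (r a) (t a) (i a) :=
  (hN.add (hk.pair (hr.pair (ht.pair hi)))).congr fun a => by simp [QLearn.ad]

theorem NumE.ancQ (hN : NumE c N) (hk : NumE c k) (hr : NumE c r) (ht : NumE c t)
    (hi : NumE c i) : NumE c fun a => QLearn.ancQ (N a) (k a) (r a) (t a) (i a) :=
  NumE.ite (CondE.eq hi (const 0)) (hN.ad (const 0) (const 0) (const 0) (const 1))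
    (hN.ad hk hr ht hi)

theorem NumE.one (hN : NumE c N) : NumE c fun a => QLearn.one (N a) :=
  hN.ad (const 0) (const 0) (const 0) (const 0)

theorem NumE.two (hN : NumE c N) : NumE c fun a => QLearn.two (N a) :=
  hN.ad (const 0) (const 0) (const 0) (const 1)

end arithmetic

/-! ### Printing circuits -/

/-- The circuit `U` is printed in polynomial time. -/
def CircE {α : Type} (c : Ctx α) (U : α → Circuit) : Prop :=
  PrintE c fun a => (U a).flatMap Gate.tokens

namespace CircE

variable {α : Type} {c : Ctx α} {U V : α → Circuit} {f g h N n k r t : α → ℕ}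

theorem congr (hU : CircE c U) (e : ∀ a, U a = V a) : CircE c V := by
  rwa [← funext e]

theorem nil : CircE c fun _ => [] := PrintE.nil

theorem append (hU : CircE c U) (hV : CircE c V) : CircE c fun a => U a ++ V a :=
  (PrintE.append hU hV).congr fun a => by simp

theorem had (hf : NumE c f) : CircE c fun a => [Gate.had (f a)] :=
  ((PrintE.singleton (NumE.const 0)).append (PrintE.singleton hf)).congr fun a => by
    simp [Gate.tokens]

theorem toff (hf : NumE c f) (hg : NumE c g) (hh : NumE c h) :
    CircE c fun a => [Gate.toff (f a) (g a) (h a)] :=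
  ((PrintE.singleton (NumE.const 1)).append ((PrintE.singleton hf).append
    ((PrintE.singleton hg).append (PrintE.singleton hh)))).congr fun a => by
    simp [Gate.tokens]

theorem cons {G : α → Gate} (hG : CircE c fun a => [G a]) (hU : CircE c U) :
    CircE c fun a => G a :: U a := hG.append hU

theorem ite {P : α → Prop} [DecidablePred P] (hP : CondE c P) (hU : CircE c U) (hV : CircE c V) :
    CircE c fun a => if P a then U a else V a :=
  (PrintE.ite hP hU hV).congr fun a => by by_cases h : P a <;> simp [h]

theorem flatMap {F : α → ℕ → Circuit} (hn : NumE c n)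
    (hF : ∀ ⦃β : Type⦄ ⦃c' : Ctx β⦄ ⦃π : β → α⦄ ⦃i : β → ℕ⦄, c.Le c' π → NumE c' i →
      CircE c' fun b => F (π b) (i b)) :
    CircE c fun a => (List.range (n a)).flatMap (F a) :=
  (PrintE.flatMap_range (g := fun a i => (F a i).flatMap Gate.tokens) hn hF).congr fun a => by
    rw [List.flatMap_assoc]

theorem literal {o p q s : α → ℕ} {b : α → Bool} (ho : NumE c o) (hp : NumE c p) (hq : NumE c q)
    (hs : NumE c s) (hb : CondE c fun a => b a = true) :
    CircE c fun a => QLearn.literal (o a) (p a) (q a) (s a) (b a) :=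
  cons (toff hp hq hs) (ite hb nil (toff hp ho hs))

theorem literal_reverse {o p q s : α → ℕ} {b : α → Bool} (ho : NumE c o) (hp : NumE c p)
    (hq : NumE c q) (hs : NumE c s) (hb : CondE c fun a => b a = true) :
    CircE c fun a => (QLearn.literal (o a) (p a) (q a) (s a) (b a)).reverse :=
  (append (ite hb nil (toff hp ho hs)) (toff hp hq hs)).congr fun a => by
    rw [QLearn.literal, List.reverse_cons]
    split_ifs <;> rfl

section chain

variable {o len : α → ℕ} {anc pos : α → ℕ → ℕ} {sgn : α → ℕ → Bool}

theorem chain (ho : NumE c o) (hanc : NumE₂ c anc) (hpos : NumE₂ c pos)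
    (hsgn : ∀ ⦃β : Type⦄ ⦃c' : Ctx β⦄ ⦃π : β → α⦄ ⦃i : β → ℕ⦄, c.Le c' π → NumE c' i →
      CondE c' fun b => sgn (π b) (i b) = true) (hlen : NumE c len) :
    CircE c fun a => QLearn.chain (o a) (anc a) (pos a) (sgn a) (len a) :=
  flatMap hlen fun _ _ _ _ hπ hi => literal (hπ.num ho) (hanc hπ hi) (hpos hπ hi)
    (hanc hπ hi.succ) (hsgn hπ hi)

theorem reverse_flatMap_range {γ : Type*} (n : ℕ) (F : ℕ → List γ) :
    ((List.range n).flatMap F).reverse =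
      (List.range n).flatMap fun i => (F (n - 1 - i)).reverse := by
  rw [List.reverse_flatMap, List.range_eq_range', List.reverse_range', List.flatMap_map,
    ← List.range_eq_range']
  refine List.flatMap_congr fun i _ => ?_
  simp

theorem chain_reverse (ho : NumE c o) (hanc : NumE₂ c anc) (hpos : NumE₂ c pos)
    (hsgn : ∀ ⦃β : Type⦄ ⦃c' : Ctx β⦄ ⦃π : β → α⦄ ⦃i : β → ℕ⦄, c.Le c' π → NumE c' i →
      CondE c' fun b => sgn (π b) (i b) = true) (hlen : NumE c len) :
    CircE c fun a => (QLearn.chain (o a) (anc a) (pos a) (sgn a) (len a)).reverse := by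
  refine (flatMap (F := fun a i => (QLearn.literal (o a) (anc a (len a - 1 - i))
    (pos a (len a - 1 - i)) (anc a (len a - 1 - i + 1)) (sgn a (len a - 1 - i))).reverse) hlen
    fun _ _ _ _ hπ hi => ?_).congr fun a => ?_
  · have hj := ((hπ.num hlen).sub (NumE.const 1)).sub hi
    exact literal_reverse (hπ.num ho) (hanc hπ hj) (hpos hπ hj) (hanc hπ hj.succ) (hsgn hπ hj)
  · rw [QLearn.chain, reverse_flatMap_range]

theorem lookup (ho : NumE c o) (hanc : NumE₂ c anc) (hpos : NumE₂ c pos) (hn : NumE c n)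
    (hN : NumE c fun a => 2 ^ n a) (ht : NumE c t) :
    CircE c fun a => QLearn.lookup (o a) (anc a) (pos a) (n a) (t a) :=
  flatMap hN fun _ _ _ _ hπ hy =>
    append (chain (hπ.num ho) (hanc.lift hπ) (hpos.lift hπ)
      (fun _ _ _ _ hρ hj => CondE.testBit (hρ.num hy) hj) (hπ.num hn))
    (cons (toff (hanc hπ (hπ.num hn)) hy (hπ.num ht))
      (chain_reverse (hπ.num ho) (hanc.lift hπ) (hpos.lift hπ)
        (fun _ _ _ _ hρ hj => CondE.testBit (hρ.num hy) hj) (hπ.num hn)))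

end chain

theorem hadamards {X : α → ℕ → ℕ} (hX : NumE₂ c X) (hn : NumE c n) :
    CircE c fun a => QLearn.hadamards (X a) (n a) :=
  flatMap hn fun _ _ _ _ hπ hi => had (hX hπ hi)

theorem counterRow {o d : α → ℕ} {C C' : α → ℕ → ℕ} (ho : NumE c o) (hd : NumE c d)
    (hC : NumE₂ c C) (hC' : NumE₂ c C') (hk : NumE c k) :
    CircE c fun a => QLearn.counterRow (o a) (d a) (C a) (C' a) (k a) :=
  flatMap hk fun _ _ _ _ hπ hj => cons (toff (hπ.num ho) (hC hπ hj) (hC' hπ hj))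
    (ite (CondE.eq hj (NumE.const 0)) nil (cons
      (toff (hπ.num hd) (hC hπ (hj.sub (NumE.const 1))) (hC' hπ hj))
      (toff (hπ.num hd) (hC hπ hj) (hC' hπ hj))))

theorem ctrlHad {F s h : α → ℕ} (hF : NumE c F) (hs : NumE c s) (hh : NumE c h) :
    CircE c fun a => QLearn.ctrlHad (F a) (s a) (h a) :=
  cons (toff hF hs hh) (cons (toff hF hh hs) (cons (had hh) (cons (toff hF hh hs) (toff hF hs hh))))

theorem ctrlToff {F u x y z : α → ℕ} (hF : NumE c F) (hu : NumE c u) (hx : NumE c x)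
    (hy : NumE c y) (hz : NumE c z) :
    CircE c fun a => QLearn.ctrlToff (F a) (u a) (x a) (y a) (z a) :=
  cons (toff hF hx hu) (cons (toff hu hy hz) (toff hF hx hu))

/-! ### Printing the tester -/

theorem prepareBits {x y : α → ℕ → ℕ} (hx : NumE₂ c x) (hy : NumE₂ c y) (hn : NumE c n) :
    CircE c fun a => QLearn.prepareBits (x a) (y a) (n a) :=
  flatMap hn fun _ _ _ _ hπ hi => cons (had (hx hπ hi)) (had (hy hπ hi))

theorem prepareOr {o o' : α → ℕ} {x y v w : α → ℕ → ℕ} (ho : NumE c o) (ho' : NumE c o')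
    (hx : NumE₂ c x) (hy : NumE₂ c y) (hv : NumE₂ c v) (hw : NumE₂ c w) (hn : NumE c n) :
    CircE c fun a => QLearn.prepareOr (o a) (o' a) (x a) (y a) (v a) (w a) (n a) :=
  flatMap hn fun _ _ _ _ hπ hi =>
    cons (toff (hx hπ hi) (hy hπ hi) (hv hπ hi)) (cons (toff (hπ.num ho) (hv hπ hi) (hw hπ hi))
      (cons (toff (hx hπ hi) (hy hπ hi) (hπ.num ho)) (cons
        (toff (hw hπ hi) (hx hπ hi) (hπ.num ho)) (cons (toff (hx hπ hi) (hy hπ hi) (hπ.num ho'))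
          (toff (hw hπ hi) (hx hπ hi) (hπ.num ho'))))))

theorem opLen (hf : NumE c f) : NumE c fun a => QLearn.opLen (c.tbl a) (f a) :=
  NumE.ite (CondE.eq hf.tok (NumE.const 1)) (NumE.const 4)
    (NumE.ite (CondE.eq hf.tok (NumE.const 2)) ((NumE.const 3).add hf.succ.tok) (NumE.const 2))

theorem opPos_le (T : List ℕ) (i : ℕ) : QLearn.opPos T i ≤ 1 + i * (4 + (unary T).length) := by
  induction i with
  | zero => simp [QLearn.opPos]
  | succ i ih =>
    have h : QLearn.opPos T (i + 1) =
      QLearn.opPos T i + QLearn.opLen T (QLearn.opPos T i) := rfl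
    have h' : QLearn.opLen T (QLearn.opPos T i) ≤ 4 + (unary T).length := by
      have := getD_le_unary T (QLearn.opPos T i + 1)
      unfold QLearn.opLen
      split_ifs <;> omega
    rw [h, Nat.succ_mul]
    omega

theorem opPos (hf : NumE c f) : NumE c fun a => QLearn.opPos (c.tbl a) (f a) :=
  NumE.recursion (s := fun a _ p => p + QLearn.opLen (c.tbl a) p)
    (V := fun a => 1 + f a * (4 + c.size a)) hf (NumE.const 1)
    (fun _ _ _ _ _ hπ _ hp => (hp.add (opLen hp)).congr fun b => by rw [hπ.tbl])
    ((PolyB.const 1).add (hf.1.mul ((PolyB.const 4).add PolyB.self)))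
    fun a i hi => (opPos_le _ _).trans (Nat.add_le_add_left
      (Nat.mul_le_mul hi (Nat.add_le_add_left (c.length_le a) 4)) 1)

theorem learnQ {q : α → ℕ} (hN : NumE c N) (hr : NumE c r) (hq : NumE c q) :
    NumE c fun a => QLearn.learnQ (N a) (r a) (q a) :=
  hN.ad (NumE.const 3) hr (NumE.const 0) hq

theorem learnStep {p i : α → ℕ} (hn : NumE c n) (hN : NumE c fun a => 2 ^ n a)
    (hr : NumE c r) (hp : NumE c p) (hi : NumE c i) :
    CircE c fun a => QLearn.learnStep (2 ^ n a) (n a) (c.tbl a) (r a) (p a) (i a) :=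
  ite (CondE.lt hp NumE.length_tbl)
    (ite (CondE.eq hp.tok (NumE.const 0)) (had (learnQ hN hr hp.succ.tok))
      (ite (CondE.eq hp.tok (NumE.const 1))
        (toff (learnQ hN hr hp.succ.tok) (learnQ hN hr (hp.add (NumE.const 2)).tok)
          (learnQ hN hr (hp.add (NumE.const 3)).tok))
        (ite (CondE.eq hp.tok (NumE.const 2))
          (lookup hN.one (fun _ _ _ _ hπ hl => (hπ.num hN).ancQ (NumE.const 5) (hπ.num hr)
              (NumE.const 0) hl)
            (fun _ _ _ _ hπ hj => learnQ (hπ.num hN) (hπ.num hr)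
              (NumE.tok_le hπ (((hπ.num hp).add (NumE.const 3)).add hj)))
            hn hN (learnQ hN hr (hp.add (NumE.const 2)).tok))
          (toff hN.one (learnQ hN hr hp.succ.tok)
            (hN.ad (NumE.const 4) hr (NumE.const 0) hi)))))
    nil

theorem learn (hn : NumE c n) (hN : NumE c fun a => 2 ^ n a) (hr : NumE c r) :
    CircE c fun a => QLearn.learn (2 ^ n a) (n a) (c.tbl a) (r a) :=
  flatMap NumE.length_tbl fun _ c' π i hπ hi =>
    (learnStep (c := c') (n := fun b => n (π b)) (hπ.num hn) (hπ.num hN) (hπ.num hr) (opPos hi)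
      hi).congr fun b => by rw [hπ.tbl]

end CircE

/-- The fields of the slot `s` are computed in polynomial time. -/
structure SlotE {α : Type} (c : Ctx α) (s : α → Slot) : Prop where
  m : NumE c fun a => (s a).m
  i : NumE c fun a => (s a).i
  k : NumE c fun a => (s a).k
  a : NumE c fun a => (s a).a
  b : NumE c fun a => (s a).b
  c : NumE c fun a => (s a).c

namespace SlotE

variable {α β : Type} {c : Ctx α} {c' : Ctx β} {π : β → α} {s : α → Slot} {l : α → ℕ}

theorem lift (hs : SlotE c s) (h : c.Le c' π) : SlotE c' fun b => s (π b) :=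
  ⟨h.num hs.m, h.num hs.i, h.num hs.k, h.num hs.a, h.num hs.b, h.num hs.c⟩

theorem idx (hs : SlotE c s) : NumE c fun a => (s a).idx :=
  hs.m.pair (hs.i.pair (hs.k.pair (hs.a.pair (hs.b.pair hs.c))))

theorem codeLen (hs : SlotE c s) : NumE c fun a => Slot.codeLen (s a).m :=
  (NumE.const 2).add ((NumE.const 3).mul hs.m.size)

theorem litLen (hs : SlotE c s) : NumE c fun a => (s a).litLen :=
  (hs.m.succ.add hs.i).add hs.codeLen

theorem litPos (hs : SlotE c s) (hl : NumE c l) : NumE c fun a => (s a).litPos (l a) :=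
  NumE.ite (CondE.lt hl hs.m.succ) hl (NumE.ite (CondE.lt hl (hs.m.succ.add hs.i))
    (hs.m.succ.add ((hl.sub hs.m.succ).mul hs.codeLen))
    ((hs.m.succ.add (hs.i.mul hs.codeLen)).add (hl.sub (hs.m.succ.add hs.i))))

/-- Case distinctions in the definition of a condition. -/
theorem _root_.QLearn.CondE.ite {P Q R : α → Prop} [DecidablePred P] [DecidablePred Q]
    [DecidablePred R] (hP : CondE c P) (hQ : CondE c Q) (hR : CondE c R) :
    CondE c fun a => if P a then Q a else R a := by
  obtain ⟨f, hf, e⟩ := hQ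
  obtain ⟨g, hg, e'⟩ := hR
  refine ⟨_, NumE.ite hP hf hg, fun a => ?_⟩
  by_cases h : P a <;> simp [h, e, e']

theorem codeBit (hs : SlotE c s) (hl : NumE c l) : CondE c fun a => (s a).codeBit (l a) = true := by
  have h2 := hl.sub (NumE.const 2)
  refine (CondE.ite (CondE.eq hl (NumE.const 0)) (CondE.eq hl hl)
    (CondE.ite (CondE.eq hl (NumE.const 1)) (CondE.eq hs.k (NumE.const 1))
      (CondE.ite (CondE.lt h2 hs.m.size) (CondE.testBit hs.a h2)
        (CondE.ite (CondE.lt h2 ((NumE.const 2).mul hs.m.size))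
          (CondE.testBit hs.b (h2.sub hs.m.size))
          (CondE.testBit hs.c (h2.sub ((NumE.const 2).mul hs.m.size))))))).congr fun a => ?_
  unfold Slot.codeBit
  split_ifs <;> simp

theorem litSgn (hs : SlotE c s) (hl : NumE c l) : CondE c fun a => (s a).litSgn (l a) = true := by
  refine (CondE.ite (CondE.lt hl hs.m) (CondE.lt hl hl)
    (CondE.ite (CondE.lt hl (hs.m.succ.add hs.i)) (CondE.eq hl hl)
      (hs.codeBit (hl.sub (hs.m.succ.add hs.i))))).congr fun a => ?_
  unfold Slot.litSgn
  split_ifs <;> simp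

end SlotE

namespace CircE

variable {α : Type} {c : Ctx α} {N n L k r t : α → ℕ}

theorem slots {F : α → Slot → Circuit} (hL : NumE c L)
    (hF : ∀ ⦃β : Type⦄ ⦃c' : Ctx β⦄ ⦃π : β → α⦄ ⦃s : β → Slot⦄, c.Le c' π → SlotE c' s →
      CircE c' fun b => F (π b) (s b)) :
    CircE c fun a => (QLearn.slots (L a)).flatMap (F a) := by
  have h : CircE c fun a => (List.range (L a)).flatMap fun m => (List.range (L a)).flatMap fun i =>
      (List.range 2).flatMap fun k => (List.range m).flatMap fun a' => (List.range m).flatMap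
        fun b => (List.range m).flatMap fun c' => F a ⟨m, i, k, a', b, c'⟩ := by
    refine flatMap hL fun _ _ _ _ h1 hm => flatMap (h1.num hL) fun _ _ _ _ h2 hi =>
      flatMap (NumE.const 2) fun _ _ _ _ h3 hk => flatMap (h3.num (h2.num hm)) fun _ _ _ _ h4 ha =>
      flatMap (h4.num (h3.num (h2.num hm))) fun _ _ _ _ h5 hb =>
      flatMap (h5.num (h4.num (h3.num (h2.num hm)))) fun _ _ _ _ h6 hc =>
      hF (h1.trans (h2.trans (h3.trans (h4.trans (h5.trans h6))))) ⟨?_, ?_, ?_, ?_, ?_, ?_⟩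
    · exact h6.num (h5.num (h4.num (h3.num (h2.num hm))))
    · exact h6.num (h5.num (h4.num (h3.num hi)))
    · exact h6.num (h5.num (h4.num hk))
    · exact h6.num (h5.num ha)
    · exact h6.num hb
    · exact hc
  refine h.congr fun a => ?_
  simp only [QLearn.slots, List.flatMap_assoc, List.flatMap_cons, List.flatMap_nil,
    List.append_nil]

theorem flagQ {s : α → Slot} (hN : NumE c N) (hr : NumE c r) (hs : SlotE c s) :
    NumE c fun a => QLearn.flagQ (N a) (r a) (s a) :=
  hN.ancQ (NumE.const 6) hr hs.idx hs.litLen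

theorem flags (hN : NumE c N) (hr : NumE c r) (hL : NumE c L) :
    CircE c fun a => QLearn.flags (N a) (r a) (L a) :=
  slots hL fun _ _ _ _ hπ hs => chain (hπ.num hN).one
    (fun _ _ _ _ hρ hl => (hρ.num (hπ.num hN)).ancQ (NumE.const 6) (hρ.num (hπ.num hr))
      (hρ.num hs.idx) hl)
    (fun _ _ _ _ hρ hl => learnQ (hρ.num (hπ.num hN)) (hρ.num (hπ.num hr)) ((hs.lift hρ).litPos hl))
    (fun _ _ _ _ hρ hl => (hs.lift hρ).litSgn hl) hs.litLen

theorem simQ {q : α → ℕ} (hN : NumE c N) (hr : NumE c r) (ht : NumE c t) (hq : NumE c q) :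
    NumE c fun a => QLearn.simQ (N a) (r a) (t a) (q a) :=
  hN.ad (NumE.const 10) hr ht hq

theorem simStep {s : α → Slot} (hN : NumE c N) (hr : NumE c r) (ht : NumE c t) (hs : SlotE c s) :
    CircE c fun a => QLearn.simStep (N a) (r a) (t a) (s a) :=
  ite (CondE.eq hs.k (NumE.const 0))
    (ite (CondE.eq hs.b (NumE.const 0)) (ite (CondE.eq hs.c (NumE.const 0))
      (ctrlHad (flagQ hN hr hs) (simQ hN hr ht hs.a) (hN.ad (NumE.const 11) hr ht hs.idx)) nil) nil)
    (ite (CondE.eq hs.a hs.b) nil (ite (CondE.eq hs.a hs.c) nil (ite (CondE.eq hs.b hs.c) nil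
      (ctrlToff (flagQ hN hr hs) (hN.ad (NumE.const 12) hr ht hs.idx) (simQ hN hr ht hs.a)
        (simQ hN hr ht hs.b) (simQ hN hr ht hs.c)))))

theorem simulate (hN : NumE c N) (hr : NumE c r) (ht : NumE c t) (hL : NumE c L) :
    CircE c fun a => QLearn.simulate (N a) (r a) (t a) (L a) :=
  slots hL fun _ _ _ _ hπ hs => simStep (hπ.num hN) (hπ.num hr) (hπ.num ht) hs

theorem numE₂_ad {k' : ℕ} (hN : NumE c N) (hr : NumE c r) (ht : NumE c t) :
    NumE₂ c fun a j => ad (N a) k' (r a) (t a) j := fun _ _ _ _ hπ hj =>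
  (hπ.num hN).ad (NumE.const k') (hπ.num hr) (hπ.num ht) hj

theorem sample (hn : NumE c n) (hN : NumE c fun a => 2 ^ n a) (hL : NumE c L) (hk : NumE c k)
    (hr : NumE c r) (ht : NumE c t) :
    CircE c fun a => QLearn.sample (2 ^ n a) (n a) (L a) (k a) (r a) (t a) := by
  have hx : NumE₂ c fun a => randQ (2 ^ n a) (r a) (t a) := numE₂_ad hN hr ht
  have hval : NumE c fun a => valQ (2 ^ n a) (r a) (t a) :=
    hN.ad (NumE.const 9) hr ht (NumE.const 0)
  have hdiff : NumE c fun a => diffQ (2 ^ n a) (r a) (t a) :=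
    hN.ad (NumE.const 9) hr ht (NumE.const 1)
  refine append (hadamards hx hn) (append (append ?_ ?_) (append (simulate hN hr ht hL) ?_))
  · exact lookup hN.one (fun _ _ _ _ hπ hl => (hπ.num hN).ancQ (NumE.const 8) (hπ.num hr)
      (hπ.num ht) hl) hx hn hN hval
  · exact flatMap hn fun _ _ _ _ hπ hj => toff (hπ.num hN).one (hx hπ hj)
      (simQ (hπ.num hN) (hπ.num hr) (hπ.num ht) hj)
  · exact cons (toff hN.one (simQ hN hr ht (NumE.const 0)) hdiff) (cons (toff hN.one hval hdiff)
      (counterRow hN.one hdiff (numE₂_ad hN hr ht) (numE₂_ad hN hr ht.succ) hk))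

theorem round {θ M : α → ℕ} (hn : NumE c n) (hN : NumE c fun a => 2 ^ n a) (hL : NumE c L)
    (hθ : NumE c θ) (hM : NumE c M) (hr : NumE c r) :
    CircE c fun a => QLearn.round (2 ^ n a) (n a) (c.tbl a) (L a) (θ a) (M a) (r a) := by
  refine append (learn hn hN hr) (append (flags hN hr hL) (append (toff hN.one hN.two
    (hN.ad (NumE.const 13) hr (NumE.const 0) (NumE.const 0))) (append ?_ (toff
      (hN.ad (NumE.const 2) hr (NumE.const 0) (NumE.const 0)) (hN.ad (NumE.const 13) hr hM hθ)
        (hN.ad (NumE.const 2) hr.succ (NumE.const 0) (NumE.const 0))))))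
  have h : CircE c fun a => (List.range (M a)).flatMap
      (QLearn.sample (2 ^ n a) (n a) (L a) (θ a + 1) (r a)) :=
    flatMap hM fun _ _ π _ hπ ht => sample (n := fun b => n (π b)) (hπ.num hn) (hπ.num hN)
      (hπ.num hL) (hπ.num hθ).succ (hπ.num hr) ht
  exact h.congr fun a => by rw [samples, List.range_eq_range']

theorem tester {θ M R J : α → ℕ} (hn : NumE c n) (hN : NumE c fun a => 2 ^ n a) (hL : NumE c L)
    (hθ : NumE c θ) (hM : NumE c M) (hR : NumE c R) (hJ : NumE c J) :
    CircE c fun a => QLearn.tester (2 ^ n a) (n a) (c.tbl a) (L a) (θ a) (M a) (R a) (J a) := by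
  have hprep : ∀ i, NumE₂ c fun a => prepQ (2 ^ n a) i := fun i _ _ _ _ hπ hj =>
    (hπ.num hN).ad (NumE.const 1) (NumE.const 0) hj (NumE.const i)
  have hacc : NumE c fun a => accQ (2 ^ n a) (R a) :=
    hN.ad (NumE.const 2) hR (NumE.const 0) (NumE.const 0)
  refine append (append (prepareBits (hprep 0) (hprep 1) hJ)
    (append (prepareOr hN.one hN.two (hprep 0) (hprep 1) (hprep 2) (hprep 3) hJ)
      (append (toff hN.one hN.two (hN.ad (NumE.const 2) (NumE.const 0) (NumE.const 0)
        (NumE.const 0))) ?_)))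
    (cons (toff hN.one (NumE.const 0) hacc) (toff hN.one hacc (NumE.const 0)))
  have h : CircE c fun a => (List.range (R a)).flatMap
      (QLearn.round (2 ^ n a) (n a) (c.tbl a) (L a) (θ a) (M a)) :=
    flatMap hR fun _ _ π _ hπ hr => (round (n := fun b => n (π b)) (hπ.num hn) (hπ.num hN)
      (hπ.num hL) (hπ.num hθ) (hπ.num hM) hr).congr fun b => by rw [hπ.tbl]
  exact h.congr fun a => by rw [rounds, List.range_eq_range']

end CircE

/-! ### The parameters of the tester -/

/-- The least `G` with `X ≤ 2 * G ^ 2`. -/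
def gap (X : ℕ) : ℕ := Nat.rec 0 (fun _ v => if 2 * (v * v) < X then v + 1 else v) X

theorem gap_spec {X : ℕ} (hX : 0 < X) : X ≤ 2 * gap X ^ 2 ∧ 2 * (gap X - 1) ^ 2 < X ∧ gap X ≤ X := by
  have aux : ∀ j, let v : ℕ := Nat.rec 0 (fun _ v => if 2 * (v * v) < X then v + 1 else v) j
      (v = j ∨ X ≤ 2 * v ^ 2) ∧ 2 * (v - 1) ^ 2 < X ∧ v ≤ j := by
    intro j
    induction j with
    | zero => simpa using hX
    | succ j ih =>
      simp only at ih ⊢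
      generalize (Nat.rec 0 (fun _ v => if 2 * (v * v) < X then v + 1 else v) j : ℕ) = v at ih ⊢
      split_ifs with h
      · refine ⟨Or.inl ?_, by simpa [sq] using h, by omega⟩
        rcases ih.1 with e | e
        · rw [e]
        · rw [sq] at e; omega
      · exact ⟨Or.inr (by rw [sq]; omega), ih.2.1, by omega⟩
  obtain ⟨h1, h2, h3⟩ := aux X
  refine ⟨?_, h2, h3⟩
  rcases h1 with e | e
  · have e' : gap X = X := e
    rw [e', sq]
    nlinarith
  · exact e

theorem isGap_gap (n s : ℕ) : IsGap n s (gap (2 ^ n * (s + 2))) := by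
  obtain ⟨h1, h2, -⟩ := gap_spec (X := 2 ^ n * (s + 2)) (by positivity)
  exact ⟨h1, h2⟩

/-- The number of gates, computed from the description of an oracle circuit. -/
def countGates (T : List ℕ) : ℕ :=
  Nat.rec 0 (fun i v => if opPos T i < T.length then
    if T.getD (opPos T i) 0 = 3 then v else v + 1 else v) T.length

theorem countGates_tokens (Q : OracleCircuit) : countGates Q.tokens = Q.size := by
  set T := Q.tokens with hT
  have aux : ∀ j, (Nat.rec 0 (fun i v => if opPos T i < T.length then
      if T.getD (opPos T i) 0 = 3 then v else v + 1 else v) j : ℕ) =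
      ((Q.gates.take j).map OracleGate.cost).sum := by
    intro j
    induction j with
    | zero => simp
    | succ j ih =>
      change (if opPos T j < T.length then if T.getD (opPos T j) 0 = 3 then _ else _ + 1 else _) = _
      rw [ih]
      by_cases hj : j < Q.gates.length
      · have hd := drop_opPos Q hj.le
        rw [← hT, List.drop_eq_getElem_cons hj, List.flatMap_cons] at hd
        rw [List.take_succ_eq_append_getElem hj, List.map_append, List.sum_append]
        have hne : (Q.gates[j]).tokens ≠ [] := by
          cases Q.gates[j] with
          | gate g => cases g <;> simp [OracleGate.tokens, Gate.tokens]
          | query xs t => simp [OracleGate.tokens]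
          | meas q => simp [OracleGate.tokens]
        have hlt : opPos T j < T.length := by
          by_contra hc
          rw [List.drop_eq_nil_of_le (not_lt.1 hc)] at hd
          exact hne (List.append_eq_nil_iff.1 hd.symm).1
        have h0 := getD_add_eq (k := 0) hd (List.length_pos_of_ne_nil hne)
        rw [add_zero] at h0
        rw [if_pos hlt, h0]
        cases Q.gates[j] with
        | gate g => cases g <;> simp [OracleGate.tokens, Gate.tokens, OracleGate.cost]
        | query xs t => simp [OracleGate.tokens, OracleGate.cost]
        | meas q => simp [OracleGate.tokens, OracleGate.cost]
      · have := length_le_opPos Q (not_lt.1 hj)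
        rw [if_neg (by rw [hT]; omega), List.take_of_length_le (by omega),
          List.take_of_length_le (by omega)]
  rw [countGates, aux, List.take_of_length_le (by rw [hT]; exact length_gates_le Q)]
  rfl

section parameters

variable {α : Type} {c : Ctx α} {n X : α → ℕ}

theorem NumE.gap (hX : NumE c X) : NumE c fun a => QLearn.gap (X a) :=
  NumE.recursion (s := fun a _ v => if 2 * (v * v) < X a then v + 1 else v) hX (NumE.const 0)
    (fun _ _ _ _ _ hπ _ hv => NumE.ite (CondE.lt ((NumE.const 2).mul (hv.mul hv)) (hπ.num hX))
      hv.succ hv) hX.1 fun a i hi => by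
      refine le_trans ?_ hi
      induction i with
      | zero => simp
      | succ i ih =>
        have := ih (by omega)
        simp only
        split_ifs <;> omega

theorem NumE.countGates : NumE c fun a => QLearn.countGates (c.tbl a) :=
  NumE.recursion (s := fun a i v => if opPos (c.tbl a) i < (c.tbl a).length then
    if (c.tbl a).getD (opPos (c.tbl a) i) 0 = 3 then v else v + 1 else v) NumE.length_tbl
    (NumE.const 0) (fun β c' π i v hπ hi hv => by
      have hp := CircE.opPos hi
      refine (NumE.ite (CondE.lt hp NumE.length_tbl) (NumE.ite (CondE.eq hp.tok (NumE.const 3)) hv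
        hv.succ) hv).congr fun b => ?_
      simp only [hπ.tbl]) NumE.length_tbl.1 fun a i hi => by
      refine le_trans ?_ hi
      induction i with
      | zero => simp
      | succ i ih =>
        have := ih (by omega)
        simp only
        split_ifs <;> omega

/-- The tester is printed in polynomial time from the description of the learner. -/
theorem CircE.naturalTester {Q : α → OracleCircuit} (hQ : ∀ a, c.tbl a = (Q a).tokens)
    (hn : NumE c n) (hN : NumE c fun a => 2 ^ n a) :
    CircE c fun a => QLearn.naturalTester (n a) (Q a)
      (QLearn.gap (2 ^ n a * ((Q a).size + 2))) := by
  have hG : NumE c fun a => QLearn.gap (2 ^ n a * ((Q a).size + 2)) :=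
    (hN.mul (NumE.countGates.add (NumE.const 2))).gap.congr fun a => by
      rw [hQ, countGates_tokens]
  have hL : NumE c fun a => (Q a).outLen := (NumE.const 0).tok.congr fun a => by rw [hQ]; rfl
  refine (tester hn hN hL (((NumE.const 200).mul hN).sub ((NumE.const 800).mul hG))
    ((NumE.const 400).mul hN) (NumE.const 200) (NumE.const 8)).congr fun a => ?_
  rw [hQ]
  rfl

end parameters

/-! ### The printing algorithm -/

namespace Prog

/-- A bound on the registers that a program uses. -/
def bound : Prog → ℕ
  | skip => 0
  | push r _ => r + 1
  | pop r => r + 1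
  | seq p q => max p.bound q.bound
  | branch r pe p0 p1 => max (r + 1) (max pe.bound (max p0.bound p1.bound))
  | loop r p => max (r + 1) p.bound

/-- The memory that agrees with `m` below `K` and with `e` from there on. -/
def mix (K : ℕ) (m e : Mem) : Mem := fun r => if r < K then m r else e r

theorem update_mix {K r : ℕ} (hr : r < K) (m e : Mem) (l : List Bool) :
    Function.update (mix K m e) r l = mix K (Function.update m r l) e := by
  funext x
  by_cases hx : x = r
  · subst hx; simp [mix, hr]
  · simp [mix, hx]

theorem mix_apply {K r : ℕ} (hr : r < K) (m e : Mem) : mix K m e r = m r := if_pos hr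

/-- The registers that a program does not use do not matter. -/
theorem Runs.mix {p : Prog} {m m' : Mem} {t : ℕ} (h : p.Runs m m' t) {K : ℕ} (hK : p.bound ≤ K)
    (e : Mem) : p.Runs (mix K m e) (mix K m' e) t := by
  induction h with
  | skip m => exact .skip _
  | push r v m =>
    have := Runs.push r v (Prog.mix K m e)
    rwa [update_mix hK, mix_apply hK] at this
  | pop r m =>
    have := Runs.pop r (Prog.mix K m e)
    rwa [update_mix hK, mix_apply hK] at this
  | seq _ _ ih ih' =>
    simp only [bound, max_le_iff] at hK
    exact .seq (ih hK.1) (ih' hK.2)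
  | branchEmpty hm _ ih =>
    simp only [bound, max_le_iff] at hK
    exact .branchEmpty (by rwa [mix_apply hK.1]) (ih hK.2.1)
  | branchZero hm _ ih =>
    simp only [bound, max_le_iff] at hK
    exact .branchZero (by rwa [mix_apply hK.1]) (ih hK.2.2.1)
  | branchOne hm _ ih =>
    simp only [bound, max_le_iff] at hK
    exact .branchOne (by rwa [mix_apply hK.1]) (ih hK.2.2.2)
  | loopDone hm =>
    simp only [bound, max_le_iff] at hK
    exact .loopDone (by rwa [mix_apply hK.1])
  | loopStep hm _ _ ih ih' =>
    have hK' := hK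
    simp only [bound, max_le_iff] at hK
    exact .loopStep (by rwa [mix_apply hK.1]) (ih hK.2) (ih' hK')

/-- A program writes at most one bit per step. -/
theorem Runs.length_le {p : Prog} {m m' : Mem} {t : ℕ} (h : p.Runs m m' t) (r : ℕ) :
    (m' r).length ≤ (m r).length + t := by
  induction h with
  | skip m => omega
  | push r' v m =>
    by_cases hr : r = r'
    · subst hr; simp
    · simp [hr]
  | pop r' m =>
    by_cases hr : r = r'
    · subst hr; simp; omega
    · simp [hr]
  | seq _ _ ih ih' => omega
  | branchEmpty _ _ ih => omega
  | branchZero _ _ ih => omega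
  | branchOne _ _ ih => omega
  | loopDone _ => omega
  | loopStep _ _ _ ih ih' => omega

/-- Empties the registers below `k`, except for the register `1`. -/
def clearAll : ℕ → Prog
  | 0 => skip
  | k + 1 => (clearAll k).seq (if k = 1 then skip else clear k)

theorem run_clearAll (k : ℕ) {m : Mem} {l : ℕ} (hl : ∀ r < k, (m r).length ≤ l) :
    (clearAll k).Run m (fun r => if r < k ∧ r ≠ 1 then [] else m r) (k * (2 * l + 1) + 1) := by
  induction k with
  | zero => simpa [clearAll] using run_skip m
  | succ k ih =>
    have h1 := ih fun r hr => hl r (by omega)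
    have hk := hl k (by omega)
    have e : (k + 1) * (2 * l + 1) = k * (2 * l + 1) + (2 * l + 1) := Nat.succ_mul _ _
    rw [clearAll]
    split_ifs with h
    · refine ((h1.seq (run_skip _)).of_eq ?_).mono (by omega)
      subst h
      funext r
      have : r < 1 + 1 ∧ r ≠ 1 ↔ r < 1 ∧ r ≠ 1 := by omega
      simp only [this]
    · refine ((h1.seq (run_clear k _)).of_eq ?_).mono ?_
      · funext r
        by_cases hr : r = k
        · subst hr; simp [h]
        · have : r < k + 1 ↔ r < k := by omega
          simp [hr, this]
      · simp
        omega

end Prog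

theorem PolyB.exists_pow {α : Type*} {S f : α → ℕ} (hf : PolyB S f) (hS : ∀ a, 1 ≤ S a) :
    ∃ b, ∀ a, f a ≤ b * S a ^ b + b := by
  obtain ⟨k, hk⟩ := hf
  refine ⟨3 ^ k + k, fun a => (hk a).trans ?_⟩
  have h1 : (S a + 2) ^ k ≤ (3 * S a) ^ k := Nat.pow_le_pow_left (by have := hS a; omega) k
  have h2 : S a ^ k ≤ S a ^ (3 ^ k + k) := Nat.pow_le_pow_right (hS a) (Nat.le_add_left _ _)
  rw [mul_pow] at h1
  calc (S a + 2) ^ k ≤ 3 ^ k * S a ^ k := h1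
    _ ≤ (3 ^ k + k) * S a ^ (3 ^ k + k) := Nat.mul_le_mul (Nat.le_add_right _ _) h2
    _ ≤ _ := Nat.le_add_right _ _

theorem length_le_listing (U : Circuit) : U.length ≤ U.listing.length := by
  refine le_trans ?_ (length_le_unary _)
  induction U with
  | nil => simp
  | cons g U ih =>
    rw [List.flatMap_cons, List.length_append, List.length_cons]
    have : 1 ≤ g.tokens.length := by cases g <;> simp [Gate.tokens]
    omega

section printer

variable {T : ℕ → ℕ} {Q : ℕ → OracleCircuit}

/-- The lengths for which the learner is fast enough. -/
abbrev Good (T : ℕ → ℕ) : Type := {n : ℕ // 1 ≤ n ∧ T n ≤ 2 ^ n}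

/-- The situation in which register `K` holds `2 ^ n`. -/
def powCtx (T : ℕ → ℕ) (K : ℕ) (hK : 2 ≤ K) : Ctx (Good T) where
  base := K + 1
  two_le := by omega
  Inv a m := m 0 = [] ∧ m K = List.replicate (2 ^ a.1) true
  tbl _ := []
  size a := 2 ^ a.1
  congr := fun ⟨h, h'⟩ hm => ⟨by rw [hm 0 (by omega) (by omega), h],
    by rw [hm K (by omega) (by omega), h']⟩
  table h := h.1
  length_le a := by simp [unary]

/-- The situation in which register `0` holds the description of the learner, register `K` holds
`2 ^ n`, and register `K + 1` holds `n`. -/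
def learnCtx (T : ℕ → ℕ) (Q : ℕ → OracleCircuit) (K : ℕ) (hK : 2 ≤ K) : Ctx (Good T) where
  base := K + 2
  two_le := by omega
  Inv a m := m 0 = unary (Q a.1).tokens ∧ m K = List.replicate (2 ^ a.1) true ∧
    m (K + 1) = List.replicate a.1 true
  tbl a := (Q a.1).tokens
  size a := 2 ^ a.1 + (unary (Q a.1).tokens).length
  congr := fun ⟨h, h', h''⟩ hm => ⟨by rw [hm 0 (by omega) (by omega), h],
    by rw [hm K (by omega) (by omega), h'], by rw [hm (K + 1) (by omega) (by omega), h'']⟩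
  table h := h.1
  length_le a := Nat.le_add_left _ _

/-- If the learner is printed in polynomial time, then so is the tester. The algorithm stores `2 ^ n`
in a register that the learner's algorithm `p` does not use, computes `n` from it, calls `p` on
`1 ^ n`, empties the registers that `p` used, and prints the tester from the output of `p`. -/
theorem exists_printer {p : Prog} {a : ℕ}
    (hp : ∀ n : ℕ, 1 ≤ n → p.Outputs (List.replicate n true) (Q n).listing (a * (n + T n) ^ a + a)) :
    ∃ (P : Prog) (b : ℕ), ∀ n : ℕ, 1 ≤ n → T n ≤ 2 ^ n →
      (naturalTester n (Q n) (gap (2 ^ n * ((Q n).size + 2)))).length ≤ b * (2 ^ n) ^ b + b ∧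
      P.Outputs (List.replicate (2 ^ n) true)
        (naturalTester n (Q n) (gap (2 ^ n * ((Q n).size + 2)))).listing (b * (2 ^ n) ^ b + b) := by
  set S : Good T → ℕ := fun x => 2 ^ x.1 with hS
  set K := max p.bound 2 with hKdef
  have hK2 : 2 ≤ K := le_max_right _ _
  have hKp : p.bound ≤ K := le_max_left _ _
  -- the time that the learner's algorithm takes
  set τ : Good T → ℕ := fun x => a * (x.1 + T x.1) ^ a + a with hτ
  have hn_le : ∀ x : Good T, x.1 ≤ 2 ^ x.1 := fun x => Nat.lt_two_pow_self.le
  have hτS : PolyB S τ := by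
    refine (((PolyB.const a).mul ((PolyB.self.add PolyB.self).pow a)).add (PolyB.const a)).mono
      fun x => ?_
    have := hn_le x
    have := x.2.2
    have hSx : S x = 2 ^ x.1 := rfl
    exact Nat.add_le_add_right (Nat.mul_le_mul_left _ (Nat.pow_le_pow_left (by omega) _)) _
  have hlist : ∀ x : Good T, (unary (Q x.1).tokens).length ≤ τ x := by
    intro x
    obtain ⟨m', t, ht, hr, e⟩ := hp x.1 x.2.1
    have := hr.length_le 1
    rw [e] at this
    simp only [one_ne_zero, if_false, List.length_nil, zero_add] at this
    exact this.trans ht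
  have hsize : PolyB S (learnCtx T Q K hK2).size :=
    (PolyB.self.add hτS).mono fun x => Nat.add_le_add_left (hlist x) _
  -- the pieces of the program
  have hnum : NumE (powCtx T K hK2) fun x => x.1 := by
    have h : NumE (powCtx T K hK2) fun x => 2 ^ x.1 :=
      NumE.of_register (r := K) (Nat.lt_succ_self K) (fun _ _ h => h.2) fun x => le_rfl
    exact (h.size.sub (NumE.const 1)).congr fun x => by rw [Nat.size_pow]; rfl
  obtain ⟨p₁, t₁, ht₁, hp₁⟩ := hnum.2 (K + 1) le_rfl
  have hcirc : CircE (learnCtx T Q K hK2) fun x =>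
      naturalTester x.1 (Q x.1) (gap (2 ^ x.1 * ((Q x.1).size + 2))) :=
    CircE.naturalTester (fun _ => rfl)
      (NumE.of_register (r := K + 1) (Nat.lt_succ_self _) (fun _ _ h => h.2.2)
        fun x => (hn_le x).trans (Nat.le_add_right _ _))
      (NumE.of_register (r := K) (by simp [learnCtx]) (fun _ _ h => h.2.1)
        fun x => Nat.le_add_right _ _)
  obtain ⟨p₂, t₂, ht₂, hp₂⟩ := hcirc (K + 2) le_rfl
  set U : Good T → Circuit := fun x =>
    naturalTester x.1 (Q x.1) (gap (2 ^ x.1 * ((Q x.1).size + 2))) with hU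
  set P : Prog := ((Prog.move 0 K).seq (p₁.seq ((Prog.copy (K + 1) 0 (K + 2)).seq (p.seq
    ((Prog.clearAll K).seq ((Prog.move 1 (K + 2)).seq ((Prog.move (K + 2) 0).seq p₂))))))).seq
      ((Prog.move 1 (K + 2)).seq ((Prog.move (K + 2) (K + 3)).seq (Prog.move (K + 3) 1))) with hP
  set W : Good T → ℕ := fun x => (4 * S x + 1) + (t₁ x + ((8 * S x + 2) + (τ x +
    ((K * (2 * (S x + τ x) + 1) + 1) + ((4 * τ x + 1) + ((4 * τ x + 1) + (t₂ x)))))))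
    with hW
  have ht₂S : PolyB S t₂ := ht₂.trans hsize
  have hWS : PolyB S W := by
    refine (((PolyB.const 4).mul PolyB.self).add (PolyB.const 1)).add (ht₁.add
      ((((PolyB.const 8).mul PolyB.self).add (PolyB.const 2)).add (hτS.add
        ((((PolyB.const K).mul (((PolyB.const 2).mul (PolyB.self.add hτS)).add
          (PolyB.const 1))).add (PolyB.const 1)).add
        ((((PolyB.const 4).mul hτS).add (PolyB.const 1)).add
          ((((PolyB.const 4).mul hτS).add (PolyB.const 1)).add ht₂S))))))
  have hmain : ∀ x : Good T, ((Prog.move 0 K).seq (p₁.seq ((Prog.copy (K + 1) 0 (K + 2)).seq (p.seq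
      ((Prog.clearAll K).seq ((Prog.move 1 (K + 2)).seq ((Prog.move (K + 2) 0).seq p₂))))))).Run
      (fun r => if r = 0 then List.replicate (2 ^ x.1) true else [])
      (fun r => if r = 0 then unary (Q x.1).tokens else if r = 1 then (U x).listing.reverse else
        if r = K then List.replicate (2 ^ x.1) true else
        if r = K + 1 then List.replicate x.1 true else []) (W x) := by
    intro x
    have n1 : K ≠ 0 := by omega
    have n2 : K ≠ 1 := by omega
    set e : Mem := fun r => if r = K then List.replicate (2 ^ x.1) true else
      if r = K + 1 then List.replicate x.1 true else [] with he
    obtain ⟨m', t, ht, hr, hm'⟩ := hp x.1 x.2.1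
    have hlen : ∀ r, (m' r).length ≤ S x + τ x := by
      intro r
      refine (hr.length_le r).trans (Nat.add_le_add ?_ ht)
      split_ifs
      · simpa using hn_le x
      · simp
    have s1 := Prog.run_move (r := 0) (d := K) (Ne.symm n1)
      (fun r => if r = 0 then List.replicate (2 ^ x.1) true else [])
    have s2 := hp₁ x (Function.update (Function.update
      (fun r => if r = 0 then List.replicate (2 ^ x.1) true else []) 0 []) K
        (((if 0 = 0 then List.replicate (2 ^ x.1) true else []).reverse ++
          if K = 0 then List.replicate (2 ^ x.1) true else [])))
      ⟨by simp [n1.symm], by simp [n1]⟩ (fun r hr => by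
        simp [show r ≠ K by omega, show r ≠ 0 by omega])
    have s3 := Prog.run_copy (r := K + 1) (d := 0) (e := K + 2) (k := x.1) (m := e) (by omega)
      (by omega) (by omega) (by simp [he]) (by simp [he])
    have s4 := hr.mix hKp e
    have s5 := Prog.run_clearAll K (m := Prog.mix K m' e) (l := S x + τ x) (fun r hr => by
      rw [Prog.mix_apply hr]; exact hlen r)
    set m₅ : Mem := fun r => if r < K ∧ r ≠ 1 then [] else Prog.mix K m' e r with hm₅
    have h51 : m₅ 1 = unary (Q x.1).tokens := by
      simp only [hm₅, ne_eq, not_true_eq_false, and_false, if_false]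
      rw [Prog.mix_apply (by omega), hm']
      rfl
    have s6 := Prog.run_move (r := 1) (d := K + 2) (by omega) m₅
    have h52 : ∀ r, r ≠ 1 → m₅ r = e r := by
      intro r hr
      by_cases hrK : r < K
      · simp [hm₅, hrK, hr, he, show r ≠ K by omega, show r ≠ K + 1 by omega]
      · simp [hm₅, hrK, Prog.mix]
    rw [h51, h52 (K + 2) (by omega)] at s6
    have s7 := Prog.run_move (r := K + 2) (d := 0) (by omega) (Function.update (Function.update m₅ 1
      []) (K + 2) ((unary (Q x.1).tokens).reverse ++ e (K + 2)))
    set m₇ : Mem := fun r => if r = 0 then unary (Q x.1).tokens else e r with hm₇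
    have s8 := hp₂ x m₇ ⟨by simp [hm₇], by simp [hm₇, he, n1], by simp [hm₇, he]⟩ (fun r hr => by
      simp [hm₇, he, show r ≠ K by omega, show r ≠ K + 1 by omega, show r ≠ 0 by omega])
    have e2 : K + 2 ≠ 0 := by omega
    have eK2 : e (K + 2) = [] := by simp [he]
    have h7 := hlist x
    refine (s1.mono (by simp [hS])).seq ((s2.of_eq ?_).seq ((s3.mono ?_).seq
      (Prog.Run.seq ⟨t, ht, ?_⟩ (s5.seq ((s6.mono (by omega)).seq (((s7.mono ?_).of_eq ?_).seq
        (s8.of_eq ?_)))))))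
    · funext r
      by_cases h1 : r = K + 1
      · subst h1; simp [he]
      · by_cases h2 : r = K
        · subst h2; simp [he, n1]
        · by_cases h3 : r = 0
          · subst h3; simp [he, n1.symm]
          · simp [he, h1, h2, h3]
    · have := hn_le x
      have : 8 * x.1 ≤ 8 * 2 ^ x.1 := by omega
      simpa [hS] using this
    · refine Eq.mp ?_ s4
      congr 1
      funext r
      by_cases h0 : r = 0
      · subst h0; simp [Prog.mix, he, n1, n1.symm, show 0 < K by omega]
      · by_cases hrK : r < K
        · simp [Prog.mix, hrK, h0, he, show r ≠ K by omega, show r ≠ K + 1 by omega]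
        · simp [Prog.mix, hrK, h0]
    · simp [eK2]
      omega
    · funext r
      by_cases h0 : r = 0
      · subst h0
        simp [hm₇, h52 0 (by omega), he, n1.symm]
      · by_cases h1 : r = 1
        · subst h1
          simp [hm₇, he, n1, n2.symm]
        · by_cases h2 : r = K + 2
          · subst h2
            simp [hm₇, eK2]
          · simp [hm₇, h0, h1, h2, h52 r h1]
    · funext r
      have h71 : m₇ 1 = [] := by simp [hm₇, he, n1, n2.symm]
      by_cases h1 : r = 1
      · subst h1
        simp [h71, Circuit.listing, hU]
      · simp [h1, hm₇, he]
  set W' : Good T → ℕ := fun x => W x + 12 * W x + 3 with hW'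
  have hW'S : PolyB S W' := (hWS.add ((PolyB.const 12).mul hWS)).add (PolyB.const 3)
  obtain ⟨b, hb⟩ := hW'S.exists_pow fun x => Nat.one_le_two_pow
  refine ⟨P, b, fun n hn hT => ?_⟩
  set x : Good T := ⟨n, hn, hT⟩
  have hx := hmain x
  have hlenU : (U x).listing.length ≤ W x := by
    obtain ⟨t, ht, hr⟩ := hx
    have := hr.length_le 1
    simp at this
    omega
  have hW'b : W' x ≤ b * (2 ^ n) ^ b + b := hb x
  refine ⟨(length_le_listing (U x)).trans (hlenU.trans (le_trans ?_ hW'b)), ?_⟩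
  · simp only [hW']
    omega
  -- the output was printed in reverse, and three moves reverse it
  have q1 := Prog.run_move (r := 1) (d := K + 2) (by omega) (fun r =>
    if r = 0 then unary (Q x.1).tokens else if r = 1 then (U x).listing.reverse else
      if r = K then List.replicate (2 ^ x.1) true else
      if r = K + 1 then List.replicate x.1 true else [])
  generalize hm₁ : Function.update _ (K + 2) _ = m₁ at q1
  have e1 : m₁ (K + 2) = (U x).listing := by
    rw [← hm₁]
    simp
  have e1' : m₁ (K + 3) = [] ∧ m₁ 1 = [] := by
    rw [← hm₁]
    simp
  have q2 := Prog.run_move (r := K + 2) (d := K + 3) (by omega) m₁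
  rw [e1, e1'.1] at q2
  generalize hm₂ : Function.update _ (K + 3) _ = m₂ at q2
  have e3 : m₂ (K + 3) = (U x).listing.reverse ∧ m₂ 1 = [] := by
    rw [← hm₂]
    simp [e1'.2]
  have q3 := Prog.run_move (r := K + 3) (d := 1) (by omega) m₂
  rw [e3.1, e3.2] at q3
  obtain ⟨t, ht, hr⟩ := hx.seq (q1.seq (q2.seq q3))
  refine ⟨_, t, ht.trans (le_trans ?_ hW'b), hr, by simp; rfl⟩
  simp [hW']
  omega

end printer

end QLearn

theorem theorem3p1 :
    ∃ lam : ℝ, 1 ≤ lam ∧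
      ∀ (𝒞 : QLearn.CircuitClass) (k : ℕ) (γ δ ε : ℕ → ℝ) (T : ℕ → ℕ),
        (∀ n, 0 ≤ γ n ∧ γ n ≤ 1 / 2) →
        (∀ᶠ n : ℕ in atTop, lam * (2 : ℝ) ^ (-(n : ℝ) / 2) ≤ γ n) →
        (∀ᶠ n : ℕ in atTop, (T n : ℝ) ≤ γ n ^ 2 * 2 ^ n / (lam * n)) →
        (∀ᶠ n : ℕ in atTop, δ n ≤ 0.99) →
        (∀ᶠ n : ℕ in atTop, ε n ≤ 1 / 2 - γ n) →
        QLearn.QuantumLearnable (fun n => 𝒞 n (n ^ k)) T ε δ →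
        QLearn.HasPromiseBQPNaturalProperty (fun n => 𝒞 n (n ^ k)) := by
  refine ⟨100, by norm_num, fun 𝒞 k γ δ ε T hγ h1 h2 h3 h4 ⟨Q, p, a, hQ⟩ => ?_⟩
  obtain ⟨P, b, hP⟩ := QLearn.exists_printer fun n hn => (hQ n hn).2.2.1
  refine ⟨fun n => QLearn.naturalTester n (Q n) (QLearn.gap (2 ^ n * ((Q n).size + 2))), P, b, ?_⟩
  filter_upwards [h1, h2, h3, h4, eventually_ge_atTop 1] with n h1 h2 h3 h4 hn
  obtain ⟨hWF, hsize, -, hlearn⟩ := hQ n hn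
  obtain ⟨hγ0, hγ1⟩ := hγ n
  have hn' : (1 : ℝ) ≤ n := by exact_mod_cast hn
  have hT : 100 * (n * T n : ℝ) ≤ γ n ^ 2 * 2 ^ n := by
    rw [le_div_iff₀ (by positivity)] at h2
    linarith
  have hT' : 100 * (T n : ℝ) ≤ γ n ^ 2 * 2 ^ n := by
    have : (T n : ℝ) ≤ n * T n := le_mul_of_one_le_left (Nat.cast_nonneg _) hn'
    linarith
  have hγsq : γ n ^ 2 ≤ 1 := by nlinarith
  have hTn : T n ≤ 2 ^ n := by
    have h : γ n ^ 2 * 2 ^ n ≤ (1 : ℝ) * 2 ^ n := by gcongr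
    have : (0 : ℝ) ≤ T n := Nat.cast_nonneg _
    have : (T n : ℝ) ≤ 2 ^ n := by linarith
    exact_mod_cast this
  -- the lower bound on `γ` makes room for the additive constant
  have hγ2 : 10000 ≤ γ n ^ 2 * 2 ^ n := by
    have h : (100 * (2 : ℝ) ^ (-(n : ℝ) / 2)) ^ 2 ≤ γ n ^ 2 := pow_le_pow_left₀ (by positivity) h1 2
    have e : ((2 : ℝ) ^ (-(n : ℝ) / 2)) ^ 2 * 2 ^ n = 1 := by
      rw [← Real.rpow_natCast, ← Real.rpow_mul (by norm_num), ← Real.rpow_natCast 2 n,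
        ← Real.rpow_add (by norm_num)]
      norm_num
    calc (10000 : ℝ) = (100 * (2 : ℝ) ^ (-(n : ℝ) / 2)) ^ 2 * 2 ^ n := by
          rw [mul_pow, mul_assoc, e]
          norm_num
      _ ≤ _ := by gcongr
  have hsize' : ((Q n).size : ℝ) ≤ T n := by exact_mod_cast hsize
  obtain ⟨hlen, hout⟩ := hP n hn hTn
  refine ⟨⟨QLearn.wf_tester hWF, hlen, hout⟩, ?_⟩
  exact QLearn.naturalTester_correct hWF (QLearn.isGap_gap _ _) hγ0 hγ1 (by linarith) h4
    fun f hf => le_trans (by norm_num at h3 ⊢; linarith) (hlearn f hf)
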